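/- Let $d\ge 1$ be an integer, let $I=[a,b]$ be a compact interval with $a<b$, let $p,q,r\in[2,\infty]$ and $\alpha\in\mathbb R$ (with $1/\infty=0$). For a Schwartz function $f:\mathbb R^d\to\mathbb C$ put $\widehat f(\xi)=\int f(y)e^{-i\langle y,\xi\rangle}\,dy$ and let $$Uf(x,t)=\frac1{(2\pi)^d}\int_{\mathbb R^d}\widehat f(\xi)\,e^{-it|\xi|^2+i\langle x,\xi\rangle}\,d\xi$$ be the solution of $i\partial_tu+\Delta u=0$, $u(\cdot,0)=f$. For a function $m$ on $\mathbb R^d$ let $m(D)f=(m\widehat f\,)^\vee$. Write $$\|u\|_{L^q(\mathbb R^d;L^r(I))}=\Big(\int_{\mathbb R^d}\Big(\int_I|u(x,t)|^r\,dt\Big)^{q/r}dx\Big)^{1/q}$$ (with essential suprema if $q=\infty$ or $r=\infty$) and $\|f\|_{L^p_\alpha}=\|(I-\Delta)^{\alpha/2}f\|_{L^p(\mathbb R^d)}$, where $(I-\Delta)^{\alpha/2}=m(D)$ with $m(\xi)=(1+|\xi|^2)^{\alpha/2}$. Suppose that there is a finite constant $C$ such that $$\|Uf\|_{L^q(\mathbb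 R^d;L^r(I))}\le C\,\|f\|_{L^p_\alpha(\mathbb R^d)}$$ for all Schwartz functions $f$ (in particular, this is so if the inequality holds for all $f\in L^p_\alpha(\mathbb R^d)$). Then 1. $p\le q$; 2. $\alpha\ge d\big(1-\frac1p-\frac1q\big)-\frac2r$; 3. $\alpha\ge\frac1q-\frac1r$; 4. $\alpha\ge\frac1q-\frac1p$; 5. $\alpha>\frac1q-\frac1p$ if $r>2$; 6. $\alpha>0$ if $r=2$, $p=q>2$ and $d\ge2$. The same conclusions hold if, for some $\nu\in(0,\infty]$, the Sobolev norm $\|f\|_{L^p_\alpha}$ in the hypothesis is replaced by the Besov norm $$\|f\|_{B^p_{\alpha,\nu}}=\Big(\sum_{k\ge0}2^{k\alpha\nu}\|P_kf\|_{L^p(\mathbb R^d)}^\nu\Big)^{1/\nu}$$ (the supremum of $2^{k\alpha}\|P_kf\|_{L^p(\mathbb R^d)}$ over $k\ge 0$ if $\nu=\infty$). Here $P_0=\chi(D)$ and $P_k=\chi(2^{-k}D)-\chi(2^{-(k-1)}D)$ for $k\ge1$, where $\chi\in C^\infty(\mathbb R^d)$ is any real-valued function with $\chi(\xi)=1$ for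 $|\xi|\le1$ and $\chi(\xi)=0$ for $|\xi|\ge2$. -/

import Mathlib

open MeasureTheory
open scoped ENNReal NNReal SchwartzMap ContDiff

noncomputable section

namespace SchrodingerSpaceTime

/-- The Euclidean space `ℝ^d`. -/
abbrev Space (d : ℕ) : Type := EuclideanSpace ℝ (Fin d)

/-- The Fourier transform `f̂(ξ) = ∫ f(y) e^{-i⟨y,ξ⟩} dy`. -/
def hat {d : ℕ} (f : Space d → ℂ) (ξ : Space d) : ℂ :=
  ∫ y : Space d, f y * Complex.exp (-Complex.I * (inner ℝ y ξ : ℝ))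

/-- The solution operator of `i ∂ₜ u + Δ u = 0`, `u(·,0) = f`, for Schwartz `f`:
`U f(x,t) = (2π)^{-d} ∫ f̂(ξ) e^{-it|ξ|² + i⟨x,ξ⟩} dξ`. -/
def U {d : ℕ} (f : 𝓢(Space d, ℂ)) (x : Space d) (t : ℝ) : ℂ :=
  ((2 * Real.pi : ℝ) : ℂ)⁻¹ ^ d *
    ∫ ξ : Space d, hat f ξ *
      Complex.exp (-Complex.I * t * (‖ξ‖ ^ 2 : ℝ) + Complex.I * (inner ℝ x ξ : ℝ))

/-- The Fourier multiplier operator `m(D)`, `m(D) f = (m f̂)^∨`, on Schwartz functions. -/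
def multiplier {d : ℕ} (m : Space d → ℝ) (f : 𝓢(Space d, ℂ)) (x : Space d) : ℂ :=
  ((2 * Real.pi : ℝ) : ℂ)⁻¹ ^ d *
    ∫ ξ : Space d, (m ξ : ℂ) * hat f ξ * Complex.exp (Complex.I * (inner ℝ x ξ : ℝ))

/-- The Sobolev norm `‖f‖_{L^p_α} = ‖(I - Δ)^{α/2} f‖_{L^p(ℝ^d)}`;
`(I - Δ)^{α/2}` is the multiplier operator with symbol `(1 + |ξ|²)^{α/2}`. -/
def sobolevNorm {d : ℕ} (p : ℝ≥0∞) (α : ℝ) (f : 𝓢(Space d, ℂ)) : ℝ≥0∞ :=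
  eLpNorm (multiplier (fun ξ => (1 + ‖ξ‖ ^ 2) ^ (α / 2)) f) p volume

/-- A smooth cutoff, equal to `1` on the closed unit ball and vanishing for `|ξ| ≥ 2`. -/
structure IsCutoff {d : ℕ} (χ : Space d → ℝ) : Prop where
  contDiff : ContDiff ℝ ∞ χ
  eq_one : ∀ ξ, ‖ξ‖ ≤ 1 → χ ξ = 1
  eq_zero : ∀ ξ, 2 ≤ ‖ξ‖ → χ ξ = 0

/-- The symbols of the Littlewood–Paley operators `P_k`. For `k ≥ 1` the symbol is
`χ(2^{-k} ξ) - χ(2^{-(k-1)} ξ)`, supported in `2^{k-1} ≤ |ξ| ≤ 2^{k+1}`, and `P_0 = χ(D)`, which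
is `I - ∑_{k ≥ 1} P_k` because the sum telescopes. -/
def dyadicSymbol {d : ℕ} (χ : Space d → ℝ) : ℕ → Space d → ℝ
  | 0, ξ => χ ξ
  | k + 1, ξ => χ ((2 ^ (k + 1) : ℝ)⁻¹ • ξ) - χ ((2 ^ k : ℝ)⁻¹ • ξ)

/-- The Besov norm `‖f‖_{B^p_{α,ν}} = (∑_{k ≥ 0} 2^{kαν} ‖P_k f‖_p^ν)^{1/ν}`, `0 < ν ≤ ∞`
(the supremum over `k` if `ν = ∞`): the `ℓ^ν` norm of the sequence `2^{kα} ‖P_k f‖_p`. -/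
def besovNorm {d : ℕ} (χ : Space d → ℝ) (p : ℝ≥0∞) (α : ℝ) (ν : ℝ≥0∞)
    (f : 𝓢(Space d, ℂ)) : ℝ≥0∞ :=
  eLpNorm (fun k : ℕ => (2 : ℝ≥0∞) ^ ((k : ℝ) * α) *
    eLpNorm (multiplier (dyadicSymbol χ k) f) p volume) ν Measure.count

/-- The mixed norm `‖u‖_{L^q(ℝ^d; L^r([a,b]))}`: the `L^r([a,b])` norm in `t` for fixed `x`,
followed by the `L^q(ℝ^d)` norm in `x`. -/
def mixedNorm {d : ℕ} (q r : ℝ≥0∞) (a b : ℝ) (u : Space d → ℝ → ℂ) : ℝ≥0∞ :=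
  eLpNorm (fun x : Space d => eLpNorm (u x) r (volume.restrict (Set.Icc a b))) q volume

/-- `‖U f‖_{L^q(ℝ^d; L^r([a,b]))} ≤ C ‖f‖_{L^p_α}` for all Schwartz `f`, with some finite `C`. -/
def SobolevEstimate (d : ℕ) (p q r : ℝ≥0∞) (α a b : ℝ) : Prop :=
  ∃ C : ℝ≥0, ∀ f : 𝓢(Space d, ℂ), mixedNorm q r a b (U f) ≤ C * sobolevNorm p α f

/-- `‖U f‖_{L^q(ℝ^d; L^r([a,b]))} ≤ C ‖f‖_{B^p_{α,ν}}` for all Schwartz `f`, with some finite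
`C`; the Besov norm is the one built from the cutoff `χ`. -/
def BesovEstimate (d : ℕ) (χ : Space d → ℝ) (p q r : ℝ≥0∞) (α : ℝ) (ν : ℝ≥0∞) (a b : ℝ) :
    Prop :=
  ∃ C : ℝ≥0, ∀ f : 𝓢(Space d, ℂ), mixedNorm q r a b (U f) ≤ C * besovNorm χ p α ν f

end SchrodingerSpaceTime

end

open MeasureTheory
open scoped ENNReal NNReal SchwartzMap ContDiff

noncomputable section

namespace SchrodingerSpaceTime

open scoped FourierTransform

variable {d : ℕ}

/-! Each condition comes from testing the inequality on explicit data with frequencies in one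
annulus `2^j ≤ |ξ| ≤ 2^(j+1)`. On such data the order `α` acts only through a factor of size
`2^(jα)`, so the Sobolev and the Besov hypothesis both imply `FrequencyEstimate`, and everything
else is derived from that. Write `l = 2^j`.

Condition 2 (`FrequencyEstimate.focusing`) uses data with Fourier transform `β(ξ/l) e^{i t₀|ξ|²}`,
`t₀ ≠ 0`. Dispersion makes them bounded at time `0`, with `L^p` norm `O(l^(d/p))`, while at time
`t₀` they focus to height `l^d` on a ball of radius about `1/l`, for a time about `l^(-2)`.

The other conditions use sums of `N` wave packets of unit width. An evolved packet is bounded below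
on its tube `|x - x₀ - 2tξ₀| ≤ 1/2` for `t` near `t₀`. If the starting points are separated, the sum
has `L^p` norm `O(N^(1/p))` for every choice of signs, and some choice makes its `L²` norm over the
union of the tubes at least that of the square function. Hölder's inequality then gives
`FrequencyEstimate.packet_inequality`, which reads `N ≲ M^(1-2/r) V^(1-2/q) l^(2α) N^(2/p)` for a
time interval of fixed length. Here `V` bounds the volume swept in `x`, and `M` bounds the time
during which a given point is covered. The choices are: - `N` parallel packets of fixed frequency,
`M ~ 1`, `V ~ N`: condition 1; - one packet, `M ~ 1/l`, `V ~ l`: condition 3; - `l = 2^(2m)` packets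
along Besicovitch–Keich lines in a plane spanned by one space direction and time, `M ~ 1/m`, `V ~
l`: this gives `l^(2/q-2/p-2α) ≲ m^(-(1-2/r))`, hence condition 4, and condition 5 when `r > 2`; -
about `l²` packets, about `l` of them on each of `l` Besicovitch–Keich lines in a plane of two space
directions, `M ~ 1`, `V ~ l²/m`: for `p = q > 2` and `r = 2` this excludes `α ≤ 0`, which is
condition 6.

The Besicovitch–Keich lines are `x ↦ ∑ ε_i 2^{-(i+1)} (x - z_i)` with binary digits `ε_i` and
decreasing nodes `z_i`. Over the interval of the nodes they overlap so much that each slice has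
small measure (`exists_keich_cover`); away from it they are separated (`le_abs_digitSum_sub`). -/

/-- Fourier synthesis: the inverse of `hat`. -/
def synth (ψ : Space d → ℂ) (x : Space d) : ℂ :=
  ((2 * Real.pi : ℝ) : ℂ)⁻¹ ^ d *
    ∫ ξ : Space d, ψ ξ * Complex.exp (Complex.I * (inner ℝ x ξ : ℝ))

/-- The Schrödinger evolution expressed through the Fourier transform of the datum. -/
def evol (ψ : Space d → ℂ) (x : Space d) (t : ℝ) : ℂ :=
  ((2 * Real.pi : ℝ) : ℂ)⁻¹ ^ d *
    ∫ ξ : Space d, ψ ξ *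
      Complex.exp (-Complex.I * t * (‖ξ‖ ^ 2 : ℝ) + Complex.I * (inner ℝ x ξ : ℝ))

/-! ### Fourier inversion, Plancherel and continuity in the present normalisation. -/

lemma hat_eq_fourier (f : Space d → ℂ) (ξ : Space d) :
    hat f ξ = 𝓕 f ((2 * Real.pi)⁻¹ • ξ) := by
  rw [hat, Real.fourier_eq']
  refine integral_congr_ae (Filter.Eventually.of_forall fun y => ?_)
  simp only [smul_eq_mul, inner_smul_right]
  rw [mul_comm]
  congr 2
  have : (Real.pi : ℂ) ≠ 0 := by exact_mod_cast Real.pi_ne_zero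
  push_cast
  field_simp

lemma synth_eq_fourierInv (ψ : Space d → ℂ) (x : Space d) :
    synth ψ x = 𝓕⁻ (fun η : Space d => ψ ((2 * Real.pi) • η)) x := by
  have h := Measure.integral_comp_smul (volume : Measure (Space d))
    (fun ξ => ψ ξ * Complex.exp (Complex.I * (inner ℝ x ξ : ℝ))) (2 * Real.pi)
  rw [Real.fourierInv_eq', synth]
  have h2 : (∫ v : Space d, Complex.exp (↑(2 * Real.pi * inner ℝ v x) * Complex.I) •
      ψ ((2 * Real.pi) • v)) = ∫ v : Space d, ψ ((2 * Real.pi) • v) *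
        Complex.exp (Complex.I * (inner ℝ x ((2 * Real.pi) • v) : ℝ)) := by
    refine integral_congr_ae (Filter.Eventually.of_forall fun y => ?_)
    simp only [smul_eq_mul, inner_smul_right]
    rw [mul_comm, real_inner_comm, mul_comm Complex.I]
  rw [h2, h, finrank_euclideanSpace_fin]
  rw [abs_of_pos (by positivity), Complex.real_smul]
  congr 1
  push_cast
  rw [inv_pow]

/-- The Schwartz function with prescribed Fourier transform. -/
def invHat (ψ : 𝓢(Space d, ℂ)) : 𝓢(Space d, ℂ) :=
  𝓕⁻ (SchwartzMap.compCLMOfContinuousLinearEquiv ℂ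
    (ContinuousLinearEquiv.smulLeft (Units.mk0 (2 * Real.pi) (by positivity)) :
      Space d ≃L[ℝ] Space d) ψ)

lemma invHat_eq_synth (ψ : 𝓢(Space d, ℂ)) : (invHat ψ : Space d → ℂ) = synth ψ := by
  funext x
  rw [synth_eq_fourierInv, invHat, SchwartzMap.fourierInv_coe]
  rfl

lemma hat_invHat (ψ : 𝓢(Space d, ℂ)) : hat (invHat ψ) = ψ := by
  funext ξ
  rw [hat_eq_fourier, invHat, ← SchwartzMap.fourier_coe, FourierTransform.fourier_fourierInv_eq]
  simp only [SchwartzMap.compCLMOfContinuousLinearEquiv_apply, Function.comp_apply]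
  congr 1
  change (2 * Real.pi) • ((2 * Real.pi)⁻¹ • ξ) = ξ
  rw [smul_smul, mul_inv_cancel₀ (by positivity), one_smul]

lemma integral_norm_sq_invHat (ψ : 𝓢(Space d, ℂ)) :
    ∫ x, ‖invHat ψ x‖ ^ 2 = ((2 * Real.pi) ^ d)⁻¹ * ∫ ξ, ‖ψ ξ‖ ^ 2 := by
  rw [← SchwartzMap.integral_norm_sq_fourier, invHat, FourierTransform.fourier_fourierInv_eq]
  simp only [SchwartzMap.compCLMOfContinuousLinearEquiv_apply, Function.comp_apply]
  have h := Measure.integral_comp_smul (volume : Measure (Space d))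
    (fun ξ => ‖ψ ξ‖ ^ 2) (2 * Real.pi)
  rw [finrank_euclideanSpace_fin, abs_of_pos (by positivity), smul_eq_mul] at h
  exact h

lemma norm_exp_evol (x ξ : Space d) (t : ℝ) :
    ‖Complex.exp (-Complex.I * t * (‖ξ‖ ^ 2 : ℝ) + Complex.I * (inner ℝ x ξ : ℝ))‖ = 1 := by
  have : -Complex.I * t * (‖ξ‖ ^ 2 : ℝ) + Complex.I * (inner ℝ x ξ : ℝ)
      = ((-t * ‖ξ‖ ^ 2 + inner ℝ x ξ : ℝ) : ℂ) * Complex.I := by push_cast; ring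
  rw [this, Complex.norm_exp_ofReal_mul_I]

lemma norm_exp_synth (x ξ : Space d) :
    ‖Complex.exp (Complex.I * (inner ℝ x ξ : ℝ))‖ = 1 := by
  rw [mul_comm, Complex.norm_exp_ofReal_mul_I]

lemma continuous_evol {ψ : Space d → ℂ} (hc : Continuous ψ) (hi : Integrable ψ) :
    Continuous fun z : Space d × ℝ => evol ψ z.1 z.2 := by
  refine continuous_const.mul ?_
  refine continuous_of_dominated (bound := fun ξ => ‖ψ ξ‖) (fun z => ?_) (fun z => ?_) hi.norm ?_
  · exact (hc.mul (by fun_prop)).aestronglyMeasurable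
  · refine Filter.Eventually.of_forall fun ξ => ?_
    rw [norm_mul, norm_exp_evol, mul_one]
  · refine Filter.Eventually.of_forall fun ξ => ?_
    fun_prop

lemma continuous_synth {ψ : Space d → ℂ} (hc : Continuous ψ) (hi : Integrable ψ) :
    Continuous (synth ψ) := by
  refine continuous_const.mul ?_
  refine continuous_of_dominated (bound := fun ξ => ‖ψ ξ‖) (fun z => ?_) (fun z => ?_) hi.norm ?_
  · exact (hc.mul (by fun_prop)).aestronglyMeasurable
  · refine Filter.Eventually.of_forall fun ξ => ?_
    rw [norm_mul, norm_exp_synth, mul_one]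
  · refine Filter.Eventually.of_forall fun ξ => ?_
    fun_prop

/-! ### Multipliers on `L^p` and Hölder's inequality for the mixed norm. -/

/-- A continuous function is bounded everywhere by its essential supremum. -/
lemma enorm_le_eLpNorm_top {E : Type*} [NormedAddCommGroup E] {f : Space d → E}
    (hf : Continuous f) (x : Space d) : ‖f x‖ₑ ≤ eLpNorm f ⊤ volume := by
  by_contra! h
  have ho : IsOpen {y | eLpNorm f ⊤ volume < ‖f y‖ₑ} :=
    isOpen_lt continuous_const hf.enorm
  have h0 : volume {y | eLpNorm f ⊤ volume < ‖f y‖ₑ} = 0 := by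
    have := ae_le_eLpNormEssSup (f := f) (μ := (volume : Measure (Space d)))
    rw [ae_iff] at this
    simpa only [eLpNorm_exponent_top, not_le] using this
  have := (ho.measure_eq_zero_iff volume).1 h0
  exact (this ▸ h : x ∈ (∅ : Set (Space d)))

/-- Minkowski's inequality for averages of translates. -/
lemma eLpNorm_integral_translate_le {κ f : Space d → ℂ} (hκ : Continuous κ)
    (hκi : Integrable κ) (hf : Continuous f) (s : ℝ) {p : ℝ≥0∞} (hp : 1 ≤ p) :
    eLpNorm (fun x => ∫ z, κ z * f (x - s • z)) p volume ≤
      (∫⁻ z, ‖κ z‖ₑ) * eLpNorm f p volume := by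
  have hle : ∀ x, ‖∫ z, κ z * f (x - s • z)‖ₑ ≤ ∫⁻ z, ‖κ z‖ₑ * ‖f (x - s • z)‖ₑ := fun x => by
    refine (enorm_integral_le_lintegral_enorm _).trans_eq ?_
    simp only [enorm_mul]
  rcases eq_or_ne p ⊤ with rfl | hpt
  · rw [eLpNorm_exponent_top]
    refine eLpNormEssSup_le_of_ae_enorm_bound (Filter.Eventually.of_forall fun x => ?_)
    refine (hle x).trans ?_
    rw [← lintegral_mul_const _ hκ.enorm.measurable]
    exact lintegral_mono fun z => mul_le_mul_right (enorm_le_eLpNorm_top hf _) _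
  have hp0 : p ≠ 0 := (zero_lt_one.trans_le hp).ne'
  have hpr : 1 ≤ p.toReal := by
    rw [← ENNReal.toReal_one]; exact (ENNReal.toReal_le_toReal ENNReal.one_ne_top hpt).2 hp
  have hpr0 : 0 < p.toReal := by linarith
  -- Against the finite measure `|κ| dz` the bound is Jensen's inequality for the `p`-th power,
  -- followed by Tonelli and translation invariance in `x`.
  set μ := (volume : Measure (Space d)).withDensity (fun z => ‖κ z‖ₑ) with hμ
  have hμu : μ Set.univ = ∫⁻ z, ‖κ z‖ₑ := by
    rw [hμ, withDensity_apply _ MeasurableSet.univ, Measure.restrict_univ]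
  have hfin : μ Set.univ ≠ ⊤ := by
    rw [hμu]; exact hκi.2.ne
  have : IsFiniteMeasure μ := ⟨lt_top_iff_ne_top.2 hfin⟩
  have hpt2 : ∀ x, (∫⁻ z, ‖κ z‖ₑ * ‖f (x - s • z)‖ₑ) ^ p.toReal ≤
      (∫⁻ z, ‖f (x - s • z)‖ₑ ^ p.toReal ∂μ) * μ Set.univ ^ (p.toReal - 1) := fun x => by
    have hc : Continuous fun z => f (x - s • z) := by fun_prop
    have h1 := eLpNorm_le_eLpNorm_mul_rpow_measure_univ (μ := μ) hp hc.aestronglyMeasurable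
    rw [eLpNorm_one_eq_lintegral_enorm, eLpNorm_eq_lintegral_rpow_enorm_toReal hp0 hpt,
      lintegral_withDensity_eq_lintegral_mul _ hκ.enorm.measurable hc.enorm.measurable] at h1
    have h2 := ENNReal.rpow_le_rpow h1 hpr0.le
    refine h2.trans_eq ?_
    rw [ENNReal.mul_rpow_of_nonneg _ _ hpr0.le, ← ENNReal.rpow_mul, ← ENNReal.rpow_mul,
      one_div_mul_cancel hpr0.ne', ENNReal.rpow_one]
    congr 2
    simp only [ENNReal.toReal_one]
    field_simp
  have hbig : ∫⁻ x, ‖∫ z, κ z * f (x - s • z)‖ₑ ^ p.toReal ≤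
      (μ Set.univ * μ Set.univ ^ (p.toReal - 1)) * ∫⁻ x, ‖f x‖ₑ ^ p.toReal := by
    calc ∫⁻ x, ‖∫ z, κ z * f (x - s • z)‖ₑ ^ p.toReal
        ≤ ∫⁻ x, (∫⁻ z, ‖f (x - s • z)‖ₑ ^ p.toReal ∂μ) * μ Set.univ ^ (p.toReal - 1) :=
          lintegral_mono fun x => (ENNReal.rpow_le_rpow (hle x) hpr0.le).trans (hpt2 x)
      _ = (∫⁻ x, ∫⁻ z, ‖f (x - s • z)‖ₑ ^ p.toReal ∂μ) * μ Set.univ ^ (p.toReal - 1) := by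
          refine lintegral_mul_const' _ _ ?_
          exact ENNReal.rpow_ne_top_of_nonneg (by linarith) hfin
      _ = (∫⁻ z, (∫⁻ x, ‖f (x - s • z)‖ₑ ^ p.toReal) ∂μ) * μ Set.univ ^ (p.toReal - 1) := by
          rw [lintegral_lintegral_swap]
          have hc : Continuous fun y : Space d × Space d => f (y.1 - s • y.2) := by fun_prop
          exact (hc.enorm.measurable.pow_const _).aemeasurable
      _ = _ := by
          have : ∀ z : Space d, ∫⁻ x, ‖f (x - s • z)‖ₑ ^ p.toReal = ∫⁻ x, ‖f x‖ₑ ^ p.toReal :=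
            fun z => lintegral_sub_right_eq_self (fun x => ‖f x‖ₑ ^ p.toReal) (s • z)
          simp only [this, lintegral_const]
          ring
  have hpow : μ Set.univ * μ Set.univ ^ (p.toReal - 1) = μ Set.univ ^ p.toReal := by
    conv_lhs => rw [← ENNReal.rpow_one (μ Set.univ), ← ENNReal.rpow_mul, one_mul]
    rw [← ENNReal.rpow_add_of_nonneg _ _ zero_le_one (by linarith)]
    congr 1; ring
  rw [eLpNorm_eq_lintegral_rpow_enorm_toReal hp0 hpt, eLpNorm_eq_lintegral_rpow_enorm_toReal hp0 hpt]
  rw [hpow] at hbig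
  refine (ENNReal.rpow_le_rpow hbig (by positivity)).trans_eq ?_
  rw [ENNReal.mul_rpow_of_nonneg _ _ (by positivity), ← ENNReal.rpow_mul,
    mul_one_div_cancel hpr0.ne', ENNReal.rpow_one, hμu]

/-- Fourier multipliers given by dilates of a fixed Schwartz symbol act as averages of
translates. -/
lemma synth_dilate_mul (χ ψ : 𝓢(Space d, ℂ)) (s : ℝ) (x : Space d) :
    synth (fun ξ => χ (s • ξ) * ψ ξ) x = ∫ z, invHat χ z * synth ψ (x - s • z) := by
  have h1 : ∀ ξ, χ (s • ξ) = ∫ z, invHat χ z * Complex.exp (-Complex.I * (inner ℝ z (s • ξ) : ℝ)) :=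
    fun ξ => by conv_lhs => rw [← hat_invHat χ]
                rfl
  rw [synth]
  have h2 : ∀ z, invHat χ z * synth ψ (x - s • z) = ((2 * Real.pi : ℝ) : ℂ)⁻¹ ^ d *
      ∫ ξ, invHat χ z * Complex.exp (-Complex.I * (inner ℝ z (s • ξ) : ℝ)) * ψ ξ *
        Complex.exp (Complex.I * (inner ℝ x ξ : ℝ)) := fun z => by
    rw [synth, mul_left_comm, ← integral_const_mul]
    congr 1
    refine integral_congr_ae (Filter.Eventually.of_forall fun ξ => ?_)
    simp only [inner_sub_left, inner_smul_left, inner_smul_right, conj_trivial]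
    rw [show Complex.I * ((inner ℝ x ξ - s * inner ℝ z ξ : ℝ) : ℂ) =
      -Complex.I * ((s * inner ℝ z ξ : ℝ) : ℂ) + Complex.I * ((inner ℝ x ξ : ℝ) : ℂ) by
        push_cast; ring, Complex.exp_add]
    ring
  simp only [h2]
  rw [integral_const_mul]
  congr 1
  rw [integral_integral_swap]
  · refine integral_congr_ae (Filter.Eventually.of_forall fun ξ => ?_)
    simp only
    rw [h1, ← integral_mul_const, ← integral_mul_const]
  · have hm := (invHat χ).integrable.mul_prod (ψ.integrable (μ := (volume : Measure (Space d))))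
      (μ := (volume : Measure (Space d)))
    refine hm.congr' ?_ ?_
    · have h3 := (invHat χ).continuous
      have h4 := ψ.continuous
      refine Continuous.aestronglyMeasurable ?_
      simp only [Function.uncurry_def]
      fun_prop
    · refine Filter.Eventually.of_forall fun z => ?_
      simp only [Function.uncurry, norm_mul, norm_exp_synth]
      have : ‖Complex.exp (-Complex.I * (inner ℝ z.1 (s • z.2) : ℝ))‖ = 1 := by
        rw [neg_mul, ← mul_neg, ← Complex.ofReal_neg, mul_comm, Complex.norm_exp_ofReal_mul_I]
      rw [this]; ring

/-- The constant is the `L¹` norm of the kernel and does not depend on `s`. Hence smooth frequency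
cutoffs are bounded on `L^p` uniformly in the dyadic scale, including at `p = ∞`. -/
lemma eLpNorm_synth_dilate_mul_le (χ ψ : 𝓢(Space d, ℂ)) (s : ℝ) {p : ℝ≥0∞} (hp : 1 ≤ p) :
    eLpNorm (synth fun ξ => χ (s • ξ) * ψ ξ) p volume ≤
      (∫⁻ z, ‖invHat χ z‖ₑ) * eLpNorm (synth ψ) p volume := by
  have : (synth fun ξ => χ (s • ξ) * ψ ξ) = fun x => ∫ z, invHat χ z * synth ψ (x - s • z) :=
    funext fun x => synth_dilate_mul χ ψ s x
  rw [this]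
  exact eLpNorm_integral_translate_le (invHat χ).continuous (invHat χ).integrable
    (continuous_synth ψ.continuous ψ.integrable) s hp

/-- Hölder's inequality: a lower bound for the mixed norm by a space-time `L²` norm. -/
lemma lintegral_sq_le_mixedNorm {q r : ℝ≥0∞} (hq : 2 ≤ q) (hr : 2 ≤ r) {a b : ℝ}
    {u : Space d → ℝ → ℂ} (hu : Continuous fun z : Space d × ℝ => u z.1 z.2)
    {Ω : Set (Space d × ℝ)} (hΩ : MeasurableSet Ω) {X : Set (Space d)} (hX : MeasurableSet X)
    {M : ℝ≥0} (hΩX : ∀ z ∈ Ω, z.1 ∈ X ∧ z.2 ∈ Set.Icc a b)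
    (hM : ∀ x ∈ X, volume {t | (x, t) ∈ Ω} ≤ M) :
    ∫⁻ z in Ω, ‖u z.1 z.2‖ₑ ^ 2 ≤
      (M : ℝ≥0∞) ^ (1 - 2 * r⁻¹.toReal) * volume X ^ (1 - 2 * q⁻¹.toReal) *
        mixedNorm q r a b u ^ 2 := by
  have hinv : ∀ {s : ℝ≥0∞}, 2 ≤ s → 0 ≤ 1 / 2 - s⁻¹.toReal := fun {s} hs => by
    have : s⁻¹.toReal ≤ (2⁻¹ : ℝ≥0∞).toReal :=
      ENNReal.toReal_mono (by simp) (ENNReal.inv_le_inv.2 hs)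
    simp only [ENNReal.toReal_inv, ENNReal.toReal_ofNat] at this ⊢
    linarith
  have hS : ∀ x, MeasurableSet {t | (x, t) ∈ Ω} := fun x => measurable_prodMk_left hΩ
  set F : Space d × ℝ → ℝ≥0∞ := Ω.indicator (fun z => ‖u z.1 z.2‖ₑ ^ 2) with hF
  have hFm : Measurable F := (hu.enorm.measurable.pow_const 2).indicator hΩ
  set B : Space d → ℝ≥0∞ := fun x => (∫⁻ t, F (x, t)) ^ (1 / 2 : ℝ) with hB
  have hBm : Measurable B := (Measurable.lintegral_prod_right' hFm).pow_const _
  have hB2 : ∀ x, B x ^ 2 = ∫⁻ t, F (x, t) := fun x => by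
    simp only [hB]
    rw [← ENNReal.rpow_natCast, ← ENNReal.rpow_mul]
    norm_num
  have hFx : ∀ x, ∫⁻ t, F (x, t) = ∫⁻ t in {t | (x, t) ∈ Ω}, ‖u x t‖ₑ ^ 2 := fun x => by
    rw [← lintegral_indicator (hS x)]
    rfl
  have hB0 : ∀ x ∉ X, B x = 0 := fun x hx => by
    have : {t | (x, t) ∈ Ω} = ∅ := by
      ext t; simp only [Set.mem_ofPred_eq, Set.mem_empty_iff_false, iff_false]
      exact fun h => hx (hΩX _ h).1
    simp [hB, hFx, this]
  have hBA : ∀ x, B x ≤ ((M ^ (1 / 2 - r⁻¹.toReal) : ℝ≥0) : ℝ≥0∞) *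
      eLpNorm (u x) r (volume.restrict (Set.Icc a b)) := fun x => by
    by_cases hx : x ∈ X
    · have hc : Continuous (u x) := by
        have : u x = (fun z : Space d × ℝ => u z.1 z.2) ∘ fun t => (x, t) := rfl
        rw [this]; fun_prop
      have h1 := eLpNorm_le_eLpNorm_mul_rpow_measure_univ
        (μ := volume.restrict {t | (x, t) ∈ Ω}) hr hc.aestronglyMeasurable
      have h2 : eLpNorm (u x) r (volume.restrict {t | (x, t) ∈ Ω}) ≤
          eLpNorm (u x) r (volume.restrict (Set.Icc a b)) :=
        eLpNorm_mono_measure _ (Measure.restrict_mono_set _ fun t ht => (hΩX _ ht).2)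
      have h3 : eLpNorm (u x) 2 (volume.restrict {t | (x, t) ∈ Ω}) = B x := by
        rw [eLpNorm_eq_lintegral_rpow_enorm_toReal (by norm_num) (by norm_num)]
        simp only [hB, hFx, ENNReal.toReal_ofNat]
        norm_cast
      rw [h3] at h1
      refine h1.trans ?_
      rw [mul_comm]
      refine mul_le_mul' ?_ h2
      rw [Measure.restrict_apply_univ, ENNReal.coe_rpow_of_nonneg _ (hinv hr)]
      -- For `r = ⊤` both `1 / r.toReal` and `r⁻¹.toReal` are `0`, so the endpoint needs no separate
      -- treatment.
      have : 1 / (2 : ℝ≥0∞).toReal - 1 / r.toReal = 1 / 2 - r⁻¹.toReal := by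
        simp [ENNReal.toReal_inv]
      rw [this]
      exact ENNReal.rpow_le_rpow (hM x hx) (hinv hr)
    · rw [hB0 x hx]; exact zero_le
  have hq2 : eLpNorm B q volume ≤ ((M ^ (1 / 2 - r⁻¹.toReal) : ℝ≥0) : ℝ≥0∞) *
      mixedNorm q r a b u := by
    have := eLpNorm_le_nnreal_smul_eLpNorm_of_ae_le_mul' (μ := (volume : Measure (Space d)))
      (f := B) (g := fun x => eLpNorm (u x) r (volume.restrict (Set.Icc a b)))
      (c := M ^ (1 / 2 - r⁻¹.toReal)) (Filter.Eventually.of_forall fun x => by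
        simpa only [enorm_eq_self] using hBA x) q
    rwa [ENNReal.smul_def, smul_eq_mul] at this
  have h22 : eLpNorm B 2 (volume.restrict X) ≤ eLpNorm B q volume *
      volume X ^ (1 / 2 - q⁻¹.toReal) := by
    have h1 := eLpNorm_le_eLpNorm_mul_rpow_measure_univ (μ := volume.restrict X) hq
      hBm.aestronglyMeasurable
    have : 1 / (2 : ℝ≥0∞).toReal - 1 / q.toReal = 1 / 2 - q⁻¹.toReal := by
      simp [ENNReal.toReal_inv]
    rw [Measure.restrict_apply_univ, this] at h1
    exact h1.trans (mul_le_mul_left (eLpNorm_mono_measure _ Measure.restrict_le_self) _)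
  have hmain : ∫⁻ z in Ω, ‖u z.1 z.2‖ₑ ^ 2 = eLpNorm B 2 (volume.restrict X) ^ 2 := by
    rw [← lintegral_indicator hΩ, Measure.volume_eq_prod, lintegral_prod _ hFm.aemeasurable]
    rw [eLpNorm_eq_lintegral_rpow_enorm_toReal (by norm_num) (by norm_num)]
    rw [← ENNReal.rpow_natCast, ← ENNReal.rpow_mul]
    simp only [ENNReal.toReal_ofNat, enorm_eq_self]
    norm_num
    rw [← lintegral_indicator hX]
    refine lintegral_congr fun x => ?_
    by_cases hx : x ∈ X
    · rw [Set.indicator_of_mem hx, hB2]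
    · rw [Set.indicator_of_notMem hx, ← hB2, hB0 x hx]; norm_num
  rw [hmain]
  calc eLpNorm B 2 (volume.restrict X) ^ 2
      ≤ (((M ^ (1 / 2 - r⁻¹.toReal) : ℝ≥0) : ℝ≥0∞) * mixedNorm q r a b u *
        volume X ^ (1 / 2 - q⁻¹.toReal)) ^ 2 := by
        gcongr
        exact h22.trans (mul_le_mul_left hq2 _)
    _ = _ := by
        rw [ENNReal.coe_rpow_of_nonneg _ (hinv hr), mul_pow, mul_pow]
        simp only [← ENNReal.rpow_natCast, ← ENNReal.rpow_mul]
        rw [show (1 / 2 - r⁻¹.toReal) * ((2 : ℕ) : ℝ) = 1 - 2 * r⁻¹.toReal by push_cast; ring,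
          show (1 / 2 - q⁻¹.toReal) * ((2 : ℕ) : ℝ) = 1 - 2 * q⁻¹.toReal by push_cast; ring]
        ring

/-! ### Reduction to one dyadic frequency annulus. -/

/-- The space-time estimate for data with frequencies in the annulus `2^j ≤ |ξ| ≤ 2^(j+1)`,
composed with a multiplier `w` bounded below by a multiple of `2^(-jα)` there. -/
def FrequencyEstimate (d : ℕ) (p q r : ℝ≥0∞) (α a b : ℝ) : Prop :=
  ∃ (C : ℝ≥0) (c : ℝ), 0 < c ∧ ∀ j : ℕ, ∃ w : Space d → ℝ, ContDiff ℝ ∞ w ∧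
    (∀ ξ, 2 ^ j ≤ ‖ξ‖ → ‖ξ‖ ≤ 2 ^ (j + 1) → c * (2 : ℝ) ^ (-(j * α)) ≤ w ξ) ∧
    ∀ ψ : 𝓢(Space d, ℂ), (∀ ξ, ψ ξ ≠ 0 → 2 ^ j ≤ ‖ξ‖ ∧ ‖ξ‖ ≤ 2 ^ (j + 1)) →
      mixedNorm q r a b (evol fun ξ => (w ξ : ℂ) * ψ ξ) ≤ C * eLpNorm (synth ψ) p volume

lemma hasCompactSupport_of_norm_le {E : Type*} [Zero E] {f : Space d → E} {R : ℝ}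
    (h : ∀ ξ, f ξ ≠ 0 → ‖ξ‖ ≤ R) : HasCompactSupport f :=
  HasCompactSupport.intro (isCompact_closedBall (0 : Space d) R) fun x hx => by
    by_contra h0
    exact hx (by simpa using h x h0)

/-- The weight is the Bessel potential symbol: the datum with Fourier transform `w ψ` has Sobolev
norm exactly `‖synth ψ‖_p`. -/
lemma FrequencyEstimate.of_sobolev {p q r : ℝ≥0∞} {α a b : ℝ}
    (h : SobolevEstimate d p q r α a b) : FrequencyEstimate d p q r α a b := by
  obtain ⟨C, hC⟩ := h
  -- On the annulus `4^j ≤ 1 + |ξ|² ≤ 5 · 4^j`; the lower bound serves `α ≤ 0`, the upper bound `α ≥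
  -- 0`.
  refine ⟨C, min 1 (5 ^ (-(α / 2))), by positivity, fun j => ?_⟩
  have hw : ContDiff ℝ ∞ fun ξ : Space d => (1 + ‖ξ‖ ^ 2) ^ (-(α / 2)) :=
    (contDiff_const.add (contDiff_norm_sq ℝ)).rpow_const_of_ne fun ξ => by positivity
  refine ⟨fun ξ => (1 + ‖ξ‖ ^ 2) ^ (-(α / 2)), hw, fun ξ h1 h2 => ?_, fun ψ hψ => ?_⟩
  · have h4 : (2 : ℝ) ^ (-(j * α)) = ((4 : ℝ) ^ j) ^ (-(α / 2)) := by
      rw [← Real.rpow_natCast, ← Real.rpow_mul (by norm_num), show (4 : ℝ) = 2 ^ (2 : ℝ) by norm_num,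
        ← Real.rpow_mul (by norm_num)]
      congr 1; ring
    have hpos : (0 : ℝ) < 4 ^ j := by positivity
    have hsq1 : (4 : ℝ) ^ j ≤ ‖ξ‖ ^ 2 := by
      calc (4 : ℝ) ^ j = (2 ^ j) ^ 2 := by rw [← pow_mul, mul_comm, pow_mul]; norm_num
        _ ≤ _ := by gcongr
    have hsq2 : ‖ξ‖ ^ 2 ≤ 4 * 4 ^ j := by
      calc ‖ξ‖ ^ 2 ≤ (2 ^ (j + 1)) ^ 2 := by gcongr
        _ = _ := by rw [← pow_mul, mul_comm, pow_mul]; norm_num [pow_succ]; ring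
    have h1j : (1 : ℝ) ≤ 4 ^ j := one_le_pow₀ (by norm_num)
    rw [h4]
    rcases le_total α 0 with hα | hα
    · calc min 1 (5 ^ (-(α / 2))) * ((4 : ℝ) ^ j) ^ (-(α / 2)) ≤ 1 * ((4 : ℝ) ^ j) ^ (-(α / 2)) := by
            gcongr; exact min_le_left _ _
        _ = ((4 : ℝ) ^ j) ^ (-(α / 2)) := one_mul _
        _ ≤ _ := Real.rpow_le_rpow hpos.le (by linarith) (by linarith)
    · calc min 1 (5 ^ (-(α / 2))) * ((4 : ℝ) ^ j) ^ (-(α / 2)) ≤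
            5 ^ (-(α / 2)) * ((4 : ℝ) ^ j) ^ (-(α / 2)) := by
            gcongr; exact min_le_right _ _
        _ = (5 * (4 : ℝ) ^ j) ^ (-(α / 2)) := (Real.mul_rpow (by norm_num) hpos.le).symm
        _ ≤ _ := Real.rpow_le_rpow_of_nonpos (by positivity) (by linarith) (by linarith)
  · have hcs : HasCompactSupport fun ξ => (((1 + ‖ξ‖ ^ 2) ^ (-(α / 2)) : ℝ) : ℂ) * ψ ξ :=
      (hasCompactSupport_of_norm_le (f := ψ) fun ξ hξ => (hψ ξ hξ).2).mul_left
    have hsm : ContDiff ℝ ∞ fun ξ => (((1 + ‖ξ‖ ^ 2) ^ (-(α / 2)) : ℝ) : ℂ) * ψ ξ :=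
      (Complex.ofRealCLM.contDiff.comp hw).mul (ψ.smooth ⊤)
    have := hC (invHat (hcs.toSchwartzMap hsm))
    have e1 : U (invHat (hcs.toSchwartzMap hsm)) =
        evol fun ξ => (((1 + ‖ξ‖ ^ 2) ^ (-(α / 2)) : ℝ) : ℂ) * ψ ξ := by
      funext x t
      simp only [U, hat_invHat, evol]
      rfl
    have e2 : multiplier (fun ξ => (1 + ‖ξ‖ ^ 2) ^ (α / 2)) (invHat (hcs.toSchwartzMap hsm)) =
        synth ψ := by
      funext x
      simp only [multiplier, hat_invHat, synth]
      congr 1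
      refine integral_congr_ae (Filter.Eventually.of_forall fun ξ => ?_)
      change (((1 + ‖ξ‖ ^ 2) ^ (α / 2) : ℝ) : ℂ) *
        ((((1 + ‖ξ‖ ^ 2) ^ (-(α / 2)) : ℝ) : ℂ) * ψ ξ) * _ = ψ ξ * _
      rw [← mul_assoc, ← Complex.ofReal_mul, ← Real.rpow_add (by positivity), add_neg_cancel,
        Real.rpow_zero, Complex.ofReal_one, one_mul]
    rwa [e1, sobolevNorm, e2] at this

lemma synth_sub {ψ φ : Space d → ℂ} (hψ : Integrable ψ) (hφ : Integrable φ) :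
    synth (fun ξ => ψ ξ - φ ξ) = synth ψ - synth φ := by
  funext x
  have hb : ∀ {f : Space d → ℂ}, Integrable f →
      Integrable fun ξ => f ξ * Complex.exp (Complex.I * (inner ℝ x ξ : ℝ)) := fun {f} hf => by
    refine hf.mul_bdd (c := 1) (Continuous.aestronglyMeasurable (by fun_prop)) ?_
    exact Filter.Eventually.of_forall fun ξ => (norm_exp_synth x ξ).le
  rw [Pi.sub_apply, synth, synth, synth, ← mul_sub, ← integral_sub (hb hψ) (hb hφ)]
  simp only [sub_mul]

lemma synth_const_mul (c : ℂ) (ψ : Space d → ℂ) : synth (fun ξ => c * ψ ξ) = c • synth ψ := by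
  funext x
  simp only [synth, Pi.smul_apply, smul_eq_mul, mul_assoc, integral_const_mul]
  ring

/-- On a function with frequencies in the annulus `2^j ≤ |ξ| ≤ 2^(j+1)` only two
Littlewood–Paley pieces are nonzero. -/
lemma dyadicSymbol_of_annulus {χ : Space d → ℝ} (hχ : IsCutoff χ) {j : ℕ} {ξ : Space d}
    (h1 : 2 ^ j ≤ ‖ξ‖) (h2 : ‖ξ‖ ≤ 2 ^ (j + 1)) (k : ℕ) :
    dyadicSymbol χ k ξ = if k = j then χ ((2 ^ j : ℝ)⁻¹ • ξ) else
      if k = j + 1 then 1 - χ ((2 ^ j : ℝ)⁻¹ • ξ) else 0 := by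
  have hn : ∀ k : ℕ, ‖(2 ^ k : ℝ)⁻¹ • ξ‖ = ‖ξ‖ / 2 ^ k := fun k => by
    rw [norm_smul, norm_inv, Real.norm_of_nonneg (by positivity)]; ring
  have hlo : ∀ k : ℕ, k < j → χ ((2 ^ k : ℝ)⁻¹ • ξ) = 0 := fun k hk => by
    refine hχ.eq_zero _ ?_
    rw [hn, le_div_iff₀ (by positivity)]
    calc (2 : ℝ) * 2 ^ k = 2 ^ (k + 1) := by ring
      _ ≤ 2 ^ j := pow_le_pow_right₀ (by norm_num) hk
      _ ≤ _ := h1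
  have hhi : ∀ k : ℕ, j < k → χ ((2 ^ k : ℝ)⁻¹ • ξ) = 1 := fun k hk => by
    refine hχ.eq_one _ ?_
    rw [hn, div_le_one (by positivity)]
    exact h2.trans (pow_le_pow_right₀ (by norm_num) hk)
  cases k with
  | zero =>
    have h0 : dyadicSymbol χ 0 ξ = χ ((2 ^ 0 : ℝ)⁻¹ • ξ) := by simp [dyadicSymbol]
    rw [h0]
    rcases Nat.eq_zero_or_pos j with rfl | hj
    · simp
    · rw [hlo 0 hj, if_neg (by omega), if_neg (by omega)]
  | succ k =>
    rw [dyadicSymbol]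
    rcases lt_trichotomy (k + 1) j with h | h | h
    · rw [hlo _ h, hlo k (by omega), if_neg (by omega), if_neg (by omega), sub_zero]
    · rw [hlo k (by omega), if_pos h, sub_zero, h]
    · rw [if_neg (by omega), hhi _ h]
      split_ifs with h'
      · rw [show k = j by omega]
      · rw [hhi k (by omega), sub_self]

/-- A constant weight suffices here. Only the pieces `k = j` and `k = j + 1` survive, and their
symbols on the annulus are `χ(2^{-j}ξ)` and `1 - χ(2^{-j}ξ)`, both bounded on `L^p` uniformly in
`j`. Two terms make the choice of `ν` immaterial. -/
lemma FrequencyEstimate.of_besov {χ : Space d → ℝ} (hχ : IsCutoff χ) {p q r ν : ℝ≥0∞}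
    (hp : 1 ≤ p) (hν : 0 < ν) {α a b : ℝ} (h : BesovEstimate d χ p q r α ν a b) :
    FrequencyEstimate d p q r α a b := by
  obtain ⟨C, hC⟩ := h
  have hcsχ : HasCompactSupport fun ξ => (χ ξ : ℂ) :=
    hasCompactSupport_of_norm_le (R := 2) fun ξ hξ => by
      by_contra! h2
      exact hξ (by simp [hχ.eq_zero ξ h2.le])
  set χ' := hcsχ.toSchwartzMap (Complex.ofRealCLM.contDiff.comp hχ.contDiff) with hχ'
  have hχ'a : ∀ ξ, χ' ξ = (χ ξ : ℂ) := fun ξ => rfl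
  set K : ℝ≥0∞ := ∫⁻ z, ‖invHat χ' z‖ₑ with hK
  have hKt : K ≠ ⊤ := (invHat χ').integrable.2.ne
  -- The factor `2^|α|` absorbs the weight of the index `j + 1` relative to `j`, and `2^(1/ν)` is
  -- the `ℓ^ν` norm of two ones; for `ν = ⊤` it is `2^(1/0) = 1`, as it should be.
  set D : ℝ≥0∞ := (2 : ℝ≥0∞) ^ |α| * (1 + K) * 2 ^ (1 / ν.toReal) with hD
  have hDt : D ≠ ⊤ := by
    refine ENNReal.mul_ne_top (ENNReal.mul_ne_top ?_ (by simp [hKt])) ?_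
    · exact ENNReal.rpow_ne_top_of_nonneg (abs_nonneg _) (by norm_num)
    · exact ENNReal.rpow_ne_top_of_nonneg (by positivity) (by norm_num)
  refine ⟨C * D.toNNReal, 1, one_pos, fun j => ⟨fun _ => (2 : ℝ) ^ (-(j * α)), contDiff_const,
    fun ξ _ _ => by rw [one_mul], fun ψ hψ => ?_⟩⟩
  set c : ℂ := (((2 : ℝ) ^ (-(j * α)) : ℝ) : ℂ) with hc
  have hce : ‖c‖ₑ = (2 : ℝ≥0∞) ^ (-(j * α)) := by
    rw [hc, ← ofReal_norm, Complex.norm_real, Real.norm_of_nonneg (by positivity),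
      ← ENNReal.ofReal_rpow_of_pos (by norm_num), ENNReal.ofReal_ofNat]
  have hU : U (invHat (c • ψ)) = evol fun ξ => c * ψ ξ := by
    funext x t
    simp only [U, hat_invHat, evol]
    rfl
  have hmul : ∀ k, multiplier (dyadicSymbol χ k) (invHat (c • ψ)) =
      c • synth fun ξ => (dyadicSymbol χ k ξ : ℂ) * ψ ξ := fun k => by
    rw [← synth_const_mul]
    funext x
    simp only [multiplier, hat_invHat, synth, smul_apply, smul_eq_mul]
    congr 1
    refine integral_congr_ae (Filter.Eventually.of_forall fun ξ => ?_)
    simp only; ring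
  have hsym : ∀ k ξ, (dyadicSymbol χ k ξ : ℂ) * ψ ξ =
      if k = j then χ' ((2 ^ j : ℝ)⁻¹ • ξ) * ψ ξ else
        if k = j + 1 then ψ ξ - χ' ((2 ^ j : ℝ)⁻¹ • ξ) * ψ ξ else 0 := fun k ξ => by
    by_cases h0 : ψ ξ = 0
    · simp [h0]
    · rw [dyadicSymbol_of_annulus hχ (hψ ξ h0).1 (hψ ξ h0).2 k, hχ'a]
      split_ifs
      · rfl
      · push_cast; ring
      · simp
  have hχψi : Integrable fun ξ => χ' ((2 ^ j : ℝ)⁻¹ • ξ) * ψ ξ := by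
    obtain ⟨B, hB⟩ : ∃ B, ∀ ξ, ‖χ' ξ‖ ≤ B := ⟨_, fun ξ => SchwartzMap.norm_le_seminorm ℝ χ' ξ⟩
    refine ψ.integrable.bdd_mul (c := B) (Continuous.aestronglyMeasurable ?_)
      (Filter.Eventually.of_forall fun ξ => hB _)
    have := χ'.continuous
    fun_prop
  have hψc : Continuous (synth ψ) := continuous_synth ψ.continuous ψ.integrable
  have hχψc : Continuous (synth fun ξ => χ' ((2 ^ j : ℝ)⁻¹ • ξ) * ψ ξ) := by
    refine continuous_synth ?_ hχψi
    have := χ'.continuous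
    have := ψ.continuous
    fun_prop
  have hY := eLpNorm_synth_dilate_mul_le χ' ψ ((2 ^ j : ℝ)⁻¹) hp
  have hpiece : ∀ k, eLpNorm (synth fun ξ => (dyadicSymbol χ k ξ : ℂ) * ψ ξ) p volume ≤
      Set.indicator (({j, j + 1} : Finset ℕ) : Set ℕ)
        (fun _ => (1 + K) * eLpNorm (synth ψ) p volume) k := fun k => by
    simp only [hsym]
    by_cases h1 : k = j
    · simp only [h1, if_true]
      rw [Set.indicator_of_mem (by simp)]
      refine hY.trans ?_
      gcongr
      exact le_add_self
    by_cases h2 : k = j + 1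
    · rw [Set.indicator_of_mem (by simp [h2])]
      simp only [h2, if_true, if_false, Nat.succ_ne_self]
      rw [synth_sub ψ.integrable hχψi]
      refine (eLpNorm_sub_le hψc.aestronglyMeasurable hχψc.aestronglyMeasurable hp).trans ?_
      rw [add_mul, one_mul]
      gcongr
    · have h0 : synth (fun _ : Space d => (0 : ℂ)) = 0 := by funext x; simp [synth]
      simp [h1, h2, h0]
  have hbes : besovNorm χ p α ν (invHat (c • ψ)) ≤ D * eLpNorm (synth ψ) p volume := by
    rw [besovNorm]
    have hpt : ∀ k : ℕ, ‖(2 : ℝ≥0∞) ^ ((k : ℝ) * α) *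
        eLpNorm (multiplier (dyadicSymbol χ k) (invHat (c • ψ))) p volume‖ₑ ≤
        ‖Set.indicator (({j, j + 1} : Finset ℕ) : Set ℕ)
          (fun _ => (2 : ℝ≥0∞) ^ |α| * ((1 + K) * eLpNorm (synth ψ) p volume)) k‖ₑ := fun k => by
      rw [enorm_eq_self, enorm_eq_self, hmul, eLpNorm_const_smul, hce, ← mul_assoc,
        ← ENNReal.rpow_add _ _ (by norm_num) (by norm_num)]
      refine (mul_le_mul_right (hpiece k) _).trans ?_
      by_cases hk : k ∈ (({j, j + 1} : Finset ℕ) : Set ℕ)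
      · rw [Set.indicator_of_mem hk, Set.indicator_of_mem hk]
        gcongr
        · norm_num
        · have : k = j ∨ k = j + 1 := by simpa using hk
          rcases this with rfl | rfl
          · simp
          · push_cast; linarith [le_abs_self α]
      · rw [Set.indicator_of_notMem hk, mul_zero]; exact zero_le
    refine (eLpNorm_mono_enorm hpt).trans_eq ?_
    rw [eLpNorm_indicator_const' (Finset.measurableSet _) _ hν.ne', Measure.count_apply_finset,
      Finset.card_pair (by omega), enorm_eq_self, hD]
    · push_cast; ring
    · rw [Measure.count_apply_finset, Finset.card_pair (by omega)]; norm_num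
  have := hC (invHat (c • ψ))
  rw [hU] at this
  refine this.trans ?_
  rw [ENNReal.coe_mul, ENNReal.coe_toNNReal hDt, mul_assoc]
  gcongr

/-! ### Wave packets: lower bounds, superposition and random signs. -/

/-- An oscillatory integral with nonnegative amplitude and nearly constant phase does not
cancel. -/
lemma cos_one_mul_integral_le_norm {h θ : Space d → ℝ} (hi : Integrable h) (h0 : ∀ ξ, 0 ≤ h ξ)
    (hθ : Continuous θ) (hb : ∀ ξ, h ξ ≠ 0 → |θ ξ| ≤ 1) :
    Real.cos 1 * ∫ ξ, h ξ ≤ ‖∫ ξ, (h ξ : ℂ) * Complex.exp (θ ξ * Complex.I)‖ := by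
  have hint : Integrable fun ξ => (h ξ : ℂ) * Complex.exp (θ ξ * Complex.I) := by
    refine hi.ofReal.mul_bdd (c := 1) (Continuous.aestronglyMeasurable (by fun_prop)) ?_
    exact Filter.Eventually.of_forall fun ξ => (Complex.norm_exp_ofReal_mul_I _).le
  refine le_trans ?_ (Complex.re_le_norm _)
  rw [show (∫ ξ, (h ξ : ℂ) * Complex.exp (θ ξ * Complex.I)).re =
    ∫ ξ, ((h ξ : ℂ) * Complex.exp (θ ξ * Complex.I)).re from (integral_re hint).symm,
    ← integral_const_mul]
  refine integral_mono (hi.const_mul _) hint.re fun ξ => ?_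
  have e : ((h ξ : ℂ) * Complex.exp (θ ξ * Complex.I)).re = h ξ * Real.cos (θ ξ) := by
    rw [Complex.re_ofReal_mul, Complex.exp_ofReal_mul_I_re]
  change Real.cos 1 * h ξ ≤ ((h ξ : ℂ) * Complex.exp (θ ξ * Complex.I)).re
  rw [e, mul_comm]
  by_cases hz : h ξ = 0
  · simp [hz]
  · refine mul_le_mul_of_nonneg_left ?_ (h0 ξ)
    rw [← Real.cos_abs (θ ξ)]
    exact Real.cos_le_cos_of_nonneg_of_le_pi (abs_nonneg _) (by linarith [Real.pi_gt_three])
      (hb ξ hz)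

/-- The constant `c` is a common phase, which has modulus one and can be removed before measuring
the oscillation. -/
lemma le_norm_evol {h Θ : Space d → ℝ} (hi : Integrable h) (h0 : ∀ ξ, 0 ≤ h ξ)
    (hΘ : Continuous Θ) (c : ℝ) {x : Space d} {t : ℝ}
    (hb : ∀ ξ, h ξ ≠ 0 → |Θ ξ - t * ‖ξ‖ ^ 2 + inner ℝ x ξ - c| ≤ 1) :
    ((2 * Real.pi) ^ d)⁻¹ * (Real.cos 1 * ∫ ξ, h ξ) ≤
      ‖evol (fun ξ => (h ξ : ℂ) * Complex.exp (Θ ξ * Complex.I)) x t‖ := by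
  have h1 := cos_one_mul_integral_le_norm hi h0
    (θ := fun ξ => Θ ξ - t * ‖ξ‖ ^ 2 + inner ℝ x ξ - c) (by fun_prop) hb
  rw [evol, norm_mul, norm_pow, norm_inv, Complex.norm_real, Real.norm_of_nonneg (by positivity),
    inv_pow]
  refine mul_le_mul_of_nonneg_left (h1.trans_eq ?_) (by positivity)
  have e : ∀ ξ, (h ξ : ℂ) * Complex.exp (Θ ξ * Complex.I) *
      Complex.exp (-Complex.I * t * (‖ξ‖ ^ 2 : ℝ) + Complex.I * (inner ℝ x ξ : ℝ)) =
      Complex.exp (c * Complex.I) * ((h ξ : ℂ) *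
        Complex.exp ((Θ ξ - t * ‖ξ‖ ^ 2 + inner ℝ x ξ - c : ℝ) * Complex.I)) := fun ξ => by
    rw [mul_left_comm, mul_assoc, ← Complex.exp_add, ← Complex.exp_add]
    congr 2
    push_cast; ring
  simp only [e]
  rw [integral_const_mul, norm_mul, Complex.norm_exp_ofReal_mul_I, one_mul]

/-- A wave packet on the Fourier side, concentrated near frequency `ξ₀`, and focusing at time
`t₀` at the point `x₀ + 2 t₀ ξ₀`. -/
def packet (φ : Space d → ℝ) (t₀ : ℝ) (x₀ ξ₀ ξ : Space d) : ℂ :=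
  (φ (ξ - ξ₀) : ℂ) *
    Complex.exp ((t₀ * ‖ξ - ξ₀‖ ^ 2 - inner ℝ x₀ (ξ - ξ₀) : ℝ) * Complex.I)

lemma contDiff_packet {φ : Space d → ℝ} (hφ : ContDiff ℝ ∞ φ) (t₀ : ℝ) (x₀ ξ₀ : Space d) :
    ContDiff ℝ ∞ (packet φ t₀ x₀ ξ₀) := by
  have h1 : ContDiff ℝ ∞ fun ξ : Space d => ξ - ξ₀ := contDiff_id.sub contDiff_const
  have h2 : ContDiff ℝ ∞ fun ξ : Space d => t₀ * ‖ξ - ξ₀‖ ^ 2 - inner ℝ x₀ (ξ - ξ₀) :=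
    (contDiff_const.mul (h1.norm_sq ℝ)).sub (contDiff_const.inner ℝ h1)
  have h3 : ContDiff ℝ ∞ fun ξ : Space d => (φ (ξ - ξ₀) : ℂ) :=
    Complex.ofRealCLM.contDiff.comp (hφ.comp h1)
  have h4 : ContDiff ℝ ∞ fun ξ : Space d =>
      ((t₀ * ‖ξ - ξ₀‖ ^ 2 - inner ℝ x₀ (ξ - ξ₀) : ℝ) : ℂ) :=
    Complex.ofRealCLM.contDiff.comp h2
  exact h3.mul (h4.mul contDiff_const).cexp

lemma synth_packet (φ : Space d → ℝ) (t₀ : ℝ) (x₀ ξ₀ x : Space d) :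
    synth (packet φ t₀ x₀ ξ₀) x =
      Complex.exp (Complex.I * (inner ℝ x ξ₀ : ℝ)) * synth (packet φ t₀ 0 0) (x - x₀) := by
  rw [synth, synth, mul_left_comm, ← integral_const_mul (Complex.exp _),
    ← integral_add_right_eq_self (fun ξ => packet φ t₀ x₀ ξ₀ ξ *
      Complex.exp (Complex.I * (inner ℝ x ξ : ℝ))) ξ₀]
  congr 1
  refine integral_congr_ae (Filter.Eventually.of_forall fun ξ => ?_)
  simp only [packet, add_sub_cancel_right, sub_zero, inner_zero_left, inner_add_right,
    inner_sub_left]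
  rw [mul_left_comm, mul_assoc, mul_assoc, ← Complex.exp_add, ← Complex.exp_add,
    ← Complex.exp_add]
  congr 2
  push_cast; ring

lemma norm_synth_packet (φ : Space d → ℝ) (t₀ : ℝ) (x₀ ξ₀ x : Space d) :
    ‖synth (packet φ t₀ x₀ ξ₀) x‖ = ‖synth (packet φ t₀ 0 0) (x - x₀)‖ := by
  rw [synth_packet, norm_mul, norm_exp_synth, one_mul]

/-- Interpolation between a sup bound and an integral bound. -/
lemma eLpNorm_le_of_enorm_le {E : Type*} [NormedAddCommGroup E] {F : Space d → E} {B : ℝ≥0}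
    (hB : ∀ x, ‖F x‖ₑ ≤ B) {s : ℝ} (hs : 0 < s) {p : ℝ≥0∞} (hp : ENNReal.ofReal s ≤ p) :
    eLpNorm F p volume ≤
      (B : ℝ≥0∞) ^ (1 - s * p⁻¹.toReal) * (∫⁻ x, ‖F x‖ₑ ^ s) ^ p⁻¹.toReal := by
  rcases eq_or_ne p ⊤ with rfl | hpt
  · simp only [ENNReal.inv_top, ENNReal.toReal_zero, mul_zero, sub_zero, ENNReal.rpow_one,
      ENNReal.rpow_zero, mul_one, eLpNorm_exponent_top]
    exact eLpNormEssSup_le_of_ae_enorm_bound (Filter.Eventually.of_forall hB)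
  have hsp : s ≤ p.toReal := by
    rw [← ENNReal.toReal_ofReal hs.le]
    exact (ENNReal.toReal_le_toReal ENNReal.ofReal_ne_top hpt).2 hp
  have hp0 : 0 < p.toReal := hs.trans_le hsp
  have hp0' : p ≠ 0 := fun h => by simp [h] at hp0
  rw [eLpNorm_eq_lintegral_rpow_enorm_toReal hp0' hpt, ENNReal.toReal_inv, one_div]
  have h1 : ∫⁻ x, ‖F x‖ₑ ^ p.toReal ≤ (B : ℝ≥0∞) ^ (p.toReal - s) * ∫⁻ x, ‖F x‖ₑ ^ s := by
    rw [← lintegral_const_mul' _ _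
      (ENNReal.rpow_ne_top_of_nonneg (by linarith) ENNReal.coe_ne_top)]
    refine lintegral_mono fun x => ?_
    calc ‖F x‖ₑ ^ p.toReal = ‖F x‖ₑ ^ (p.toReal - s) * ‖F x‖ₑ ^ s := by
          rw [← ENNReal.rpow_add_of_nonneg _ _ (by linarith) hs.le]; congr 1; ring
      _ ≤ _ := by gcongr; exact hB x
  refine (ENNReal.rpow_le_rpow h1 (by positivity)).trans_eq ?_
  rw [ENNReal.mul_rpow_of_nonneg _ _ (by positivity), ← ENNReal.rpow_mul]
  congr 2
  field_simp

/-- Sums of a rapidly decaying function over separated translates are uniformly bounded. -/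
lemma exists_sum_decay_le (d : ℕ) {s : ℝ} (hs : 0 < s) : ∃ C : ℝ≥0, ∀ {ι : Type} [Fintype ι]
    (x : ι → Space d), (∀ i k, i ≠ k → s ≤ ‖x i - x k‖) → ∀ y : Space d,
    ∑ i, ENNReal.ofReal ((1 + ‖y - x i‖) ^ (-((d : ℝ) + 1))) ≤ C := by
  set e : ℝ := -((d : ℝ) + 1) with he
  have he0 : e ≤ 0 := by rw [he]; linarith [(Nat.cast_nonneg d : (0 : ℝ) ≤ d)]
  have hint : Integrable fun y : Space d => (1 + ‖y‖) ^ e := by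
    rw [he]
    exact integrable_one_add_norm (by simp)
  set I : ℝ≥0∞ := ∫⁻ y : Space d, ENNReal.ofReal ((1 + ‖y‖) ^ e) with hI
  have hIt : I ≠ ⊤ := by
    have := hint.lintegral_lt_top
    exact this.ne
  set v : ℝ≥0∞ := volume (Metric.ball (0 : Space d) (s / 2)) with hv
  have hv0 : v ≠ 0 := (Metric.measure_ball_pos volume _ (by positivity)).ne'
  have hvt : v ≠ ⊤ := measure_ball_lt_top.ne
  set A : ℝ≥0∞ := ENNReal.ofReal ((1 + s / 2) ^ (-e)) with hA
  have hfin : A * I / v ≠ ⊤ :=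
    ENNReal.div_ne_top (ENNReal.mul_ne_top ENNReal.ofReal_ne_top hIt) hv0
  refine ⟨(A * I / v).toNNReal, fun {ι} _ x hx y => ?_⟩
  rw [ENNReal.coe_toNNReal hfin, ENNReal.le_div_iff_mul_le (Or.inl hv0) (Or.inl hvt),
    Finset.sum_mul]
  -- The decaying function varies by a bounded factor on a ball of radius `s/2`. These balls are
  -- disjoint, so the sum is controlled by one integral over the whole space.
  have hone : ∀ i, ENNReal.ofReal ((1 + ‖y - x i‖) ^ e) * v ≤
      ∫⁻ z in Metric.ball (x i) (s / 2), A * ENNReal.ofReal ((1 + ‖y - z‖) ^ e) := fun i => by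
    have hvi : v = volume (Metric.ball (x i) (s / 2)) := by
      rw [hv, Measure.addHaar_ball_center volume (x i)]
    rw [hvi, ← setLIntegral_const]
    refine setLIntegral_mono' measurableSet_ball fun z hz => ?_
    rw [hA, ← ENNReal.ofReal_mul (by positivity)]
    refine ENNReal.ofReal_le_ofReal ?_
    have h1 : 1 + ‖y - z‖ ≤ (1 + s / 2) * (1 + ‖y - x i‖) := by
      have h2 : ‖y - z‖ ≤ ‖y - x i‖ + ‖x i - z‖ := norm_sub_le_norm_sub_add_norm_sub _ _ _
      have h3 : ‖x i - z‖ < s / 2 := by rw [← dist_eq_norm, dist_comm]; exact hz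
      nlinarith [norm_nonneg (y - x i)]
    calc (1 + ‖y - x i‖) ^ e = (1 + s / 2) ^ (-e) * ((1 + s / 2) * (1 + ‖y - x i‖)) ^ e := by
          rw [Real.mul_rpow (by positivity) (by positivity), ← mul_assoc,
            ← Real.rpow_add (by positivity), neg_add_cancel, Real.rpow_zero, one_mul]
      _ ≤ _ := by
          refine mul_le_mul_of_nonneg_left ?_ (by positivity)
          exact Real.rpow_le_rpow_of_nonpos (by positivity) h1 he0
  refine (Finset.sum_le_sum fun i _ => hone i).trans ?_
  have hdisj : Set.PairwiseDisjoint (↑(Finset.univ : Finset ι))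
      fun i => Metric.ball (x i) (s / 2) := fun i _ k _ hik => by
    refine Metric.ball_disjoint_ball ?_
    rw [dist_eq_norm]
    linarith [hx i k hik]
  rw [← lintegral_biUnion_finset hdisj fun i _ => measurableSet_ball]
  refine (setLIntegral_le_lintegral _ _).trans ?_
  rw [lintegral_const_mul' _ _ ENNReal.ofReal_ne_top, hI]
  rw [lintegral_sub_left_eq_self (fun z => ENNReal.ofReal ((1 + ‖z‖) ^ e)) y]

lemma SchwartzMap.exists_norm_le_decay (G : 𝓢(Space d, ℂ)) :
    ∃ C : ℝ≥0, ∀ x, ‖G x‖ ≤ C * (1 + ‖x‖) ^ (-((d : ℝ) + 1)) := by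
  set S := ((Finset.Iic ((d + 1, 0) : ℕ × ℕ)).sup fun m => SchwartzMap.seminorm ℝ m.1 m.2) G
  have hS : 0 ≤ S := apply_nonneg _ _
  refine ⟨(2 ^ (d + 1) * S).toNNReal, fun x => ?_⟩
  have h := SchwartzMap.one_add_le_sup_seminorm_apply (𝕜 := ℝ) (m := (d + 1, 0)) (k := d + 1)
    (n := 0) le_rfl le_rfl G x
  rw [norm_iteratedFDeriv_zero] at h
  have h1 : (1 + ‖x‖) ^ (-((d : ℝ) + 1)) = ((1 + ‖x‖) ^ (d + 1))⁻¹ := by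
    rw [Real.rpow_neg (by positivity)]
    congr 1
    exact_mod_cast Real.rpow_natCast (1 + ‖x‖) (d + 1)
  rw [h1, Real.coe_toNNReal _ (by positivity), ← div_eq_mul_inv, le_div_iff₀ (by positivity),
    mul_comm]
  exact h

/-- Random signs: some choice of signs makes the `L²` norm of a sum at least the square
function. -/
lemma exists_signs {Z : Type*} [MeasurableSpace Z] (μ : Measure Z) {ι : Type} (v : ι → Z → ℂ)
    (hv : ∀ i, Measurable (v i)) (K : Finset ι) : ∃ ε : ι → ℝ, (∀ i, |ε i| = 1) ∧
    ∑ i ∈ K, ∫⁻ z, ‖v i z‖ₑ ^ 2 ∂μ ≤ ∫⁻ z, ‖∑ i ∈ K, (ε i : ℂ) * v i z‖ₑ ^ 2 ∂μ := by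
  classical
  induction K using Finset.induction_on with
  | empty => exact ⟨fun _ => 1, by simp, by simp⟩
  | insert k K hk ih =>
    obtain ⟨ε, hε, hle⟩ := ih
    set S : Z → ℂ := fun z => ∑ i ∈ K, (ε i : ℂ) * v i z with hS
    have hSm : Measurable S := Finset.measurable_sum _ fun i _ => (hv i).const_mul _
    have hpar : ∀ x y : ℂ, ‖x + y‖ₑ ^ 2 + ‖x - y‖ₑ ^ 2 = 2 * (‖x‖ₑ ^ 2 + ‖y‖ₑ ^ 2) := fun x y => by
      have := parallelogram_law_with_norm ℝ x y
      simp only [← ofReal_norm, ← ENNReal.ofReal_pow (norm_nonneg _)]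
      rw [← ENNReal.ofReal_add (by positivity) (by positivity),
        ← ENNReal.ofReal_add (by positivity) (by positivity), ← ENNReal.ofReal_ofNat,
        ← ENNReal.ofReal_mul (by norm_num)]
      congr 1
    have hsum : ∫⁻ z, ‖S z + v k z‖ₑ ^ 2 ∂μ + ∫⁻ z, ‖S z - v k z‖ₑ ^ 2 ∂μ =
        2 * (∫⁻ z, ‖S z‖ₑ ^ 2 ∂μ + ∫⁻ z, ‖v k z‖ₑ ^ 2 ∂μ) := by
      have hm : Measurable fun z => ‖S z + v k z‖ₑ ^ 2 := (hSm.add (hv k)).enorm.pow_const 2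
      have hm2 : Measurable fun z => ‖S z‖ₑ ^ 2 + ‖v k z‖ₑ ^ 2 :=
        (hSm.enorm.pow_const 2).add ((hv k).enorm.pow_const 2)
      rw [← lintegral_add_left hm,
        ← lintegral_add_left (hSm.enorm.pow_const 2), ← lintegral_const_mul _ hm2]
      exact lintegral_congr fun z => hpar _ _
    -- By the parallelogram law the two signs together give twice the desired quantity, so one of
    -- them gives at least that quantity.
    have key : ∃ σ : ℝ, |σ| = 1 ∧ ∫⁻ z, ‖S z‖ₑ ^ 2 ∂μ + ∫⁻ z, ‖v k z‖ₑ ^ 2 ∂μ ≤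
        ∫⁻ z, ‖S z + (σ : ℂ) * v k z‖ₑ ^ 2 ∂μ := by
      by_contra! hcon
      have h1 := hcon 1 (by simp)
      have h2 := hcon (-1) (by simp)
      simp only [Complex.ofReal_one, one_mul, Complex.ofReal_neg, neg_mul, ← sub_eq_add_neg]
        at h1 h2
      have := ENNReal.add_lt_add h1 h2
      rw [hsum, two_mul] at this
      exact this.false
    obtain ⟨σ, hσ, hkey⟩ := key
    refine ⟨Function.update ε k σ, fun i => ?_, ?_⟩
    · by_cases h : i = k
      · subst h; simpa using hσ
      · simpa [h] using hε i
    · rw [Finset.sum_insert hk]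
      have e : ∀ z, ∑ i ∈ insert k K, ((Function.update ε k σ i : ℝ) : ℂ) * v i z =
          S z + (σ : ℂ) * v k z := fun z => by
        rw [Finset.sum_insert hk, Function.update_self, add_comm, hS]
        congr 1
        refine Finset.sum_congr rfl fun i hi => ?_
        rw [Function.update_of_ne]
        rintro rfl
        exact hk hi
      simp only [e]
      refine le_trans ?_ hkey
      rw [add_comm]
      gcongr

/-- A fixed smooth bump supported in the unit ball. -/
def unitBump (d : ℕ) : ContDiffBump (0 : Space d) where
  rIn := 1 / 2
  rOut := 1
  rIn_pos := by norm_num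
  rIn_lt_rOut := by norm_num

lemma norm_lt_one_of_unitBump {ξ : Space d} (h : unitBump d ξ ≠ 0) : ‖ξ‖ < 1 := by
  have : ξ ∈ Function.support (unitBump d) := h
  rw [ContDiffBump.support_eq] at this
  simpa [unitBump] using this

lemma norm_sub_lt_one_of_packet {t₀ : ℝ} {x₀ ξ₀ ξ : Space d}
    (h : packet (unitBump d) t₀ x₀ ξ₀ ξ ≠ 0) : ‖ξ - ξ₀‖ < 1 := by
  refine norm_lt_one_of_unitBump fun h0 => h ?_
  simp [packet, h0]

lemma hasCompactSupport_packet (t₀ : ℝ) (x₀ ξ₀ : Space d) :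
    HasCompactSupport (packet (unitBump d) t₀ x₀ ξ₀) := by
  refine hasCompactSupport_of_norm_le (R := 1 + ‖ξ₀‖) fun ξ hξ => ?_
  have := norm_sub_lt_one_of_packet hξ
  have h2 := norm_le_norm_sub_add ξ ξ₀
  linarith

/-- A wave packet as a Schwartz function. -/
def packetS (t₀ : ℝ) (x₀ ξ₀ : Space d) : 𝓢(Space d, ℂ) :=
  (hasCompactSupport_packet t₀ x₀ ξ₀).toSchwartzMap
    (contDiff_packet (unitBump d).contDiff t₀ x₀ ξ₀)

lemma coe_packetS (t₀ : ℝ) (x₀ ξ₀ : Space d) :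
    (packetS t₀ x₀ ξ₀ : Space d → ℂ) = packet (unitBump d) t₀ x₀ ξ₀ := rfl

lemma synth_sum {ι : Type} [Fintype ι] {f : ι → Space d → ℂ} (hf : ∀ i, Integrable (f i))
    (c : ι → ℂ) (x : Space d) :
    synth (fun ξ => ∑ i, c i * f i ξ) x = ∑ i, c i * synth (f i) x := by
  simp only [synth, Finset.sum_mul]
  rw [integral_finsetSum, Finset.mul_sum]
  · refine Finset.sum_congr rfl fun i _ => ?_
    simp only [mul_assoc]
    rw [integral_const_mul]
    ring
  · intro i _
    refine ((hf i).const_mul (c i)).mul_bdd (c := 1)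
      (Continuous.aestronglyMeasurable (by fun_prop)) ?_
    exact Filter.Eventually.of_forall fun ξ => (norm_exp_synth x ξ).le

lemma evol_sum {ι : Type} [Fintype ι] {f : ι → Space d → ℂ} (hf : ∀ i, Integrable (f i))
    (c : ι → ℂ) (x : Space d) (t : ℝ) :
    evol (fun ξ => ∑ i, c i * f i ξ) x t = ∑ i, c i * evol (f i) x t := by
  simp only [evol, Finset.sum_mul]
  rw [integral_finsetSum, Finset.mul_sum]
  · refine Finset.sum_congr rfl fun i _ => ?_
    simp only [mul_assoc]
    rw [integral_const_mul]
    ring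
  · intro i _
    refine ((hf i).const_mul (c i)).mul_bdd (c := 1)
      (Continuous.aestronglyMeasurable (by fun_prop)) ?_
    exact Filter.Eventually.of_forall fun ξ => (norm_exp_evol x ξ t).le

/-- A sum of `N` separated wave packets with arbitrary signs has `L^p` norm `O(N^{1/p})`. -/
lemma exists_eLpNorm_packet_sum_le (d : ℕ) {p : ℝ≥0∞} (hp : 1 ≤ p) (t₀ : ℝ) {s : ℝ}
    (hs : 0 < s) : ∃ C : ℝ≥0, ∀ {ι : Type} [Fintype ι] (x ξ : ι → Space d) (ε : ι → ℝ),
    (∀ i k, i ≠ k → s ≤ ‖x i - x k‖) → (∀ i, |ε i| = 1) →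
    eLpNorm (synth fun η => ∑ i, (ε i : ℂ) * packet (unitBump d) t₀ (x i) (ξ i) η) p volume ≤
      C * (Fintype.card ι : ℝ≥0∞) ^ p⁻¹.toReal := by
  obtain ⟨Cs, hCs⟩ := exists_sum_decay_le d hs
  set G : 𝓢(Space d, ℂ) := invHat (packetS t₀ 0 0) with hG
  have hGs : (G : Space d → ℂ) = synth (packet (unitBump d) t₀ 0 0) := by
    rw [hG, invHat_eq_synth, coe_packetS]
  obtain ⟨Cg, hCg⟩ := SchwartzMap.exists_norm_le_decay G
  set g₁ : ℝ≥0∞ := ∫⁻ x, ‖G x‖ₑ with hg₁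
  have hg₁t : g₁ ≠ ⊤ := G.integrable.2.ne
  have hpi : 0 ≤ 1 - 1 * p⁻¹.toReal := by
    have : p⁻¹.toReal ≤ (1 : ℝ≥0∞).toReal :=
      ENNReal.toReal_mono (by simp) (ENNReal.inv_le_one.2 hp)
    simp only [ENNReal.toReal_one] at this
    linarith
  set D : ℝ≥0∞ := ((Cg * Cs : ℝ≥0) : ℝ≥0∞) ^ (1 - 1 * p⁻¹.toReal) * g₁ ^ p⁻¹.toReal with hD
  have hDt : D ≠ ⊤ := ENNReal.mul_ne_top
    (ENNReal.rpow_ne_top_of_nonneg hpi ENNReal.coe_ne_top)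
    (ENNReal.rpow_ne_top_of_nonneg ENNReal.toReal_nonneg hg₁t)
  refine ⟨D.toNNReal, fun {ι} _ x ξ ε hx hε => ?_⟩
  rw [ENNReal.coe_toNNReal hDt]
  -- At time `0` every packet has the modulus of the same Schwartz function `G`, translated to `x
  -- i`. Signs and frequencies no longer matter.
  have hpt : ∀ y, ‖synth (fun η => ∑ i, (ε i : ℂ) * packet (unitBump d) t₀ (x i) (ξ i) η) y‖ₑ ≤
      ∑ i, ‖G (y - x i)‖ₑ := fun y => by
    have hint : ∀ i, Integrable (packet (unitBump d) t₀ (x i) (ξ i)) :=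
      fun i => (packetS t₀ (x i) (ξ i)).integrable
    rw [synth_sum hint]
    refine (enorm_sum_le _ _).trans (Finset.sum_le_sum fun i _ => ?_)
    rw [enorm_mul, hGs, ← ofReal_norm, ← ofReal_norm, ← ofReal_norm,
      norm_synth_packet, Complex.norm_real, Real.norm_eq_abs, hε i, ENNReal.ofReal_one, one_mul]
  have hB : ∀ y, ‖synth (fun η => ∑ i, (ε i : ℂ) * packet (unitBump d) t₀ (x i) (ξ i) η) y‖ₑ ≤
      ((Cg * Cs : ℝ≥0) : ℝ≥0∞) := fun y => by
    refine (hpt y).trans ?_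
    rw [ENNReal.coe_mul]
    refine le_trans ?_ (mul_le_mul_right (hCs x hx y) _)
    rw [Finset.mul_sum]
    refine Finset.sum_le_sum fun i _ => ?_
    rw [← ofReal_norm, ← ENNReal.ofReal_coe_nnreal, ← ENNReal.ofReal_mul (by positivity)]
    exact ENNReal.ofReal_le_ofReal (hCg _)
  -- Interpolation between the sup bound, uniform in the number of packets by separation, and the
  -- `L¹` bound, which is linear in that number.
  refine (eLpNorm_le_of_enorm_le hB one_pos (by simpa using hp)).trans ?_
  rw [hD, mul_assoc, ← ENNReal.mul_rpow_of_nonneg _ _ ENNReal.toReal_nonneg]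
  gcongr
  simp only [ENNReal.rpow_one]
  refine (lintegral_mono hpt).trans ?_
  rw [lintegral_finsetSum]
  · have : ∀ i, ∫⁻ y, ‖G (y - x i)‖ₑ = g₁ := fun i =>
      lintegral_sub_right_eq_self (fun y => ‖G y‖ₑ) (x i)
    simp only [this, Finset.sum_const, Finset.card_univ, nsmul_eq_mul]
    rw [mul_comm]
  · intro i _
    have := G.continuous
    exact Continuous.measurable (by fun_prop)

/-- On its space-time tube, an evolved wave packet is bounded below. -/
lemma le_norm_evol_packet {w : Space d → ℝ} (hw : Continuous w) {m : ℝ} {t₀ t : ℝ}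
    {x₀ ξ₀ x : Space d} (hm : 0 ≤ m) (hwm : ∀ ξ, ‖ξ - ξ₀‖ ≤ 1 → m ≤ w ξ) (ht : |t - t₀| ≤ 1 / 2)
    (hx : ‖x - x₀ - (2 * t) • ξ₀‖ ≤ 1 / 2) :
    ((2 * Real.pi) ^ d)⁻¹ * (Real.cos 1 * (m * ∫ ξ, unitBump d ξ)) ≤
      ‖evol (fun ξ => (w ξ : ℂ) * packet (unitBump d) t₀ x₀ ξ₀ ξ) x t‖ := by
  have hcb : Continuous fun ξ : Space d => unitBump d (ξ - ξ₀) :=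
    (unitBump d).continuous.comp (by fun_prop)
  have hcs : HasCompactSupport fun ξ : Space d => unitBump d (ξ - ξ₀) :=
    hasCompactSupport_of_norm_le (R := 1 + ‖ξ₀‖) fun ξ hξ => by
      have := norm_lt_one_of_unitBump hξ
      have h2 := norm_le_norm_sub_add ξ ξ₀
      linarith
  have hi : Integrable fun ξ => w ξ * unitBump d (ξ - ξ₀) :=
    (hw.mul hcb).integrable_of_hasCompactSupport hcs.mul_left
  have hib : Integrable fun ξ => unitBump d (ξ - ξ₀) :=
    hcb.integrable_of_hasCompactSupport hcs
  have hmono : ∀ ξ, m * unitBump d (ξ - ξ₀) ≤ w ξ * unitBump d (ξ - ξ₀) := fun ξ => by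
    by_cases h0 : unitBump d (ξ - ξ₀) = 0
    · simp [h0]
    · exact mul_le_mul_of_nonneg_right (hwm ξ (norm_lt_one_of_unitBump h0).le)
        (unitBump d).nonneg
  have key := le_norm_evol (h := fun ξ => w ξ * unitBump d (ξ - ξ₀))
    (Θ := fun ξ => t₀ * ‖ξ - ξ₀‖ ^ 2 - inner ℝ x₀ (ξ - ξ₀)) hi
    (fun ξ => (mul_nonneg hm (unitBump d).nonneg).trans (hmono ξ)) (by fun_prop)
    (-t * ‖ξ₀‖ ^ 2 + inner ℝ x ξ₀) (x := x) (t := t) (fun ξ hξ => by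
      have hη : ‖ξ - ξ₀‖ < 1 := norm_lt_one_of_unitBump fun h => hξ (by simp [h])
      -- With `η = ξ - ξ₀`, the phase modulo a constant is `-(t - t₀)|η|² + ⟨x - x₀ - 2tξ₀, η⟩`. The
      -- factor `e^{i t₀|η|²}` in the packet cancels the spreading around `t₀`, so each term is at
      -- most `1/2` on the tube.
      have e : t₀ * ‖ξ - ξ₀‖ ^ 2 - inner ℝ x₀ (ξ - ξ₀) - t * ‖ξ‖ ^ 2 + inner ℝ x ξ -
          (-t * ‖ξ₀‖ ^ 2 + inner ℝ x ξ₀) =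
          -(t - t₀) * ‖ξ - ξ₀‖ ^ 2 + inner ℝ (x - x₀ - (2 * t) • ξ₀) (ξ - ξ₀) := by
        simp only [inner_sub_left, inner_sub_right, inner_smul_left, norm_sub_sq_real,
          real_inner_self_eq_norm_sq, conj_trivial, real_inner_comm ξ ξ₀]
        ring
      rw [e]
      have h1 : |-(t - t₀) * ‖ξ - ξ₀‖ ^ 2| ≤ 1 / 2 := by
        rw [abs_mul, abs_neg, abs_of_nonneg (sq_nonneg ‖ξ - ξ₀‖)]
        have : ‖ξ - ξ₀‖ ^ 2 ≤ 1 := pow_le_one₀ (norm_nonneg _) hη.le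
        nlinarith [abs_nonneg (t - t₀), sq_nonneg ‖ξ - ξ₀‖]
      have h2 : |inner ℝ (x - x₀ - (2 * t) • ξ₀) (ξ - ξ₀)| ≤ 1 / 2 := by
        refine (abs_real_inner_le_norm _ _).trans ?_
        nlinarith [norm_nonneg (x - x₀ - (2 * t) • ξ₀), norm_nonneg (ξ - ξ₀)]
      exact (abs_add_le _ _).trans (by linarith))
  have hfun : (fun ξ => ((w ξ * unitBump d (ξ - ξ₀) : ℝ) : ℂ) *
      Complex.exp ((t₀ * ‖ξ - ξ₀‖ ^ 2 - inner ℝ x₀ (ξ - ξ₀) : ℝ) * Complex.I)) =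
      fun ξ => (w ξ : ℂ) * packet (unitBump d) t₀ x₀ ξ₀ ξ := by
    funext ξ
    rw [packet, Complex.ofReal_mul, mul_assoc]
  rw [hfun] at key
  refine le_trans ?_ key
  have hcos : 0 < Real.cos 1 := Real.cos_one_pos
  gcongr
  rw [← integral_sub_right_eq_self (unitBump d) ξ₀, ← integral_const_mul]
  exact integral_mono (hib.const_mul _) hi hmono

/-- With time as the outer variable every slice is a ball of radius `1/2`, so the volume does not
depend on the speed. -/
lemma volume_tube (x₀ ξ₀ : Space d) (t₁ t₂ : ℝ) :
    volume {z : Space d × ℝ | z.2 ∈ Set.Icc t₁ t₂ ∧ ‖z.1 - x₀ - (2 * z.2) • ξ₀‖ ≤ 1 / 2} =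
      ENNReal.ofReal (t₂ - t₁) * volume (Metric.closedBall (0 : Space d) (1 / 2)) := by
  have hm : MeasurableSet
      {z : Space d × ℝ | z.2 ∈ Set.Icc t₁ t₂ ∧ ‖z.1 - x₀ - (2 * z.2) • ξ₀‖ ≤ 1 / 2} := by
    refine IsClosed.measurableSet (IsClosed.inter (isClosed_Icc.preimage continuous_snd) ?_)
    exact isClosed_le (f := fun z : Space d × ℝ => ‖z.1 - x₀ - (2 * z.2) • ξ₀‖) (by fun_prop)
      continuous_const
  rw [Measure.volume_eq_prod, Measure.prod_apply_symm hm]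
  have : ∀ t : ℝ, volume ((fun x : Space d => (x, t)) ⁻¹'
      {z : Space d × ℝ | z.2 ∈ Set.Icc t₁ t₂ ∧ ‖z.1 - x₀ - (2 * z.2) • ξ₀‖ ≤ 1 / 2}) =
      (Set.Icc t₁ t₂).indicator (fun _ => volume (Metric.closedBall (0 : Space d) (1 / 2))) t := by
    intro t
    by_cases ht : t ∈ Set.Icc t₁ t₂
    · rw [Set.indicator_of_mem ht,
        ← Measure.addHaar_closedBall_center volume (x₀ + (2 * t) • ξ₀)]
      congr 1
      ext x
      simp only [Set.mem_preimage, Set.mem_ofPred_eq, ht, true_and, Metric.mem_closedBall,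
        dist_eq_norm, sub_sub]
    · rw [Set.indicator_of_notMem ht]
      simp only [Set.preimage_ofPred_eq, ht, false_and, Set.ofPred_false, measure_empty]
  simp only [this]
  rw [lintegral_indicator measurableSet_Icc, setLIntegral_const, Real.volume_Icc, mul_comm]

lemma inv_toReal_le_half {s : ℝ≥0∞} (hs : 2 ≤ s) : s⁻¹.toReal ≤ 1 / 2 := by
  have : s⁻¹.toReal ≤ (2⁻¹ : ℝ≥0∞).toReal :=
    ENNReal.toReal_mono (by simp) (ENNReal.inv_le_inv.2 hs)
  simp only [ENNReal.toReal_inv, ENNReal.toReal_ofNat] at this ⊢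
  linarith

/-! ### The inequality for families of packets. -/

/-- The points swept by a tube around the classical trajectory with initial position `x₀` and
frequency `ξ₀`, at time `t`. -/
def InTube (x₀ ξ₀ x : Space d) (t : ℝ) : Prop := ‖x - x₀ - (2 * t) • ξ₀‖ ≤ 1 / 2

lemma isClosed_tube (x₀ ξ₀ : Space d) (t₁ t₂ : ℝ) :
    IsClosed {z : Space d × ℝ | z.2 ∈ Set.Icc t₁ t₂ ∧ InTube x₀ ξ₀ z.1 z.2} :=
  IsClosed.inter (isClosed_Icc.preimage continuous_snd)
    (isClosed_le (f := fun z : Space d × ℝ => ‖z.1 - x₀ - (2 * z.2) • ξ₀‖) (by fun_prop)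
      continuous_const)

/-- The estimate for `U` controls the number of wave packets in terms of the size of the union
of their tubes. -/
theorem FrequencyEstimate.packet_inequality {p q r : ℝ≥0∞} {α a b : ℝ}
    (h : FrequencyEstimate d p q r α a b) (hp : 2 ≤ p) (hq : 2 ≤ q) (hr : 2 ≤ r) (t₀ : ℝ)
    {s : ℝ} (hs : 0 < s) :
    ∃ C : ℝ, 0 < C ∧ ∀ (j : ℕ) {ι : Type} [Fintype ι] (x ξ : ι → Space d),
      (∀ i k, i ≠ k → s ≤ ‖x i - x k‖) →
      (∀ i, (2 : ℝ) ^ j + 1 ≤ ‖ξ i‖ ∧ ‖ξ i‖ ≤ 2 ^ (j + 1) - 1) →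
      ∀ t₁ t₂ : ℝ, t₁ ≤ t₂ → a ≤ t₁ → t₂ ≤ b → t₀ - 1 / 2 ≤ t₁ → t₂ ≤ t₀ + 1 / 2 →
      ∀ (X : Set (Space d)) (M V : ℝ), MeasurableSet X → 0 ≤ M → 0 ≤ V →
        volume X ≤ ENNReal.ofReal V →
        (∀ i, ∀ t ∈ Set.Icc t₁ t₂, ∀ y, InTube (x i) (ξ i) y t → y ∈ X) →
        (∀ y ∈ X, volume {t | t ∈ Set.Icc t₁ t₂ ∧ ∃ i, InTube (x i) (ξ i) y t} ≤
          ENNReal.ofReal M) →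
        Fintype.card ι * (t₂ - t₁) ≤ C * (M ^ (1 - 2 * r⁻¹.toReal) * V ^ (1 - 2 * q⁻¹.toReal)) *
          (2 ^ (2 * (j * α)) * (Fintype.card ι : ℝ) ^ (2 * p⁻¹.toReal)) := by
  obtain ⟨C, c, hc, h⟩ := h
  obtain ⟨Cp, hCp⟩ := exists_eLpNorm_packet_sum_le d (le_trans (by norm_num) hp) t₀ hs
  set vB : ℝ≥0∞ := volume (Metric.closedBall (0 : Space d) (1 / 2)) with hvB
  have hvBt : vB ≠ ⊤ := measure_closedBall_lt_top.ne
  have hvB0 : vB ≠ 0 := (Metric.measure_closedBall_pos volume _ (by norm_num)).ne'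
  set v := vB.toReal with hv
  have hv0 : 0 < v := ENNReal.toReal_pos hvB0 hvBt
  have hvv : vB = ENNReal.ofReal v := (ENNReal.ofReal_toReal hvBt).symm
  set c₁ : ℝ := ((2 * Real.pi) ^ d)⁻¹ * (Real.cos 1 * (c * ∫ ξ, unitBump d ξ)) with hc₁
  have hc₁0 : 0 < c₁ := by
    have := (unitBump d).integral_pos (μ := volume)
    have := Real.cos_one_pos
    positivity
  -- The summand `1` makes the constant positive even if `C * Cp = 0`.
  refine ⟨(C * Cp) ^ 2 / (v * c₁ ^ 2) + 1, by positivity, ?_⟩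
  intro j ι _ x ξ hsep hξ t₁ t₂ ht ha hb ht1 ht2 X M V hX hM hV hVX hTX hMX
  obtain ⟨w, hw, hwc, hest⟩ := h j
  set L : ℝ := (2 : ℝ) ^ (-(j * α)) with hL
  have hL0 : 0 < L := by positivity
  have hann : ∀ i η, ‖η - ξ i‖ ≤ 1 → 2 ^ j ≤ ‖η‖ ∧ ‖η‖ ≤ 2 ^ (j + 1) := fun i η hη => by
    have h1 := norm_le_norm_sub_add η (ξ i)
    have h2 := norm_le_norm_sub_add (ξ i) η
    rw [norm_sub_rev] at h2
    constructor <;> linarith [(hξ i).1, (hξ i).2]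
  -- the space-time region
  set T : ι → Set (Space d × ℝ) := fun i =>
    {z | z.2 ∈ Set.Icc t₁ t₂ ∧ InTube (x i) (ξ i) z.1 z.2} with hT
  have hTm : ∀ i, MeasurableSet (T i) := fun i => (isClosed_tube _ _ _ _).measurableSet
  set Ω : Set (Space d × ℝ) := ⋃ i, T i with hΩ
  have hΩm : MeasurableSet Ω := MeasurableSet.iUnion hTm
  -- evolved packets
  set f : ι → Space d → ℂ := fun i η => (w η : ℂ) * packet (unitBump d) t₀ (x i) (ξ i) η with hf
  have hfc : ∀ i, Continuous (f i) := fun i => by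
    have h1 := hw.continuous
    have h2 : Continuous (packet (unitBump d) t₀ (x i) (ξ i)) := (packetS t₀ (x i) (ξ i)).continuous
    exact (Complex.continuous_ofReal.comp h1).mul h2
  have hfi : ∀ i, Integrable (f i) := fun i =>
    (hfc i).integrable_of_hasCompactSupport (hasCompactSupport_packet t₀ (x i) (ξ i)).mul_left
  -- The signs are chosen for the evolved packets over the union of all tubes; the `L^p` bound for
  -- the datum holds for any signs, so the choice costs nothing there.
  obtain ⟨ε, hε, hsq⟩ := exists_signs ((volume : Measure (Space d × ℝ)).restrict Ω)
    (fun i z => evol (f i) z.1 z.2) (fun i => (continuous_evol (hfc i) (hfi i)).measurable)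
    Finset.univ
  set ψ : 𝓢(Space d, ℂ) := ∑ i, (ε i : ℂ) • packetS t₀ (x i) (ξ i) with hψ
  have hψc : ∀ η, ψ η = ∑ i, (ε i : ℂ) * packet (unitBump d) t₀ (x i) (ξ i) η := fun η => by
    rw [hψ, sum_apply]
    simp only [smul_apply, smul_eq_mul, coe_packetS]
  have hψa : ∀ η, ψ η ≠ 0 → 2 ^ j ≤ ‖η‖ ∧ ‖η‖ ≤ 2 ^ (j + 1) := fun η hη => by
    rw [hψc] at hη
    obtain ⟨i, -, hi⟩ := Finset.exists_ne_zero_of_sum_ne_zero hη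
    exact hann i η (norm_sub_lt_one_of_packet (right_ne_zero_of_mul hi)).le
  have hwψ : (fun η => (w η : ℂ) * ψ η) = fun η => ∑ i, (ε i : ℂ) * f i η := by
    funext η
    rw [hψc, Finset.mul_sum]
    exact Finset.sum_congr rfl fun i _ => by simp only [hf]; ring
  have hmix := hest ψ hψa
  rw [hwψ] at hmix
  have hLp : eLpNorm (synth ψ) p volume ≤ Cp * (Fintype.card ι : ℝ≥0∞) ^ p⁻¹.toReal := by
    have := hCp x ξ ε hsep hε
    rwa [show (fun η => ∑ i, (ε i : ℂ) * packet (unitBump d) t₀ (x i) (ξ i) η) = ψ from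
      (funext hψc).symm] at this
  have hsumc : Continuous fun η => ∑ i, (ε i : ℂ) * f i η :=
    continuous_finsetSum _ fun i _ => continuous_const.mul (hfc i)
  have hsumi : Integrable fun η => ∑ i, (ε i : ℂ) * f i η :=
    integrable_finsetSum _ fun i _ => (hfi i).const_mul _
  have hup := lintegral_sq_le_mixedNorm (a := a) (b := b) hq hr (continuous_evol hsumc hsumi)
    hΩm hX (M := M.toNNReal)
    (fun z hz => by
      obtain ⟨i, hi⟩ := Set.mem_iUnion.1 hz
      exact ⟨hTX i z.2 hi.1 z.1 hi.2, ha.trans hi.1.1, hi.1.2.trans hb⟩)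
    (fun y hy => by
      refine (measure_mono fun t ht => ?_).trans (hMX y hy)
      obtain ⟨i, hi⟩ := Set.mem_iUnion.1 (show (y, t) ∈ ⋃ i, T i from ht)
      exact ⟨hi.1, i, hi.2⟩)
  -- Each packet contributes at least its energy on its own tube. Overlaps between tubes are no
  -- loss, since the sum of the squares is integrated.
  have hlow : ∀ i, ENNReal.ofReal ((t₂ - t₁) * v * (c₁ * L) ^ 2) ≤
      ∫⁻ z in Ω, ‖evol (f i) z.1 z.2‖ₑ ^ 2 := fun i => by
    have h1 : ∫⁻ z in T i, ‖evol (f i) z.1 z.2‖ₑ ^ 2 ≤ ∫⁻ z in Ω, ‖evol (f i) z.1 z.2‖ₑ ^ 2 :=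
      lintegral_mono_set (Set.subset_iUnion T i)
    refine le_trans ?_ h1
    have h2 : volume (T i) = ENNReal.ofReal (t₂ - t₁) * vB := volume_tube _ _ _ _
    rw [ENNReal.ofReal_mul (mul_nonneg (by linarith) hv0.le), ENNReal.ofReal_mul (by linarith),
      ← hvv, ← h2, mul_comm, ← setLIntegral_const]
    refine setLIntegral_mono' (hTm i) fun z hz => ?_
    rw [← ofReal_norm, ← ENNReal.ofReal_pow (norm_nonneg _)]
    refine ENNReal.ofReal_le_ofReal (pow_le_pow_left₀ (by positivity) ?_ 2)
    refine le_trans (le_of_eq ?_) (le_norm_evol_packet hw.continuous (m := c * L)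
      (by positivity) (fun η hη => hwc η (hann i η hη).1 (hann i η hη).2) ?_ hz.2)
    · rw [hc₁]; ring
    · rw [abs_le]; constructor <;> linarith [hz.1.1, hz.1.2]
  have hchain : ENNReal.ofReal (Fintype.card ι * ((t₂ - t₁) * v * (c₁ * L) ^ 2)) ≤
      ENNReal.ofReal (M ^ (1 - 2 * r⁻¹.toReal) * V ^ (1 - 2 * q⁻¹.toReal) *
        (C * (Cp * (Fintype.card ι : ℝ) ^ p⁻¹.toReal)) ^ 2) := by
    have hr0 : 0 ≤ 1 - 2 * r⁻¹.toReal := by linarith [inv_toReal_le_half hr]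
    have hq0 : 0 ≤ 1 - 2 * q⁻¹.toReal := by linarith [inv_toReal_le_half hq]
    calc ENNReal.ofReal (Fintype.card ι * ((t₂ - t₁) * v * (c₁ * L) ^ 2))
        = ∑ _i : ι, ENNReal.ofReal ((t₂ - t₁) * v * (c₁ * L) ^ 2) := by
          rw [Finset.sum_const, Finset.card_univ, nsmul_eq_mul,
            ENNReal.ofReal_mul (Nat.cast_nonneg _), ENNReal.ofReal_natCast]
      _ ≤ ∑ i, ∫⁻ z in Ω, ‖evol (f i) z.1 z.2‖ₑ ^ 2 := Finset.sum_le_sum fun i _ => hlow i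
      _ ≤ _ := hsq
      _ = ∫⁻ z in Ω, ‖evol (fun η => ∑ i, (ε i : ℂ) * f i η) z.1 z.2‖ₑ ^ 2 := by
          simp only [evol_sum hfi]
      _ ≤ _ := hup
      _ ≤ ENNReal.ofReal (M ^ (1 - 2 * r⁻¹.toReal)) * ENNReal.ofReal (V ^ (1 - 2 * q⁻¹.toReal)) *
          (ENNReal.ofReal (C * (Cp * (Fintype.card ι : ℝ) ^ p⁻¹.toReal))) ^ 2 := by
          gcongr
          · rw [← ENNReal.ofReal_rpow_of_nonneg hM hr0]; rfl
          · rw [← ENNReal.ofReal_rpow_of_nonneg hV hq0]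
            exact ENNReal.rpow_le_rpow hVX hq0
          · rw [ENNReal.ofReal_mul NNReal.zero_le_coe, ENNReal.ofReal_mul NNReal.zero_le_coe,
              ENNReal.ofReal_coe_nnreal, ENNReal.ofReal_coe_nnreal,
              ← ENNReal.ofReal_rpow_of_nonneg (Nat.cast_nonneg _) ENNReal.toReal_nonneg,
              ENNReal.ofReal_natCast]
            exact hmix.trans (mul_le_mul_right hLp _)
      _ = _ := by
          rw [← ENNReal.ofReal_pow (by positivity), ← ENNReal.ofReal_mul (by positivity),
            ← ENNReal.ofReal_mul (by positivity)]
  rw [ENNReal.ofReal_le_ofReal_iff (by positivity)] at hchain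
  have hLL : L ^ 2 * (2 : ℝ) ^ (2 * (j * α)) = 1 := by
    rw [hL, ← Real.rpow_natCast, ← Real.rpow_mul (by norm_num), ← Real.rpow_add (by norm_num)]
    rw [show -(j * α) * ((2 : ℕ) : ℝ) + 2 * (j * α) = 0 by push_cast; ring, Real.rpow_zero]
  have hN2 : ((Fintype.card ι : ℝ) ^ p⁻¹.toReal) ^ 2 = (Fintype.card ι : ℝ) ^ (2 * p⁻¹.toReal) := by
    rw [← Real.rpow_natCast, ← Real.rpow_mul (Nat.cast_nonneg _)]
    congr 1; push_cast; ring
  set N : ℝ := (Fintype.card ι : ℝ)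
  set P : ℝ := M ^ (1 - 2 * r⁻¹.toReal) * V ^ (1 - 2 * q⁻¹.toReal) with hP
  have hP0 : 0 ≤ P := by positivity
  set E : ℝ := (2 : ℝ) ^ (2 * (j * α)) with hE
  have hE0 : 0 < E := by positivity
  have hNp : 0 ≤ N ^ (2 * p⁻¹.toReal) := by positivity
  have hchain' : N * ((t₂ - t₁) * v * (c₁ * L) ^ 2) ≤
      P * (C ^ 2 * (Cp ^ 2 * N ^ (2 * p⁻¹.toReal))) := by
    rwa [← hN2, ← mul_pow, ← mul_pow]
  have hfinal : N * (t₂ - t₁) * (v * c₁ ^ 2) ≤ (C * Cp) ^ 2 * P * (E * N ^ (2 * p⁻¹.toReal)) := by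
    calc N * (t₂ - t₁) * (v * c₁ ^ 2) = (N * ((t₂ - t₁) * v * (c₁ * L) ^ 2)) * E := by
          rw [mul_pow]
          linear_combination (-(N * (t₂ - t₁) * v * c₁ ^ 2)) * hLL
      _ ≤ (P * (C ^ 2 * (Cp ^ 2 * N ^ (2 * p⁻¹.toReal)))) * E := by gcongr
      _ = _ := by ring
  calc N * (t₂ - t₁) ≤ (C * Cp) ^ 2 * P * (E * N ^ (2 * p⁻¹.toReal)) / (v * c₁ ^ 2) := by
        rwa [le_div_iff₀ (by positivity)]
    _ = (C * Cp) ^ 2 / (v * c₁ ^ 2) * P * (E * N ^ (2 * p⁻¹.toReal)) := by ring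
    _ ≤ _ := by
        refine mul_le_mul_of_nonneg_right ?_ (by positivity)
        exact mul_le_mul_of_nonneg_right (by linarith) hP0

/-! ### The dispersive estimate and focusing data. -/

/-- The integral is an explicit complex Gaussian in `w`, and its exponential factor has modulus at
most one because `1/b` has nonnegative real part. Only `‖b‖` enters the bound, so it survives as `b`
approaches the imaginary axis. -/
lemma norm_integral_gaussian_le {b : ℂ} (hb : 0 < b.re) (w : Space d) :
    ‖∫ ξ : Space d, Complex.exp (-b * ‖ξ‖ ^ 2 + Complex.I * (inner ℝ w ξ : ℝ))‖ ≤
      (Real.pi / ‖b‖) ^ ((d : ℝ) / 2) := by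
  rw [GaussianFourier.integral_cexp_neg_mul_sq_norm_add hb, norm_mul, finrank_euclideanSpace_fin]
  have h1 : ‖((Real.pi : ℂ) / b) ^ ((d : ℂ) / 2)‖ = (Real.pi / ‖b‖) ^ ((d : ℝ) / 2) := by
    rw [show ((d : ℂ) / 2) = (((d : ℝ) / 2 : ℝ) : ℂ) by push_cast; rfl, Complex.norm_cpow_real,
      norm_div, Complex.norm_real, Real.norm_of_nonneg Real.pi_pos.le]
  have h2 : ‖Complex.exp (Complex.I ^ 2 * (‖w‖ : ℂ) ^ 2 / (4 * b))‖ ≤ 1 := by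
    rw [Complex.norm_exp, Real.exp_le_one_iff]
    have e : Complex.I ^ 2 * (‖w‖ : ℂ) ^ 2 / (4 * b) = ((-(‖w‖ ^ 2 / 4) : ℝ) : ℂ) * b⁻¹ := by
      rw [Complex.I_sq]; push_cast
      rw [div_eq_mul_inv, mul_inv]; ring
    rw [e, Complex.re_ofReal_mul, Complex.inv_re]
    have : 0 ≤ b.re / Complex.normSq b := div_nonneg hb.le (Complex.normSq_nonneg _)
    nlinarith [sq_nonneg ‖w‖]
  rw [h1]
  exact mul_le_of_le_one_right (by positivity) h2

/-- The dilated symbol `φ(s ξ)` is a superposition of characters with integrable coefficients, so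
the integral is an average of Gaussian integrals at the points `x - s z`. The bound is therefore
independent of `s`. -/
lemma norm_integral_regularized_le (φ : 𝓢(Space d, ℂ)) (s : ℝ) {b : ℂ} (hb : 0 < b.re)
    (x : Space d) :
    ‖∫ ξ : Space d, φ (s • ξ) *
      Complex.exp (-b * ‖ξ‖ ^ 2 + Complex.I * (inner ℝ x ξ : ℝ))‖ ≤
      (Real.pi / ‖b‖) ^ ((d : ℝ) / 2) * ∫ z, ‖invHat φ z‖ := by
  have h1 : ∀ ξ, φ (s • ξ) = ∫ z, invHat φ z * Complex.exp (-Complex.I * (inner ℝ z (s • ξ) : ℝ)) :=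
    fun ξ => by conv_lhs => rw [← hat_invHat φ]
                rfl
  have hg : Integrable fun ξ : Space d => Complex.exp (-b * ‖ξ‖ ^ 2) := by
    simpa using GaussianFourier.integrable_cexp_neg_mul_sq_norm_add hb 0 (0 : Space d)
  have h2 : ∫ ξ : Space d, φ (s • ξ) *
      Complex.exp (-b * ‖ξ‖ ^ 2 + Complex.I * (inner ℝ x ξ : ℝ)) =
      ∫ z, invHat φ z * ∫ ξ : Space d,
        Complex.exp (-b * ‖ξ‖ ^ 2 + Complex.I * (inner ℝ (x - s • z) ξ : ℝ)) := by
    simp only [← integral_const_mul]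
    rw [integral_integral_swap]
    · refine integral_congr_ae (Filter.Eventually.of_forall fun ξ => ?_)
      simp only
      rw [h1, ← integral_mul_const]
      refine integral_congr_ae (Filter.Eventually.of_forall fun z => ?_)
      simp only [inner_sub_left, inner_smul_left, inner_smul_right, conj_trivial]
      rw [mul_assoc, ← Complex.exp_add]
      congr 2
      push_cast; ring
    · refine ((invHat φ).integrable.mul_prod hg).congr' ?_ ?_
      · have h3 := (invHat φ).continuous
        refine Continuous.aestronglyMeasurable ?_
        simp only [Function.uncurry_def]
        fun_prop
      · refine Filter.Eventually.of_forall fun z => ?_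
        simp only [Function.uncurry, norm_mul]
        rw [Complex.exp_add, norm_mul, norm_exp_synth, mul_one]
  rw [h2]
  refine (norm_integral_le_integral_norm _).trans ?_
  rw [← integral_const_mul]
  refine integral_mono_of_nonneg (Filter.Eventually.of_forall fun z => norm_nonneg _)
    ((invHat φ).integrable.norm.const_mul _) (Filter.Eventually.of_forall fun z => ?_)
  simp only [norm_mul]
  rw [mul_comm]
  exact mul_le_mul_of_nonneg_right (norm_integral_gaussian_le hb _) (norm_nonneg _)

/-- The dispersive estimate, for data whose Fourier transform is a dilate of a fixed function. -/
lemma norm_synth_chirp_le (φ : 𝓢(Space d, ℂ)) {s t₀ : ℝ} (hs : s ≠ 0) (ht : t₀ ≠ 0)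
    (x : Space d) :
    ‖synth (fun ξ => φ (s • ξ) * Complex.exp ((t₀ * ‖ξ‖ ^ 2 : ℝ) * Complex.I)) x‖ ≤
      ((2 * Real.pi) ^ d)⁻¹ * ((Real.pi / |t₀|) ^ ((d : ℝ) / 2) * ∫ z, ‖invHat φ z‖) := by
  rw [synth, norm_mul, norm_pow, norm_inv, Complex.norm_real, Real.norm_of_nonneg (by positivity),
    inv_pow]
  refine mul_le_mul_of_nonneg_left ?_ (by positivity)
  have hφi : Integrable fun ξ => φ (s • ξ) := φ.integrable.comp_smul hs
  have hφc : Continuous fun ξ : Space d => φ (s • ξ) := φ.continuous.comp (by fun_prop)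
  -- The pure chirp is the limit of Gaussians with parameter `b = ε - i t₀`, `ε → 0+`, for which
  -- `‖b‖ ≥ |t₀|`.
  have hlim : Filter.Tendsto (fun ε : ℝ => ∫ ξ : Space d, φ (s • ξ) *
      Complex.exp (-((ε : ℂ) - t₀ * Complex.I) * ‖ξ‖ ^ 2 + Complex.I * (inner ℝ x ξ : ℝ)))
      (nhdsWithin 0 (Set.Ioi 0)) (nhds (∫ ξ : Space d, φ (s • ξ) *
        Complex.exp (-(((0 : ℝ) : ℂ) - t₀ * Complex.I) * ‖ξ‖ ^ 2 +
          Complex.I * (inner ℝ x ξ : ℝ)))) := by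
    refine tendsto_integral_filter_of_dominated_convergence (fun ξ => ‖φ (s • ξ)‖) ?_ ?_
      hφi.norm ?_
    · exact Filter.Eventually.of_forall fun ε =>
        Continuous.aestronglyMeasurable (hφc.mul (by fun_prop))
    · filter_upwards [self_mem_nhdsWithin] with ε hε
      refine Filter.Eventually.of_forall fun ξ => ?_
      rw [norm_mul]
      refine mul_le_of_le_one_right (norm_nonneg _) ?_
      rw [Complex.norm_exp, Real.exp_le_one_iff]
      have e : -((ε : ℂ) - t₀ * Complex.I) * ‖ξ‖ ^ 2 + Complex.I * (inner ℝ x ξ : ℝ) =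
          ((-ε * ‖ξ‖ ^ 2 : ℝ) : ℂ) + ((t₀ * ‖ξ‖ ^ 2 + inner ℝ x ξ : ℝ) : ℂ) * Complex.I := by
        push_cast; ring
      rw [e, Complex.add_re, Complex.ofReal_re, Complex.re_ofReal_mul, Complex.I_re, mul_zero,
        add_zero]
      have : 0 < ε := hε
      nlinarith [sq_nonneg ‖ξ‖]
    · refine Filter.Eventually.of_forall fun ξ => ?_
      refine Filter.Tendsto.mono_left (Continuous.tendsto ?_ 0) nhdsWithin_le_nhds
      fun_prop
  have heq : ∫ ξ : Space d, φ (s • ξ) * Complex.exp ((t₀ * ‖ξ‖ ^ 2 : ℝ) * Complex.I) *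
      Complex.exp (Complex.I * (inner ℝ x ξ : ℝ)) = ∫ ξ : Space d, φ (s • ξ) *
        Complex.exp (-(((0 : ℝ) : ℂ) - t₀ * Complex.I) * ‖ξ‖ ^ 2 +
          Complex.I * (inner ℝ x ξ : ℝ)) := by
    refine integral_congr_ae (Filter.Eventually.of_forall fun ξ => ?_)
    simp only
    rw [mul_assoc, ← Complex.exp_add]
    congr 2
    push_cast; ring
  rw [heq]
  refine le_of_tendsto hlim.norm ?_
  filter_upwards [self_mem_nhdsWithin] with ε hε
  have hre : ((ε : ℂ) - t₀ * Complex.I).re = ε := by simp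
  refine (norm_integral_regularized_le φ s (b := (ε : ℂ) - t₀ * Complex.I) ?_ x).trans ?_
  · rw [hre]; exact hε
  · have him : |t₀| ≤ ‖(ε : ℂ) - t₀ * Complex.I‖ := by
      have := Complex.abs_im_le_norm ((ε : ℂ) - t₀ * Complex.I)
      simpa using this
    have : 0 < |t₀| := abs_pos.2 ht
    gcongr

/-- Comparison of exponents from an inequality at all large dyadic scales. -/
lemma exponent_le_of_forall_dyadic {x y K : ℝ} (j₀ : ℕ)
    (h : ∀ j : ℕ, j₀ ≤ j → ((2 : ℝ) ^ j) ^ x ≤ K * ((2 : ℝ) ^ j) ^ y) : x ≤ y := by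
  by_contra! hlt
  have h1 : (1 : ℝ) < 2 ^ (x - y) := Real.one_lt_rpow (by norm_num) (by linarith)
  obtain ⟨n, hn⟩ := pow_unbounded_of_one_lt K h1
  have h2 := h (max n j₀) (le_max_right _ _)
  have hpos : (0 : ℝ) < ((2 : ℝ) ^ (max n j₀)) ^ y := by positivity
  have h3 : (((2 : ℝ) ^ (x - y)) ^ (max n j₀)) * ((2 : ℝ) ^ (max n j₀)) ^ y =
      ((2 : ℝ) ^ (max n j₀)) ^ x := by
    simp only [← Real.rpow_natCast, ← Real.rpow_mul (show (0 : ℝ) ≤ 2 by norm_num)]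
    rw [← Real.rpow_add (by norm_num)]
    congr 1; ring
  rw [← h3] at h2
  have h4 := le_of_mul_le_mul_right h2 hpos
  have h5 := pow_le_pow_right₀ h1.le (le_max_left n j₀)
  linarith

/-- A smooth bump supported in the annulus `1 ≤ |ξ| ≤ 2`. -/
def annulusBump {d : ℕ} (i : Fin d) : ContDiffBump (EuclideanSpace.single i (3 / 2 : ℝ)) where
  rIn := 1 / 4
  rOut := 1 / 2
  rIn_pos := by norm_num
  rIn_lt_rOut := by norm_num

lemma norm_of_annulusBump {i : Fin d} {ξ : Space d} (h : annulusBump i ξ ≠ 0) :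
    1 ≤ ‖ξ‖ ∧ ‖ξ‖ ≤ 2 := by
  have h1 : ξ ∈ Function.support (annulusBump i) := h
  rw [ContDiffBump.support_eq, Metric.mem_ball, dist_eq_norm] at h1
  have h2 : ‖(EuclideanSpace.single i (3 / 2 : ℝ) : Space d)‖ = 3 / 2 := by
    rw [PiLp.norm_single, Real.norm_of_nonneg (by norm_num)]
  have h3 : ‖ξ - EuclideanSpace.single i (3 / 2 : ℝ)‖ < 1 / 2 := h1
  have h4 := norm_le_norm_sub_add ξ (EuclideanSpace.single i (3 / 2 : ℝ))
  have h5 := norm_le_norm_sub_add (EuclideanSpace.single i (3 / 2 : ℝ)) ξ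
  rw [norm_sub_rev] at h5
  constructor <;> linarith

lemma integral_comp_inv_smul (f : Space d → ℝ) {l : ℝ} (hl : 0 < l) :
    ∫ ξ, f (l⁻¹ • ξ) = l ^ d * ∫ ξ, f ξ := by
  rw [Measure.integral_comp_smul, finrank_euclideanSpace_fin, inv_pow, inv_inv,
    abs_of_pos (by positivity), smul_eq_mul]

lemma FrequencyEstimate.focusing {p q r : ℝ≥0∞} {α a b : ℝ}
    (h : FrequencyEstimate d p q r α a b) (hd : 1 ≤ d) (hp : 2 ≤ p) (hq : 2 ≤ q) (hr : 2 ≤ r)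
    {t₀ : ℝ} (ht₀ : t₀ ≠ 0) (ha : a ≤ t₀) (hb : t₀ < b) :
    (d : ℝ) * (1 - p⁻¹.toReal - q⁻¹.toReal) - 2 * r⁻¹.toReal ≤ α := by
  obtain ⟨C, c, hc, h⟩ := h
  set i₀ : Fin d := ⟨0, hd⟩
  set β := annulusBump i₀ with hβ
  have hβcs : HasCompactSupport fun ξ => (β ξ : ℂ) :=
    hasCompactSupport_of_norm_le (R := 2) fun ξ hξ =>
      (norm_of_annulusBump fun h0 => hξ (by rw [h0, Complex.ofReal_zero])).2
  have hβsm : ContDiff ℝ ∞ fun ξ => (β ξ : ℂ) := Complex.ofRealCLM.contDiff.comp β.contDiff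
  set φ : 𝓢(Space d, ℂ) := hβcs.toSchwartzMap hβsm with hφ
  have hφa : ∀ ξ, φ ξ = (β ξ : ℂ) := fun ξ => rfl
  set B : ℝ≥0 := (((2 * Real.pi) ^ d)⁻¹ *
    ((Real.pi / |t₀|) ^ ((d : ℝ) / 2) * ∫ z, ‖invHat φ z‖)).toNNReal with hB
  set A : ℝ := ((2 * Real.pi) ^ d)⁻¹ * ∫ ξ, ‖φ ξ‖ ^ 2 with hA
  have hA0 : 0 ≤ A := mul_nonneg (by positivity) (integral_nonneg fun ξ => by positivity)
  -- Frequencies reach `2l`, so `1/8` makes `(t - t₀)|ξ|² ≤ 1/2`. The radius `1/(4l)` used below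
  -- does the same for `⟨x, ξ⟩`.
  set δ : ℝ := min (1 / 8) (b - t₀) with hδ
  have hδ0 : 0 < δ := lt_min (by norm_num) (by linarith)
  set v : ℝ := (volume (Metric.closedBall (0 : Space d) (1 / 4))).toReal with hv
  have hv0 : 0 < v := ENNReal.toReal_pos
    (Metric.measure_closedBall_pos volume _ (by norm_num)).ne' measure_closedBall_lt_top.ne
  have hvv : volume (Metric.closedBall (0 : Space d) (1 / 4)) = ENNReal.ofReal v :=
    (ENNReal.ofReal_toReal measure_closedBall_lt_top.ne).symm
  set c₁ : ℝ := ((2 * Real.pi) ^ d)⁻¹ * (Real.cos 1 * (c * ∫ ξ, β ξ)) with hc₁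
  have hc₁0 : 0 < c₁ := by
    have := β.integral_pos (μ := volume)
    have := Real.cos_one_pos
    positivity
  have hr0 : 0 ≤ 1 - 2 * r⁻¹.toReal := by linarith [inv_toReal_le_half hr]
  have hq0 : 0 ≤ 1 - 2 * q⁻¹.toReal := by linarith [inv_toReal_le_half hq]
  have hp0 : 0 ≤ 1 - 2 * p⁻¹.toReal := by linarith [inv_toReal_le_half hp]
  have hpi : 0 ≤ p⁻¹.toReal := ENNReal.toReal_nonneg
  set K : ℝ := δ ^ (1 - 2 * r⁻¹.toReal) * v ^ (1 - 2 * q⁻¹.toReal) *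
    (C * ((B : ℝ) ^ (1 - 2 * p⁻¹.toReal) * A ^ p⁻¹.toReal)) ^ 2 / (v * δ * c₁ ^ 2) with hK
  -- On the left, the squared height `l^(2(d-α))` times the volume `l^(-d-2)` of the focal region.
  -- On the right, the Hölder factors in `t` and in `x` and the squared norm `l^(2d/p)` of the
  -- datum.
  have main : ∀ j : ℕ, 0 ≤ j → ((2 : ℝ) ^ j) ^ (-(d : ℝ) - 2 + 2 * d - 2 * α) ≤
      K * ((2 : ℝ) ^ j) ^ (-2 * (1 - 2 * r⁻¹.toReal) - d * (1 - 2 * q⁻¹.toReal) +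
        2 * (d * p⁻¹.toReal)) := by
    intro j _
    obtain ⟨w, hw, hwc, hest⟩ := h j
    set l : ℝ := 2 ^ j with hl
    have hl0 : 0 < l := by positivity
    have hl1 : 1 ≤ l := one_le_pow₀ (by norm_num)
    have hlα : (2 : ℝ) ^ (-(j * α)) = l ^ (-α) := by
      rw [hl, ← Real.rpow_natCast, ← Real.rpow_mul (by norm_num)]; congr 1; ring
    have hnl : ∀ ξ : Space d, ‖l⁻¹ • ξ‖ = ‖ξ‖ / l := fun ξ => by
      rw [norm_smul, norm_inv, Real.norm_of_nonneg hl0.le]; ring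
    have hsupp : ∀ ξ : Space d, β (l⁻¹ • ξ) ≠ 0 → l ≤ ‖ξ‖ ∧ ‖ξ‖ ≤ 2 * l := fun ξ hξ => by
      have := norm_of_annulusBump hξ
      rw [hnl, le_div_iff₀ hl0, div_le_iff₀ hl0] at this
      exact ⟨by linarith [this.1], this.2⟩
    set g : Space d → ℂ := fun ξ => φ (l⁻¹ • ξ) * Complex.exp ((t₀ * ‖ξ‖ ^ 2 : ℝ) * Complex.I)
      with hg
    have hg0 : ∀ ξ, g ξ ≠ 0 → l ≤ ‖ξ‖ ∧ ‖ξ‖ ≤ 2 * l := fun ξ hξ =>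
      hsupp ξ fun h0 => hξ (by simp [hg, hφa, h0])
    have hgcs : HasCompactSupport g := hasCompactSupport_of_norm_le fun ξ hξ => (hg0 ξ hξ).2
    have hgsm : ContDiff ℝ ∞ g := by
      have h1 : ContDiff ℝ ∞ fun ξ : Space d => φ (l⁻¹ • ξ) :=
        (φ.smooth ⊤).comp (contDiff_const_smul _)
      have h2 : ContDiff ℝ ∞ fun ξ : Space d => t₀ * ‖ξ‖ ^ 2 :=
        contDiff_const.mul (contDiff_norm_sq ℝ)
      have h3 : ContDiff ℝ ∞ fun ξ : Space d => ((t₀ * ‖ξ‖ ^ 2 : ℝ) : ℂ) :=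
        Complex.ofRealCLM.contDiff.comp h2
      exact h1.mul (h3.mul contDiff_const).cexp
    set ψ : 𝓢(Space d, ℂ) := hgcs.toSchwartzMap hgsm with hψ
    have hψg : (ψ : Space d → ℂ) = g := rfl
    have hmix := hest ψ fun ξ hξ => by
      have := hg0 ξ hξ
      rw [pow_succ, mul_comm]
      exact this
    -- the norm of the datum
    have hnorm : eLpNorm (synth ψ) p volume ≤
        ENNReal.ofReal ((B : ℝ) ^ (1 - 2 * p⁻¹.toReal) * (l ^ d * A) ^ p⁻¹.toReal) := by
      have hsup : ∀ x, ‖synth ψ x‖ₑ ≤ B := fun x => by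
        rw [← ofReal_norm, hB]
        exact ENNReal.ofReal_le_ofReal
          (norm_synth_chirp_le φ (inv_ne_zero hl0.ne') ht₀ x)
      have h2 : ∫⁻ x, ‖synth ψ x‖ₑ ^ (2 : ℝ) = ENNReal.ofReal (l ^ d * A) := by
        have h3 : ∫ x, ‖invHat ψ x‖ ^ 2 = l ^ d * A := by
          rw [integral_norm_sq_invHat]
          have : ∀ ξ, ‖ψ ξ‖ ^ 2 = ‖φ (l⁻¹ • ξ)‖ ^ 2 := fun ξ => by
            rw [hψg, hg]
            simp only [norm_mul, Complex.norm_exp_ofReal_mul_I, mul_one]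
          simp only [this]
          rw [integral_comp_inv_smul (fun ξ => ‖φ ξ‖ ^ 2) hl0]
          ring
        rw [← h3, ofReal_integral_eq_lintegral_ofReal]
        · refine lintegral_congr fun x => ?_
          rw [invHat_eq_synth, ENNReal.ofReal_pow (norm_nonneg _), ofReal_norm]
          norm_cast
        · exact ((invHat ψ).memLp 2).integrable_norm_pow (by norm_num)
        · exact Filter.Eventually.of_forall fun x => by positivity
      -- The dispersive sup bound does not depend on `l`, and Plancherel gives a squared `L²` norm
      -- proportional to `l^d`; interpolation yields `l^(d/p)`.
      refine (eLpNorm_le_of_enorm_le hsup (s := 2) (by norm_num) (by simpa using hp)).trans_eq ?_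
      rw [h2, ENNReal.ofReal_rpow_of_nonneg (by positivity) hpi, ENNReal.ofReal_mul (by positivity),
        ← ENNReal.ofReal_rpow_of_nonneg NNReal.zero_le_coe hp0, ENNReal.ofReal_coe_nnreal]
    set X : Set (Space d) := Metric.closedBall 0 (l⁻¹ * (1 / 4)) with hX
    set J : Set ℝ := Set.Icc t₀ (t₀ + δ / l ^ 2) with hJ
    have hvX : volume X = ENNReal.ofReal (v / l ^ d) := by
      rw [hX, Measure.addHaar_closedBall_mul volume _ (by positivity) (by norm_num),
        finrank_euclideanSpace_fin, hvv, ← ENNReal.ofReal_mul (by positivity)]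
      congr 1; rw [inv_pow]; ring
    have hvJ : volume J = ENNReal.ofReal (δ / l ^ 2) := by
      rw [hJ, Real.volume_Icc]; congr 1; ring
    set f : Space d → ℂ := fun ξ => (w ξ : ℂ) * ψ ξ with hf
    have hfc : Continuous f := (Complex.continuous_ofReal.comp hw.continuous).mul ψ.continuous
    have hfi : Integrable f := hfc.integrable_of_hasCompactSupport hgcs.mul_left
    have hδl : δ / l ^ 2 ≤ δ := div_le_self hδ0.le (one_le_pow₀ hl1)
    have hup := lintegral_sq_le_mixedNorm (a := a) (b := b) hq hr (continuous_evol hfc hfi)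
      (Ω := X ×ˢ J) (Metric.isClosed_closedBall.measurableSet.prod measurableSet_Icc)
      (X := X) Metric.isClosed_closedBall.measurableSet (M := (δ / l ^ 2).toNNReal)
      (fun z hz => ⟨hz.1, ha.trans hz.2.1, hz.2.2.trans (by
        have := min_le_right (1 / 8) (b - t₀)
        linarith)⟩)
      (fun x hx => by
        have : {t | (x, t) ∈ X ×ˢ J} = J := by ext t; simp [hx]
        rw [this, hvJ]
        exact le_rfl)
    have hlow : ENNReal.ofReal (v / l ^ d * (δ / l ^ 2) * (c₁ * (l ^ (-α) * l ^ d)) ^ 2) ≤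
        ∫⁻ z in X ×ˢ J, ‖evol f z.1 z.2‖ₑ ^ 2 := by
      have hvol : volume (X ×ˢ J) = ENNReal.ofReal (v / l ^ d * (δ / l ^ 2)) := by
        rw [Measure.volume_eq_prod, Measure.prod_prod, hvX, hvJ, ← ENNReal.ofReal_mul]
        positivity
      rw [ENNReal.ofReal_mul (by positivity), ← hvol, mul_comm, ← setLIntegral_const]
      refine setLIntegral_mono' (Metric.isClosed_closedBall.measurableSet.prod measurableSet_Icc)
        fun z hz => ?_
      rw [← ofReal_norm, ← ENNReal.ofReal_pow (norm_nonneg _)]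
      refine ENNReal.ofReal_le_ofReal (pow_le_pow_left₀ (by positivity) ?_ 2)
      have hβc : Continuous fun ξ : Space d => β (l⁻¹ • ξ) := β.continuous.comp (by fun_prop)
      have hβcs' : HasCompactSupport fun ξ : Space d => β (l⁻¹ • ξ) :=
        hasCompactSupport_of_norm_le fun ξ hξ => (hsupp ξ hξ).2
      have hi : Integrable fun ξ => w ξ * β (l⁻¹ • ξ) :=
        (hw.continuous.mul hβc).integrable_of_hasCompactSupport hβcs'.mul_left
      have hmono : ∀ ξ, c * l ^ (-α) * β (l⁻¹ • ξ) ≤ w ξ * β (l⁻¹ • ξ) := fun ξ => by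
        by_cases h0 : β (l⁻¹ • ξ) = 0
        · simp [h0]
        · refine mul_le_mul_of_nonneg_right ?_ β.nonneg
          have := hwc ξ (hsupp ξ h0).1 (by rw [pow_succ, mul_comm]; exact (hsupp ξ h0).2)
          rwa [hlα] at this
      have key := le_norm_evol (h := fun ξ => w ξ * β (l⁻¹ • ξ)) (Θ := fun ξ => t₀ * ‖ξ‖ ^ 2) hi
        (fun ξ => (mul_nonneg (by positivity) β.nonneg).trans (hmono ξ)) (by fun_prop) 0
        (x := z.1) (t := z.2) (fun ξ hξ => by
          have hξl := (hsupp ξ fun h0 => hξ (by simp [h0])).2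
          have h1 : |inner ℝ z.1 ξ| ≤ 1 / 2 := by
            refine (abs_real_inner_le_norm _ _).trans ?_
            have hz1 : ‖z.1‖ ≤ l⁻¹ * (1 / 4) := by simpa [hX] using hz.1
            calc ‖z.1‖ * ‖ξ‖ ≤ (l⁻¹ * (1 / 4)) * (2 * l) := by gcongr
              _ = 1 / 2 := by field_simp; norm_num
          have h2 : |t₀ * ‖ξ‖ ^ 2 - z.2 * ‖ξ‖ ^ 2| ≤ 1 / 2 := by
            rw [← sub_mul, abs_mul, abs_of_nonneg (sq_nonneg ‖ξ‖), abs_sub_comm,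
              abs_of_nonneg (by linarith [hz.2.1])]
            have hz2 : z.2 - t₀ ≤ (1 / 8) / l ^ 2 := by
              have : δ / l ^ 2 ≤ (1 / 8) / l ^ 2 := by gcongr; exact min_le_left _ _
              linarith [hz.2.2]
            calc (z.2 - t₀) * ‖ξ‖ ^ 2 ≤ (1 / 8) / l ^ 2 * (2 * l) ^ 2 := by gcongr
              _ = 1 / 2 := by field_simp; norm_num
          rw [sub_zero]
          exact (abs_add_le _ _).trans (by linarith))
      have hfun : (fun ξ => ((w ξ * β (l⁻¹ • ξ) : ℝ) : ℂ) *
          Complex.exp ((t₀ * ‖ξ‖ ^ 2 : ℝ) * Complex.I)) = f := by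
        funext ξ
        rw [hf, hψg, hg]
        simp only [hφa]
        rw [Complex.ofReal_mul, mul_assoc]
      rw [hfun] at key
      refine le_trans ?_ key
      have hcos : 0 < Real.cos 1 := Real.cos_one_pos
      have hint : c * l ^ (-α) * (l ^ d * ∫ ξ, β ξ) ≤ ∫ ξ, w ξ * β (l⁻¹ • ξ) := by
        rw [← integral_comp_inv_smul (fun ξ => β ξ) hl0, ← integral_const_mul]
        exact integral_mono ((hβc.integrable_of_hasCompactSupport hβcs').const_mul _) hi hmono
      calc c₁ * (l ^ (-α) * l ^ d) = ((2 * Real.pi) ^ d)⁻¹ * (Real.cos 1 *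
            (c * l ^ (-α) * (l ^ d * ∫ ξ, β ξ))) := by rw [hc₁]; ring
        _ ≤ _ := by gcongr
    have hchain : ENNReal.ofReal (v / l ^ d * (δ / l ^ 2) * (c₁ * (l ^ (-α) * l ^ d)) ^ 2) ≤
        ENNReal.ofReal ((δ / l ^ 2) ^ (1 - 2 * r⁻¹.toReal) *
          (v / l ^ d) ^ (1 - 2 * q⁻¹.toReal) *
          (C * ((B : ℝ) ^ (1 - 2 * p⁻¹.toReal) * (l ^ d * A) ^ p⁻¹.toReal)) ^ 2) := by
      refine hlow.trans (hup.trans ?_)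
      rw [ENNReal.ofReal_mul (by positivity), ENNReal.ofReal_mul (by positivity),
        ENNReal.ofReal_pow (by positivity)]
      gcongr
      · rw [← ENNReal.ofReal_rpow_of_nonneg (by positivity) hr0]; rfl
      · rw [← ENNReal.ofReal_rpow_of_nonneg (by positivity) hq0, hvX]
      · rw [ENNReal.ofReal_mul NNReal.zero_le_coe, ENNReal.ofReal_coe_nnreal]
        exact hmix.trans (mul_le_mul_right hnorm _)
    rw [ENNReal.ofReal_le_ofReal_iff (by positivity)] at hchain
    -- collect powers of `l`
    have hR : (δ / l ^ 2) ^ (1 - 2 * r⁻¹.toReal) * (v / l ^ d) ^ (1 - 2 * q⁻¹.toReal) *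
        (C * ((B : ℝ) ^ (1 - 2 * p⁻¹.toReal) * (l ^ d * A) ^ p⁻¹.toReal)) ^ 2 =
        (δ ^ (1 - 2 * r⁻¹.toReal) * v ^ (1 - 2 * q⁻¹.toReal) *
        (C * ((B : ℝ) ^ (1 - 2 * p⁻¹.toReal) * A ^ p⁻¹.toReal)) ^ 2) *
        l ^ (-2 * (1 - 2 * r⁻¹.toReal) - d * (1 - 2 * q⁻¹.toReal) + 2 * (d * p⁻¹.toReal)) := by
      have e1 : (δ / l ^ 2) ^ (1 - 2 * r⁻¹.toReal) =
          δ ^ (1 - 2 * r⁻¹.toReal) * l ^ (-2 * (1 - 2 * r⁻¹.toReal)) := by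
        rw [div_eq_mul_inv, Real.mul_rpow hδ0.le (by positivity), ← Real.rpow_natCast,
          ← Real.rpow_neg hl0.le, ← Real.rpow_mul hl0.le]
        norm_num
      have e2 : (v / l ^ d) ^ (1 - 2 * q⁻¹.toReal) =
          v ^ (1 - 2 * q⁻¹.toReal) * l ^ (-(d * (1 - 2 * q⁻¹.toReal))) := by
        rw [div_eq_mul_inv, Real.mul_rpow hv0.le (by positivity), ← Real.rpow_natCast,
          ← Real.rpow_neg hl0.le, ← Real.rpow_mul hl0.le, neg_mul]
      have e3 : (l ^ d * A) ^ p⁻¹.toReal = l ^ (d * p⁻¹.toReal) * A ^ p⁻¹.toReal := by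
        rw [Real.mul_rpow (by positivity) hA0, ← Real.rpow_natCast, ← Real.rpow_mul hl0.le]
      have e4 : l ^ (2 * (d * p⁻¹.toReal)) = (l ^ (d * p⁻¹.toReal)) ^ 2 := by
        rw [← Real.rpow_natCast, ← Real.rpow_mul hl0.le]; congr 1; push_cast; ring
      have e5 : -2 * (1 - 2 * r⁻¹.toReal) - d * (1 - 2 * q⁻¹.toReal) + 2 * (d * p⁻¹.toReal) =
          -2 * (1 - 2 * r⁻¹.toReal) + -(d * (1 - 2 * q⁻¹.toReal)) + 2 * (d * p⁻¹.toReal) := by ring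
      rw [e1, e2, e3, e5, Real.rpow_add hl0, Real.rpow_add hl0, e4]
      ring
    have hLf : v / l ^ d * (δ / l ^ 2) * (c₁ * (l ^ (-α) * l ^ d)) ^ 2 =
        (v * δ * c₁ ^ 2) * l ^ (-(d : ℝ) - 2 + 2 * d - 2 * α) := by
      have e1 : l ^ (-(d : ℝ) - 2 + 2 * d - 2 * α) = (l ^ d)⁻¹ * (l ^ 2)⁻¹ *
          (l ^ (-α) * l ^ d) ^ 2 := by
        rw [mul_pow, show -(d : ℝ) - 2 + 2 * d - 2 * α = -(d : ℝ) + (-(2 : ℕ)) + ((-α) * (2 : ℕ) +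
          d * (2 : ℕ)) by push_cast; ring, Real.rpow_add hl0, Real.rpow_add hl0, Real.rpow_add hl0,
          Real.rpow_neg hl0.le, Real.rpow_neg hl0.le, Real.rpow_natCast, Real.rpow_natCast,
          Real.rpow_mul hl0.le, Real.rpow_mul hl0.le, Real.rpow_natCast, Real.rpow_natCast,
          Real.rpow_natCast]
      rw [e1]; field_simp
    rw [hR, hLf] at hchain
    rw [hK, div_mul_eq_mul_div, le_div_iff₀ (by positivity)]
    linarith
  have := exponent_le_of_forall_dyadic 0 main
  nlinarith

/-! ### Binary digit sums and the Besicovitch–Keich covering. -/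

/-- The sum `∑ ε_i 2^{-(i+1)} c_i` over binary digits `ε_i`. -/
def digitSum {n : ℕ} (e : Fin n → Bool) (c : ℕ → ℝ) : ℝ :=
  ∑ i : Fin n, if e i then (1 / 2 : ℝ) ^ ((i : ℕ) + 1) * c i else 0

lemma digitSum_succ {n : ℕ} (e : Fin (n + 1) → Bool) (c : ℕ → ℝ) :
    digitSum e c = (if e 0 then 1 / 2 * c 0 else 0) +
      1 / 2 * digitSum (fun i => e i.succ) (fun i => c (i + 1)) := by
  rw [digitSum, Fin.sum_univ_succ, digitSum, Finset.mul_sum]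
  congr 1
  · simp
  · refine Finset.sum_congr rfl fun i _ => ?_
    rw [mul_ite, mul_zero, Fin.val_succ, pow_succ' _ ((i : ℕ) + 1)]
    simp only [mul_assoc]

lemma digitSum_sub {n : ℕ} (e : Fin n → Bool) (c c' : ℕ → ℝ) :
    digitSum e (fun i => c i - c' i) = digitSum e c - digitSum e c' := by
  rw [digitSum, digitSum, digitSum, ← Finset.sum_sub_distrib]
  refine Finset.sum_congr rfl fun i _ => ?_
  split_ifs <;> ring

lemma digitSum_const {n : ℕ} (e : Fin n → Bool) (x : ℝ) :
    digitSum e (fun _ => x) = x * digitSum e (fun _ => 1) := by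
  rw [digitSum, digitSum, Finset.mul_sum]
  refine Finset.sum_congr rfl fun i _ => ?_
  split_ifs <;> ring

/-- The deficit `(1/2)^n` in the geometric sum is exactly the room that separates distinct digit
strings in `le_abs_digitSum_sub`. -/
lemma abs_digitSum_le {n : ℕ} (e : Fin n → Bool) {c : ℕ → ℝ} {B : ℝ} (h : ∀ i, |c i| ≤ B) :
    |digitSum e c| ≤ B * (1 - (1 / 2) ^ n) := by
  induction n generalizing c with
  | zero => simp [digitSum]
  | succ n ih =>
    have hB : 0 ≤ B := (abs_nonneg _).trans (h 0)
    have h1 := ih (fun i => e i.succ) (c := fun i => c (i + 1)) fun i => h (i + 1)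
    have h2 : |if e 0 then 1 / 2 * c 0 else 0| ≤ 1 / 2 * B := by
      split_ifs
      · rw [abs_mul, abs_of_pos (by norm_num : (0 : ℝ) < 1 / 2)]
        linarith [h 0]
      · simpa using hB
    rw [digitSum_succ]
    refine (abs_add_le _ _).trans ?_
    rw [abs_mul, abs_of_pos (by norm_num : (0 : ℝ) < 1 / 2), pow_succ]
    linarith

lemma digitSum_nonneg {n : ℕ} (e : Fin n → Bool) {c : ℕ → ℝ} (h : ∀ i, 0 ≤ c i) :
    0 ≤ digitSum e c :=
  Finset.sum_nonneg fun i _ => by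
    split_ifs
    · exact mul_nonneg (by positivity) (h i)
    · exact le_rfl

/-- Digit sums with nonincreasing positive weights are separated. -/
lemma le_abs_digitSum_sub {n : ℕ} {e e' : Fin n → Bool} (hne : e ≠ e') {c : ℕ → ℝ}
    (hc : Antitone c) {κ : ℝ} (hκ : 0 ≤ κ) (h : ∀ i, κ ≤ c i) :
    (1 / 2) ^ n * κ ≤ |digitSum e c - digitSum e' c| := by
  induction n generalizing c with
  | zero => exact absurd (Subsingleton.elim e e') hne
  | succ n ih =>
    have hc' : Antitone fun i => c (i + 1) := fun i k hik => hc (by omega)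
    -- The first differing digit dominates: since the weights decrease, all later digits together
    -- fall short of `c 0` by `(1/2)^n * c 0`.
    have tail : ∀ e₁ e₂ : Fin n → Bool,
        -(c 0 * (1 - (1 / 2) ^ n)) ≤
          digitSum e₁ (fun i => c (i + 1)) - digitSum e₂ (fun i => c (i + 1)) := by
      intro e₁ e₂
      have h1 := digitSum_nonneg e₁ (c := fun i => c (i + 1)) fun i => hκ.trans (h _)
      have h2 := abs_digitSum_le e₂ (c := fun i => c (i + 1)) (B := c 0) fun i => by
        rw [abs_of_nonneg (hκ.trans (h _))]; exact hc (by omega)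
      linarith [le_abs_self (digitSum e₂ fun i => c (i + 1))]
    rw [digitSum_succ e, digitSum_succ e']
    have hpow : (0 : ℝ) < (1 / 2) ^ n := by positivity
    rcases h0 : e 0 with _ | _ <;> rcases h0' : e' 0 with _ | _
    · have hne' : (fun i : Fin n => e i.succ) ≠ fun i => e' i.succ := fun heq => hne <| by
        funext i
        refine Fin.cases (by rw [h0, h0']) (fun i => congrFun heq i) i
      have := ih hne' hc' fun i => h (i + 1)
      simp only [Bool.false_eq_true, if_false, zero_add, ← mul_sub, abs_mul]
      rw [abs_of_pos (by norm_num : (0 : ℝ) < 1 / 2), pow_succ]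
      linarith
    · have := tail (fun i => e' i.succ) (fun i => e i.succ)
      simp only [Bool.false_eq_true, if_false, zero_add, if_true]
      rw [abs_sub_comm, pow_succ]
      refine le_trans ?_ (le_abs_self _)
      nlinarith [h 0]
    · have := tail (fun i => e i.succ) (fun i => e' i.succ)
      simp only [Bool.false_eq_true, if_false, zero_add, if_true]
      rw [pow_succ]
      refine le_trans ?_ (le_abs_self _)
      nlinarith [h 0]
    · have hne' : (fun i : Fin n => e i.succ) ≠ fun i => e' i.succ := fun heq => hne <| by
        funext i
        refine Fin.cases (by rw [h0, h0']) (fun i => congrFun heq i) i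
      have := ih hne' hc' fun i => h (i + 1)
      simp only [if_true, add_sub_add_left_eq_sub, ← mul_sub, abs_mul]
      rw [abs_of_pos (by norm_num : (0 : ℝ) < 1 / 2), pow_succ]
      linarith

lemma sum_mul_half_pow_le (n : ℕ) :
    ∑ i ∈ Finset.range n, (1 / 2 : ℝ) ^ (i + 1) * (i + 1) ≤ 2 := by
  have : ∑ i ∈ Finset.range n, (1 / 2 : ℝ) ^ (i + 1) * (i + 1) = 2 - (n + 2) * (1 / 2) ^ n := by
    induction n with
    | zero => simp
    | succ n ih => rw [Finset.sum_range_succ, ih]; push_cast; ring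
  rw [this]
  have : (0 : ℝ) ≤ (n + 2) * (1 / 2) ^ n := by positivity
  linarith

/-- The heights at which the lines of the Besicovitch–Keich configuration are recombined. -/
def keichNode (β w : ℝ) (m i : ℕ) : ℝ := β - w * (min (i + 1) m : ℕ) / m

lemma keichNode_antitone {β w : ℝ} (hw : 0 ≤ w) (m : ℕ) : Antitone (keichNode β w m) := by
  intro i k hik
  have : ((min (i + 1) m : ℕ) : ℝ) ≤ (min (k + 1) m : ℕ) := by
    exact_mod_cast min_le_min_right m (by omega)
  simp only [keichNode]
  gcongr

lemma keichNode_mem {β w : ℝ} (hw : 0 ≤ w) {m : ℕ} (hm : 0 < m) (i : ℕ) :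
    keichNode β w m i ∈ Set.Icc (β - w) β := by
  have h1 : ((min (i + 1) m : ℕ) : ℝ) ≤ m := by exact_mod_cast min_le_right _ _
  have hm' : (0 : ℝ) < m := by exact_mod_cast hm
  have h2 : w * (min (i + 1) m : ℕ) / m ≤ w := by
    rw [div_le_iff₀ hm']; gcongr
  have h3 : 0 ≤ w * (min (i + 1) m : ℕ) / m := by positivity
  simp only [keichNode]
  constructor <;> linarith

/-- Every slice of the Besicovitch–Keich configuration is covered by few short intervals. -/
lemma exists_keich_cover {m : ℕ} (hm : 0 < m) {β w x : ℝ} (hw : 0 < w) (h1 : β - w ≤ x)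
    (h2 : x ≤ β) : ∃ (T : Finset ℝ) (l : ℝ), 0 ≤ l ∧
      (∀ e : Fin (2 * m) → Bool, ∃ τ ∈ T, τ ≤ digitSum e (fun i => x - keichNode β w m i) ∧
        digitSum e (fun i => x - keichNode β w m i) ≤ τ + l) ∧
      (T.card : ℝ) * l ≤ 2 * w / m ∧ (T.card : ℝ) ≤ 2 ^ m := by
  classical
  have hm' : (0 : ℝ) < m := by exact_mod_cast hm
  set c : ℕ → ℝ := fun i => x - keichNode β w m i with hc
  -- The index `k` locates `x` among the equally spaced nodes. The first `k` digits leave `2^k`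
  -- possible heads; from index `k` on the coefficients `x - z_i` are nonnegative and grow at most
  -- linearly from a value at most `w/m`, so the weighted tail is at most `2^(-k) · 2w/m`.
  set k : ℕ := ⌊(β - x) * m / w⌋₊ with hk
  have hnn : 0 ≤ (β - x) * m / w := by
    have : 0 ≤ β - x := by linarith
    positivity
  have hk1 : w * k / m ≤ β - x := by
    have := Nat.floor_le hnn
    rw [← hk, le_div_iff₀ hw] at this
    rw [div_le_iff₀ hm']; linarith
  have hk2 : β - x < w * (k + 1) / m := by
    have := Nat.lt_floor_add_one ((β - x) * m / w)
    rw [← hk, div_lt_iff₀ hw] at this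
    rw [lt_div_iff₀ hm']; linarith
  have hkm : k ≤ m := by
    have : w * k ≤ w * m := by
      rw [div_le_iff₀ hm'] at hk1
      nlinarith
    exact_mod_cast le_of_mul_le_mul_left this hw
  have hc0 : ∀ i, 0 ≤ c (k + i) := fun i => by
    simp only [hc, keichNode]
    rcases Nat.lt_or_ge k m with hlt | hge
    · have : ((k + 1 : ℕ) : ℝ) ≤ (min (k + i + 1) m : ℕ) := by
        exact_mod_cast le_min (by omega) (by omega)
      have h3 : w * (k + 1) / m ≤ w * (min (k + i + 1) m : ℕ) / m := by
        push_cast at this ⊢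
        gcongr
      linarith
    -- For `k ≥ m` the nodes have been truncated to the left endpoint `β - w`, which is at most `x`.
    · have : min (k + i + 1) m = m := min_eq_right (by omega)
      rw [this, mul_div_assoc, div_self hm'.ne']
      linarith
  have hc1 : ∀ i, c (k + i) ≤ w / m * (i + 1) := fun i => by
    have : ((min (k + i + 1) m : ℕ) : ℝ) ≤ (k + i + 1 : ℕ) := by exact_mod_cast min_le_left _ _
    have h3 : w * (min (k + i + 1) m : ℕ) / m ≤ w * (k + i + 1 : ℕ) / m := by gcongr
    have h4 : w * ((k + i + 1 : ℕ) : ℝ) / m = w * k / m + w / m * (i + 1) := by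
      push_cast; ring
    simp only [hc, keichNode]
    linarith
  obtain ⟨n', hn'⟩ := Nat.exists_eq_add_of_le (show k ≤ 2 * m by omega)
  refine ⟨Finset.univ.image fun π : Fin k → Bool => digitSum π c, (1 / 2) ^ k * (w / m * 2),
    by positivity, ?_, ?_, ?_⟩
  · rw [hn']
    intro e
    refine ⟨_, Finset.mem_image_of_mem _ (Finset.mem_univ fun i => e (Fin.castAdd n' i)), ?_⟩
    have hsplit : digitSum e c = digitSum (fun i => e (Fin.castAdd n' i)) c +
        ∑ i : Fin n', if e (Fin.natAdd k i) then
          (1 / 2 : ℝ) ^ (k + (i : ℕ) + 1) * c (k + i) else 0 := by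
      rw [digitSum, Fin.sum_univ_add]
      rfl
    rw [hsplit]
    constructor
    · refine le_add_of_nonneg_right (Finset.sum_nonneg fun i _ => ?_)
      split_ifs
      · exact mul_nonneg (by positivity) (hc0 i)
      · exact le_rfl
    · gcongr
      calc ∑ i : Fin n', (if e (Fin.natAdd k i) then
            (1 / 2 : ℝ) ^ (k + (i : ℕ) + 1) * c (k + i) else 0)
          ≤ ∑ i : Fin n', (1 / 2) ^ k * (w / m * ((1 / 2 : ℝ) ^ ((i : ℕ) + 1) * ((i : ℕ) + 1))) := by
            refine Finset.sum_le_sum fun i _ => ?_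
            split_ifs
            · rw [add_assoc, pow_add]
              have := mul_le_mul_of_nonneg_left (hc1 i)
                (show (0 : ℝ) ≤ (1 / 2) ^ k * (1 / 2) ^ ((i : ℕ) + 1) by positivity)
              linarith
            · positivity
        _ = (1 / 2) ^ k * (w / m * ∑ i ∈ Finset.range n', (1 / 2 : ℝ) ^ (i + 1) * (i + 1)) := by
            rw [Finset.sum_range, Finset.mul_sum, Finset.mul_sum]
        _ ≤ _ := by gcongr; exact sum_mul_half_pow_le n'
  · have hcard : ((Finset.univ.image fun π : Fin k → Bool => digitSum π c).card : ℝ) ≤ 2 ^ k := by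
      have := Finset.card_image_le (s := Finset.univ) (f := fun π : Fin k → Bool => digitSum π c)
      rw [Finset.card_univ, Fintype.card_fun, Fintype.card_bool, Fintype.card_fin] at this
      exact_mod_cast this
    calc _ ≤ (2 : ℝ) ^ k * ((1 / 2) ^ k * (w / m * 2)) := by gcongr
      _ = (2 * (1 / 2)) ^ k * (w / m * 2) := by rw [mul_pow]; ring
      _ = _ := by norm_num; ring
  · have := Finset.card_image_le (s := Finset.univ) (f := fun π : Fin k → Bool => digitSum π c)
    rw [Finset.card_univ, Fintype.card_fun, Fintype.card_bool, Fintype.card_fin] at this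
    exact_mod_cast this.trans (Nat.pow_le_pow_right (by norm_num) hkm)

/-! ### Boxes and admissible time intervals. -/

lemma volume_box (l u : Fin d → ℝ) :
    volume {x : Space d | ∀ i, x i ∈ Set.Icc (l i) (u i)} = ∏ i, ENNReal.ofReal (u i - l i) := by
  have e : {x : Space d | ∀ i, x i ∈ Set.Icc (l i) (u i)} =
      (MeasurableEquiv.toLp 2 (Fin d → ℝ)).symm ⁻¹' (Set.univ.pi fun i => Set.Icc (l i) (u i)) := by
    ext x
    simp only [Set.mem_ofPred_eq, Set.mem_preimage, Set.mem_univ_pi]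
    rfl
  rw [e, (EuclideanSpace.volume_preserving_symm_measurableEquiv_toLp (Fin d)).measure_preimage
    (MeasurableSet.univ_pi fun i => measurableSet_Icc).nullMeasurableSet, volume_pi_pi]
  simp only [Real.volume_Icc]

lemma measurableSet_box (l u : Fin d → ℝ) :
    MeasurableSet {x : Space d | ∀ i, x i ∈ Set.Icc (l i) (u i)} := by
  rw [Set.ofPred_forall]
  refine MeasurableSet.iInter fun i => ?_
  exact (isClosed_Icc.preimage (EuclideanSpace.proj i).continuous).measurableSet

/-- A box with one distinguished side. -/
def slab (i₀ : Fin d) (A B : ℝ) : Set (Space d) :=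
  {x | ∀ i, x i ∈ Set.Icc (if i = i₀ then A else -(1 / 2)) (if i = i₀ then B else 1 / 2)}

lemma volume_slab (i₀ : Fin d) (A B : ℝ) : volume (slab i₀ A B) = ENNReal.ofReal (B - A) := by
  rw [slab, volume_box]
  rw [Finset.prod_eq_single i₀]
  · simp
  · intro i _ hi
    simp only [hi, if_false]
    norm_num
  · simp

/-- A box with two distinguished sides. -/
def slab₂ (i₀ i₁ : Fin d) (A B A' B' : ℝ) : Set (Space d) :=
  {x | ∀ i, x i ∈ Set.Icc (if i = i₀ then A else if i = i₁ then A' else -(1 / 2))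
    (if i = i₀ then B else if i = i₁ then B' else 1 / 2)}

lemma volume_slab₂ {i₀ i₁ : Fin d} (h : i₀ ≠ i₁) (A B A' B' : ℝ) :
    volume (slab₂ i₀ i₁ A B A' B') = ENNReal.ofReal (B - A) * ENNReal.ofReal (B' - A') := by
  rw [slab₂, volume_box]
  rw [Finset.prod_eq_mul i₀ i₁ h]
  · simp [h.symm]
  · intro i _ hi
    simp only [hi.1, hi.2, if_false]
    norm_num
  · simp
  · simp

lemma InTube.abs_apply_le {x₀ ξ₀ y : Space d} {t : ℝ} (h : InTube x₀ ξ₀ y t) (i : Fin d) :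
    |y i - x₀ i - 2 * t * ξ₀ i| ≤ 1 / 2 := by
  have := (PiLp.norm_apply_le (y - x₀ - (2 * t) • ξ₀) i).trans h
  simpa using this

lemma norm_single_real (i : Fin d) (x : ℝ) : ‖(EuclideanSpace.single i x : Space d)‖ = |x| := by
  rw [PiLp.norm_single, Real.norm_eq_abs]

/-- A short interval of times around a point of `(a, b)`. -/
lemma exists_time_interval {a b t₀ : ℝ} (h : t₀ ∈ Set.Ioo a b) :
    ∃ δ : ℝ, 0 < δ ∧ δ ≤ 1 / 2 ∧ a ≤ t₀ - δ ∧ t₀ + δ ≤ b :=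
  ⟨min (1 / 2) (min (t₀ - a) (b - t₀)), by
    have := h.1; have := h.2
    refine lt_min (by norm_num) (lt_min ?_ ?_) <;> linarith, min_le_left _ _, by
    have := (min_le_right (1 / 2) _).trans (min_le_left (t₀ - a) (b - t₀))
    linarith, by
    have := (min_le_right (1 / 2) _).trans (min_le_right (t₀ - a) (b - t₀))
    linarith⟩

/-! ### Parallel packets and a single packet. -/

/-- At a fixed frequency the tubes stay within bounded distance of their starting points, so `N`
packets sweep a volume `O(N)` and letting `N` grow compares the exponents `1` and `1 - 2/q + 2/p`.
-/
lemma FrequencyEstimate.inv_le_inv {p q r : ℝ≥0∞} {α a b : ℝ}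
    (h : FrequencyEstimate d p q r α a b) (hd : 1 ≤ d) (hab : a < b) (hp : 2 ≤ p) (hq : 2 ≤ q)
    (hr : 2 ≤ r) : q⁻¹.toReal ≤ p⁻¹.toReal := by
  set t₀ : ℝ := (a + b) / 2 with ht₀
  obtain ⟨δ, hδ, hδ1, hδa, hδb⟩ := exists_time_interval (show t₀ ∈ Set.Ioo a b from ⟨by linarith, by linarith⟩)
  obtain ⟨C, hC, h⟩ := h.packet_inequality hp hq hr t₀ one_pos
  set i₀ : Fin d := ⟨0, hd⟩
  set R : ℝ := 1 / 2 + 12 * (|t₀| + 1) with hR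
  set v : ℝ := (volume (Metric.closedBall (0 : Space d) R)).toReal with hv
  have hq0 : 0 ≤ 1 - 2 * q⁻¹.toReal := by linarith [inv_toReal_le_half hq]
  have main : ∀ n : ℕ, 0 ≤ n → ((2 : ℝ) ^ n) ^ (1 : ℝ) ≤
      ((C * (2 * δ) ^ (1 - 2 * r⁻¹.toReal) * v ^ (1 - 2 * q⁻¹.toReal) *
        2 ^ (2 * ((2 : ℕ) * α))) / (2 * δ)) *
      ((2 : ℝ) ^ n) ^ (1 - 2 * q⁻¹.toReal + 2 * p⁻¹.toReal) := by
    intro n _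
    set N : ℕ := 2 ^ n with hN
    have hN0 : (0 : ℝ) < N := by positivity
    set x : Fin N → Space d := fun k => EuclideanSpace.single i₀ (k : ℝ) with hx
    -- The scale `j = 2` is the fixed one, and `6` lies between `2^2 + 1` and `2^3 - 1`. The
    -- displacement is `2 · 6 · |t|`, whence the `12` in `R`.
    have := h 2 x (fun _ => EuclideanSpace.single i₀ 6) (fun i k hik => by
        refine le_trans ?_ (PiLp.norm_apply_le (x i - x k) i₀)
        have : ((i : ℕ) : ℤ) - ((k : ℕ) : ℤ) ≠ 0 := by
          have := Fin.val_injective.ne hik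
          omega
        have := Int.one_le_abs this
        simp only [hx, PiLp.sub_apply, PiLp.single_apply, if_true, Real.norm_eq_abs]
        exact_mod_cast this)
      (fun i => by rw [norm_single_real]; norm_num) (t₀ - δ) (t₀ + δ) (by linarith) hδa hδb
      (by linarith) (by linarith) (⋃ k, Metric.closedBall (x k) R) (2 * δ) (N * v)
      (MeasurableSet.iUnion fun k => Metric.isClosed_closedBall.measurableSet) (by positivity)
      (by positivity) (by
        refine (measure_iUnion_le _).trans ?_
        simp only [Measure.addHaar_closedBall_center, tsum_fintype, Finset.sum_const,
          Finset.card_univ, Fintype.card_fin, nsmul_eq_mul]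
        rw [ENNReal.ofReal_mul (by positivity), ENNReal.ofReal_natCast,
          ENNReal.ofReal_toReal measure_closedBall_lt_top.ne])
      (fun k t ht y hy => by
        refine Set.mem_iUnion.2 ⟨k, ?_⟩
        rw [Metric.mem_closedBall, dist_eq_norm]
        have h1 := norm_le_norm_sub_add (y - x k) ((2 * t) • EuclideanSpace.single i₀ (6 : ℝ))
        rw [norm_smul, norm_single_real, Real.norm_eq_abs, abs_mul] at h1
        have h2 : |t| ≤ |t₀| + 1 := by
          have h3 : |t - t₀| ≤ 1 := by rw [abs_le]; constructor <;> linarith [ht.1, ht.2]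
          have h4 := abs_add_le (t - t₀) t₀
          rw [sub_add_cancel] at h4
          linarith
        have h5 : ‖y - x k - (2 * t) • EuclideanSpace.single i₀ (6 : ℝ)‖ ≤ 1 / 2 := hy
        norm_num at h1
        linarith)
      (fun y _ => by
        refine (measure_mono (t := Set.Icc (t₀ - δ) (t₀ + δ)) fun t ht => ht.1).trans_eq ?_
        rw [Real.volume_Icc]; congr 1; ring)
    rw [Fintype.card_fin, Real.mul_rpow hN0.le (by positivity)] at this
    have hcast : (N : ℝ) = 2 ^ n := by rw [hN]; push_cast; rfl
    rw [← hcast, Real.rpow_one, Real.rpow_add hN0, div_mul_eq_mul_div, le_div_iff₀ (by positivity)]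
    calc (N : ℝ) * (2 * δ) = N * (t₀ + δ - (t₀ - δ)) := by ring
      _ ≤ _ := this
      _ = _ := by ring
  have := exponent_le_of_forall_dyadic 0 main
  linarith

/-- One packet of frequency about `l` travels a distance about `l` and stays over each point only
for a time about `1/l`. -/
lemma FrequencyEstimate.inv_sub_inv_le {p q r : ℝ≥0∞} {α a b : ℝ}
    (h : FrequencyEstimate d p q r α a b) (hd : 1 ≤ d) (hab : a < b) (hp : 2 ≤ p) (hq : 2 ≤ q)
    (hr : 2 ≤ r) : q⁻¹.toReal - r⁻¹.toReal ≤ α := by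
  set t₀ : ℝ := (a + b) / 2 with ht₀
  obtain ⟨δ, hδ, hδ1, hδa, hδb⟩ := exists_time_interval (show t₀ ∈ Set.Ioo a b from ⟨by linarith, by linarith⟩)
  obtain ⟨C, hC, h⟩ := h.packet_inequality hp hq hr t₀ one_pos
  set i₀ : Fin d := ⟨0, hd⟩
  have hq0 : 0 ≤ 1 - 2 * q⁻¹.toReal := by linarith [inv_toReal_le_half hq]
  -- From `j ≥ 1` on, `3l/2` lies between `l + 1` and `2l - 1`.
  have main : ∀ j : ℕ, 1 ≤ j → ((2 : ℝ) ^ j) ^ (0 : ℝ) ≤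
      (C * (1 / 3) ^ (1 - 2 * r⁻¹.toReal) * (6 * δ + 1) ^ (1 - 2 * q⁻¹.toReal) / (2 * δ)) *
      ((2 : ℝ) ^ j) ^ (-(1 - 2 * r⁻¹.toReal) + (1 - 2 * q⁻¹.toReal) + 2 * α) := by
    intro j hj
    set l : ℝ := 2 ^ j with hl
    have hl0 : 0 < l := by positivity
    have hl2 : 2 ≤ l := by
      calc (2 : ℝ) = 2 ^ 1 := by norm_num
        _ ≤ l := pow_le_pow_right₀ (by norm_num) hj
    set L : ℝ := 3 / 2 * l with hL
    have hL0 : 0 < L := by positivity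
    have := h j (fun _ : Unit => (0 : Space d)) (fun _ => EuclideanSpace.single i₀ L)
      (fun i k hik => absurd (Subsingleton.elim i k) hik)
      (fun i => by
        rw [norm_single_real, abs_of_pos hL0, pow_succ, ← hl]
        constructor <;> linarith) (t₀ - δ) (t₀ + δ) (by linarith) hδa hδb
      (by linarith) (by linarith)
      (slab i₀ (2 * (t₀ - δ) * L - 1 / 2) (2 * (t₀ + δ) * L + 1 / 2)) (1 / 3 * l⁻¹)
      ((6 * δ + 1) * l) (measurableSet_box _ _) (by positivity) (by positivity) (by
        rw [volume_slab]
        refine ENNReal.ofReal_le_ofReal ?_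
        rw [hL]; linarith)
      (fun _ t ht y hy i => by
        have h1 := abs_le.1 (hy.abs_apply_le i)
        by_cases hi : i = i₀
        · have h2 : (t₀ - δ) * L ≤ t * L := by gcongr; exact ht.1
          have h3 : t * L ≤ (t₀ + δ) * L := by gcongr; exact ht.2
          simp only [hi, if_true]
          rw [hi] at h1
          simp at h1
          constructor <;> linarith
        · simp only [hi, if_false]
          simp [hi] at h1
          constructor <;> linarith)
      -- A tube of unit width and speed `2L` covers a point for time `1/(2L) = 1/(3l)`.
      (fun y _ => by
        refine (measure_mono (t := Set.Icc ((y i₀ - 1 / 2) / (2 * L)) ((y i₀ + 1 / 2) / (2 * L)))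
          fun t ht => ?_).trans_eq ?_
        · obtain ⟨_, _, hy⟩ := ht
          have h1 := abs_le.1 (hy.abs_apply_le i₀)
          simp at h1
          rw [Set.mem_Icc, div_le_iff₀ (by positivity), le_div_iff₀ (by positivity)]
          constructor <;> linarith
        · rw [Real.volume_Icc]
          congr 1
          rw [hL]; field_simp; ring)
    rw [Fintype.card_unit, Nat.cast_one, Real.one_rpow, one_mul, mul_one,
      Real.mul_rpow (by norm_num) (by positivity), Real.mul_rpow (by positivity) hl0.le] at this
    have e1 : l⁻¹ ^ (1 - 2 * r⁻¹.toReal) = l ^ (-(1 - 2 * r⁻¹.toReal)) := by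
      rw [Real.rpow_neg hl0.le, Real.inv_rpow hl0.le]
    have e2 : (2 : ℝ) ^ (2 * (j * α)) = l ^ (2 * α) := by
      rw [hl, ← Real.rpow_natCast, ← Real.rpow_mul (by norm_num)]; congr 1; ring
    rw [Real.rpow_zero, Real.rpow_add hl0, Real.rpow_add hl0, div_mul_eq_mul_div,
      le_div_iff₀ (by positivity)]
    rw [e1, e2] at this
    calc 1 * (2 * δ) = t₀ + δ - (t₀ - δ) := by ring
      _ ≤ _ := this
      _ = _ := by ring
  have := exponent_le_of_forall_dyadic 1 main
  linarith

/-- Time `0` must be avoided: data are measured there, and the focusing and Besicovitch–Keich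
examples need them spread out then but concentrated at the observation time. -/
lemma exists_ne_zero_mem_Ioo {a b : ℝ} (hab : a < b) : ∃ t ∈ Set.Ioo a b, t ≠ 0 := by
  by_cases h : (a + b) / 2 = 0
  · exact ⟨(a + 3 * b) / 4, ⟨by linarith, by linarith⟩, by intro h'; linarith⟩
  · exact ⟨(a + b) / 2, ⟨by linarith, by linarith⟩, h⟩

/-- A time interval away from `0`, described up to reflection. -/
lemma exists_signed_time_interval {a b : ℝ} (hab : a < b) : ∃ t₀ σ τ δ : ℝ,
    (σ = 1 ∨ σ = -1) ∧ t₀ = σ * τ ∧ 0 < τ ∧ 0 < δ ∧ δ ≤ 1 / 2 ∧ δ ≤ τ / 2 ∧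
      a ≤ t₀ - δ ∧ t₀ + δ ≤ b := by
  obtain ⟨t₀, ht, ht0⟩ := exists_ne_zero_mem_Ioo hab
  obtain ⟨δ, h0, h1, h2, h3⟩ := exists_time_interval ht
  have hpos : 0 < |t₀| := abs_pos.2 ht0
  have hm : min δ (|t₀| / 2) ≤ δ := min_le_left _ _
  have hm2 : min δ (|t₀| / 2) ≤ |t₀| / 2 := min_le_right _ _
  have hm3 : 0 < min δ (|t₀| / 2) := lt_min h0 (by positivity)
  rcases lt_or_gt_of_ne ht0 with h | h
  · exact ⟨t₀, -1, |t₀|, min δ (|t₀| / 2), Or.inr rfl, by rw [abs_of_neg h]; ring, hpos, hm3,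
      by linarith, hm2, by linarith, by linarith⟩
  · exact ⟨t₀, 1, |t₀|, min δ (|t₀| / 2), Or.inl rfl, by rw [abs_of_pos h]; ring, hpos, hm3,
      by linarith, hm2, by linarith, by linarith⟩

/-! ### Besicovitch–Keich lines in space-time. -/

lemma digitSum_mem_Icc {n : ℕ} (e : Fin n → Bool) {z : ℕ → ℝ} {A B : ℝ}
    (hz : ∀ i, z i ∈ Set.Icc A B) :
    digitSum e z ∈ Set.Icc (A * digitSum e (fun _ => 1)) (B * digitSum e (fun _ => 1)) := by
  have h1 := digitSum_nonneg e (c := fun i => z i - A) fun i => by linarith [(hz i).1]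
  have h2 := digitSum_nonneg e (c := fun i => B - z i) fun i => by linarith [(hz i).2]
  rw [digitSum_sub, digitSum_const] at h1 h2
  constructor <;> linarith

lemma digitSum_one_mem_Icc {n : ℕ} (e : Fin n → Bool) :
    digitSum e (fun _ => 1) ∈ Set.Icc (0 : ℝ) 1 := by
  refine ⟨digitSum_nonneg e fun _ => zero_le_one, ?_⟩
  have h1 := abs_digitSum_le e (c := fun _ => 1) (B := 1) fun _ => by simp
  have h2 : (0 : ℝ) ≤ (1 / 2) ^ n := by positivity
  linarith [le_abs_self (digitSum e fun _ => 1)]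

lemma natCast_le_two_pow (m : ℕ) : (m : ℝ) ≤ 2 ^ m := by exact_mod_cast Nat.lt_two_pow_self.le

/-- A Besicovitch–Keich configuration of lines `g e * (x - y e) = 2 * l * t` in the plane. -/
lemma exists_keich_configuration {τ δ : ℝ} (hτ : 0 < τ) (hδ : 0 < δ) (hδτ : δ ≤ τ / 2) {m : ℕ}
    (hm : 0 < m) {l : ℝ} (hl : l = 2 ^ (2 * m)) :
    ∃ (g y : (Fin (2 * m) → Bool) → ℝ) (γ : ℝ),
      (∀ e, 11 / 20 ≤ g e) ∧ (∀ e, g e ≤ 3 / 4) ∧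
      (∀ e e', e ≠ e' → τ / 15 ≤ |y e - y e'|) ∧
      (∀ e x, 2 * l * (τ - δ) ≤ g e * (x - y e) → g e * (x - y e) ≤ 2 * l * (τ + δ) →
        x ∈ Set.Icc γ (γ + 80 / 11 * (l * δ))) ∧
      ∀ x ∈ Set.Icc γ (γ + 80 / 11 * (l * δ)), ∃ (T : Finset ℝ) (k : ℝ), 0 ≤ k ∧
        (∀ e, ∃ θ ∈ T, |g e * (x - y e) - θ| ≤ k) ∧
        (T.card : ℝ) * k ≤ 16 / 11 * (l * δ) / m ∧ (T.card : ℝ) ≤ 2 ^ m := by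
  classical
  have hl0 : 0 < l := by rw [hl]; positivity
  -- Before `γ` every line has `g (x - y) ≤ 11x/20`, after `γ + w` it has `≥ 11x/20`. The window
  -- `[γ, γ + w]` is where `11x/20` runs from `2l(τ - δ)` to `2l(τ + δ)`, so all lines lie over it
  -- during the time interval.
  obtain ⟨γ, hγ⟩ : ∃ γ, γ * (11 / 20) = 2 * l * (τ - δ) := ⟨2 * l * (τ - δ) / (11 / 20), by ring⟩
  obtain ⟨w, hw⟩ : ∃ w, w = 80 / 11 * (l * δ) := ⟨_, rfl⟩
  have hw0 : 0 < w := by rw [hw]; positivity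
  have hγ0 : l * τ ≤ γ * (11 / 20) := by
    have := mul_le_mul_of_nonneg_left hδτ hl0.le
    linarith
  have hγpos : 0 < γ := by
    have : 0 < l * τ := by positivity
    linarith
  have hβγ : γ + w ≤ 3 * γ := by
    have := mul_le_mul_of_nonneg_left hδτ hl0.le
    linarith
  have hzmem : ∀ i, keichNode (γ + w) w m i ∈ Set.Icc γ (γ + w) := fun i => by
    have := keichNode_mem (β := γ + w) hw0.le hm i
    rwa [add_sub_cancel_right] at this
  have hzanti := keichNode_antitone (β := γ + w) hw0.le m
  have hcover := fun x (h1 : γ ≤ x) (h2 : x ≤ γ + w) =>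
    exists_keich_cover hm (β := γ + w) (w := w) (x := x) hw0 (by linarith) h2
  rw [← hw]
  generalize keichNode (γ + w) w m = z at hzmem hzanti hcover
  have hP : ∀ (e : Fin (2 * m) → Bool) x, digitSum e (fun i => x - z i) =
      x * digitSum e (fun _ => 1) - digitSum e z := fun e x => by
    rw [digitSum_sub e (fun _ => x) z, digitSum_const]
  have hsep : ∀ e e' : Fin (2 * m) → Bool, e ≠ e' → ∀ y ≤ 4 / 5 * γ,
      (1 / 2) ^ (2 * m) * (1 / 5 * γ) ≤ |(digitSum e z - y * digitSum e (fun _ => 1)) -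
        (digitSum e' z - y * digitSum e' (fun _ => 1))| := fun e e' hne y hy => by
    have h1 := le_abs_digitSum_sub hne (c := fun i => z i - y) (fun i k hik => by
        have := hzanti hik
        simp only; linarith) (κ := 1 / 5 * γ) (by positivity) fun i => by
          linarith [(hzmem i).1]
    have h2 : ∀ e₁ : Fin (2 * m) → Bool, digitSum e₁ (fun i => z i - y) =
        digitSum e₁ z - y * digitSum e₁ (fun _ => 1) := fun e₁ => by
      rw [digitSum_sub e₁ z (fun _ => y), digitSum_const]
    rwa [h2, h2] at h1
  simp only [hP] at hcover
  have hS01 : ∀ e : Fin (2 * m) → Bool, 0 ≤ digitSum e (fun _ => 1) ∧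
    digitSum e (fun _ => 1) ≤ 1 := fun e => digitSum_one_mem_Icc e
  have hZmem : ∀ e : Fin (2 * m) → Bool, γ * digitSum e (fun _ => 1) ≤ digitSum e z ∧
    digitSum e z ≤ (γ + w) * digitSum e (fun _ => 1) := fun e => digitSum_mem_Icc e hzmem

  clear hP
  obtain ⟨S, hS⟩ : ∃ S : (Fin (2 * m) → Bool) → ℝ, ∀ e, digitSum e (fun _ => 1) = S e :=
    ⟨_, fun _ => rfl⟩
  obtain ⟨Z, hZ⟩ : ∃ Z : (Fin (2 * m) → Bool) → ℝ, ∀ e, digitSum e z = Z e :=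
    ⟨_, fun _ => rfl⟩
  simp only [hS, hZ] at hS01 hZmem hsep hcover
  have hg0 : ∀ e, 0 < 11 / 20 + 1 / 5 * S e := fun e => by linarith [(hS01 e).1]
  -- The point `y e` is where line `e` meets time `0`. With it, `2lt = g (x - y)` is the digit-sum
  -- line `(x S - Z)/5` plus the common term `11x/20`, which only shifts the slices.
  obtain ⟨y, hy⟩ : ∃ y : (Fin (2 * m) → Bool) → ℝ,
      ∀ e, (11 / 20 + 1 / 5 * S e) * y e = 1 / 5 * Z e :=
    ⟨fun e => 1 / 5 * Z e / (11 / 20 + 1 / 5 * S e), fun e => mul_div_cancel₀ _ (hg0 e).ne'⟩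
  have hgy : ∀ e x, (11 / 20 + 1 / 5 * S e) * (x - y e) = 11 / 20 * x + 1 / 5 * (x * S e - Z e) :=
    fun e x => by rw [mul_sub, hy]; ring
  refine ⟨fun e => 11 / 20 + 1 / 5 * S e, y, γ, fun e => by linarith [(hS01 e).1],
    fun e => by linarith [(hS01 e).2], fun e e' hne => ?_, fun e x h1 h2 => ?_, fun x hx => ?_⟩
  -- Since `Z ≤ 3γS`, `y e` is at most `(3γ/5)S / (11/20 + S/5)`, whose maximum, at `S = 1`, is
  -- `4γ/5`. Thus `y e` is at distance at least `γ/5` from all nodes and the separation of digit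
  -- sums applies there.
  · have hyγ : y e ≤ 4 / 5 * γ := by
      refine le_of_mul_le_mul_left ?_ (hg0 e)
      rw [hy]
      have h1 := (hZmem e).2
      have h2 := mul_le_mul_of_nonneg_right hβγ (hS01 e).1
      have h3 := mul_le_mul_of_nonneg_left (hS01 e).2 hγpos.le
      linarith
    have h1 := hsep e e' hne (y e) hyγ
    have h2 : Z e - y e * S e - (Z e' - y e * S e') =
        5 * ((11 / 20 + 1 / 5 * S e') * (y e - y e')) := by
      linear_combination 5 * hy e' - 5 * hy e
    rw [h2, abs_mul, abs_mul, abs_of_pos (hg0 e'), abs_of_pos (by norm_num : (0 : ℝ) < 5)] at h1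
    have h6 : (1 / 2 : ℝ) ^ (2 * m) * l = 1 := by rw [hl, ← mul_pow]; norm_num
    have h7 : (1 / 2 : ℝ) ^ (2 * m) * (l * τ) ≤ (1 / 2 : ℝ) ^ (2 * m) * (γ * (11 / 20)) := by
      gcongr
    have h8 : (11 / 20 + 1 / 5 * S e') * |y e - y e'| ≤ 3 / 4 * |y e - y e'| :=
      mul_le_mul_of_nonneg_right (by linarith [(hS01 e').2]) (abs_nonneg _)
    rw [← mul_assoc, h6] at h7
    linarith
  · rw [hgy] at h1 h2
    constructor
    · by_contra! hlt
      have h4 := mul_le_mul_of_nonneg_right hlt.le (hS01 e).1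
      linarith [(hZmem e).1]
    · by_contra! hlt
      have h4 := mul_le_mul_of_nonneg_right hlt.le (hS01 e).1
      linarith [(hZmem e).2]
  · obtain ⟨T, k, hk, hT, hTk, hT2⟩ := hcover x hx.1 hx.2
    -- The covering intervals `[θ, θ + k]` are recentred at their midpoints and scaled by `1/5`, so
    -- their half-length is `k/10`.
    refine ⟨T.image fun θ => 11 / 20 * x + 1 / 5 * (θ + k / 2), k / 10, by positivity,
      fun e => ?_, ?_, ?_⟩
    · obtain ⟨θ, hθ, h1, h2⟩ := hT e
      refine ⟨_, Finset.mem_image_of_mem _ hθ, ?_⟩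
      rw [hgy, abs_le]
      constructor <;> linarith
    · have hc : ((T.image fun θ => 11 / 20 * x + 1 / 5 * (θ + k / 2)).card : ℝ) ≤ T.card := by
        exact_mod_cast Finset.card_image_le
      calc _ ≤ (T.card : ℝ) * (k / 10) := by gcongr
        _ = T.card * k / 10 := by ring
        _ ≤ 2 * w / m / 10 := by gcongr
        _ = _ := by rw [hw]; ring
    · have hc : ((T.image fun θ => 11 / 20 * x + 1 / 5 * (θ + k / 2)).card : ℝ) ≤ T.card := by
        exact_mod_cast Finset.card_image_le
      exact hc.trans hT2

/-- Wave packets moving along a Besicovitch–Keich configuration of lines in the plane spanned by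
one space direction and time. -/
lemma FrequencyEstimate.exists_keich_time_bound {p q r : ℝ≥0∞} {α a b : ℝ}
    (h : FrequencyEstimate d p q r α a b) (hd : 1 ≤ d) (hab : a < b) (hp : 2 ≤ p) (hq : 2 ≤ q)
    (hr : 2 ≤ r) : ∃ (K : ℝ) (m₀ : ℕ), ∀ m : ℕ, m₀ ≤ m →
      ((2 : ℝ) ^ (2 * m)) ^ (2 * q⁻¹.toReal - 2 * p⁻¹.toReal - 2 * α) ≤
        K * (1 / (m : ℝ)) ^ (1 - 2 * r⁻¹.toReal) := by
  obtain ⟨t₀, σ, τ, δ, hσ, hστ, hτ, hδ, hδ1, hδτ, hδa, hδb⟩ := exists_signed_time_interval hab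
  have hσσ : σ * σ = 1 := by rcases hσ with rfl | rfl <;> norm_num
  have hσabs : |σ| = 1 := by rcases hσ with rfl | rfl <;> norm_num
  obtain ⟨C, hC, h⟩ := h.packet_inequality hp hq hr t₀ (s := τ / 15) (by positivity)
  obtain ⟨i₀, -⟩ : ∃ i₀ : Fin d, i₀ = ⟨0, hd⟩ := ⟨_, rfl⟩
  obtain ⟨m₁, hm₁⟩ := exists_nat_gt (1 / δ)
  refine ⟨C * (8 * δ + 1) ^ (1 - 2 * r⁻¹.toReal) * (8 * δ) ^ (1 - 2 * q⁻¹.toReal) / δ,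
    max m₁ 2, fun m hm => ?_⟩
  have hm2 : 2 ≤ m := (le_max_right _ _).trans hm
  have hm0 : 0 < m := by omega
  have hmr : (0 : ℝ) < m := by exact_mod_cast hm0
  obtain ⟨l, hl⟩ : ∃ l : ℝ, l = 2 ^ (2 * m) := ⟨_, rfl⟩
  have hl0 : 0 < l := by rw [hl]; positivity
  have hlm : l = 2 ^ m * 2 ^ m := by rw [hl, two_mul, pow_add]
  have hl16 : 16 ≤ l := by
    calc (16 : ℝ) = 2 ^ (2 * 2) := by norm_num
      _ ≤ 2 ^ (2 * m) := pow_le_pow_right₀ (by norm_num) (by omega)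
      _ = l := hl.symm
  have hlδ : 1 < l * δ := by
    have h1 : (m₁ : ℝ) ≤ m := by exact_mod_cast (le_max_left _ _).trans hm
    have h2 := natCast_le_two_pow m
    have h3 : (1 : ℝ) ≤ 2 ^ m := one_le_pow₀ (by norm_num)
    have h4 : 1 / δ < l := by
      rw [hlm]
      calc 1 / δ < 2 ^ m := by linarith
        _ ≤ 2 ^ m * 2 ^ m := le_mul_of_one_le_left (by positivity) h3
    rwa [div_lt_iff₀ hδ] at h4
  obtain ⟨g, y, γ, hg1, hg2, hsep, hslab, hcover⟩ :=
    exists_keich_configuration hτ hδ hδτ hm0 hl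
  have hg0 : ∀ e, 0 < g e := fun e => by linarith [hg1 e]
  -- A tube of half-width `1/2` thickens its line by at most `g/2 ≤ 3/8` in the variable `2lσt`; the
  -- sign `σ` treats negative times by reflection.
  have hcross : ∀ e t (x : Space d), InTube (EuclideanSpace.single i₀ (y e))
      (EuclideanSpace.single i₀ (σ * (l / g e))) x t →
      |2 * l * (σ * t) - g e * (x i₀ - y e)| ≤ 3 / 8 := fun e t x hx => by
    have h1 := hx.abs_apply_le i₀
    simp only [PiLp.single_apply, if_true] at h1
    have e1 : 2 * l * (σ * t) - g e * (x i₀ - y e) =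
        -(g e * (x i₀ - y e - 2 * t * (σ * (l / g e)))) := by
      have := (hg0 e).ne'
      field_simp
      ring
    rw [e1, abs_neg, abs_mul, abs_of_pos (hg0 e)]
    calc g e * |x i₀ - y e - 2 * t * (σ * (l / g e))| ≤ 3 / 4 * (1 / 2) := by
          gcongr; exact hg2 e
      _ = 3 / 8 := by norm_num
  have key := h (2 * m) (fun e => EuclideanSpace.single i₀ (y e))
    (fun e => EuclideanSpace.single i₀ (σ * (l / g e)))
    (fun e e' hne => by
      refine le_trans ?_ (PiLp.norm_apply_le _ i₀)
      simp only [PiLp.sub_apply, PiLp.single_apply, if_true, Real.norm_eq_abs]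
      exact hsep e e' hne)
    (fun e => by
      rw [norm_single_real, abs_mul, hσabs, one_mul, abs_of_pos (div_pos hl0 (hg0 e)), pow_succ,
        ← hl, le_div_iff₀ (hg0 e), div_le_iff₀ (hg0 e)]
      constructor
      · calc (l + 1) * g e ≤ (l + 1) * (3 / 4) := by gcongr; exact hg2 e
          _ ≤ l := by linarith
      · calc l ≤ (l * 2 - 1) * (11 / 20) := by linarith
          _ ≤ _ := mul_le_mul_of_nonneg_left (hg1 e) (by linarith))
    -- Half of the available interval is used: the slack `lδ > 1` absorbs the thickness `3/8` and
    -- keeps the tubes over the window.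
    (t₀ - δ / 2) (t₀ + δ / 2) (by linarith) (by linarith) (by linarith) (by linarith)
    (by linarith) (slab i₀ γ (γ + 80 / 11 * (l * δ))) ((8 * δ + 1) * (1 / m)) (8 * δ * l)
    (measurableSet_box _ _) (by positivity) (by positivity) (by
      rw [volume_slab]
      refine ENNReal.ofReal_le_ofReal ?_
      linarith)
    (fun e t ht x hx i => by
      by_cases hi : i = i₀
      · simp only [hi, if_true]
        have h2 := abs_le.1 (hcross e t x hx)
        have ht' : |σ * t - τ| ≤ δ / 2 := by
          have : σ * t - τ = σ * (t - t₀) := by rw [hστ, mul_sub, ← mul_assoc, hσσ, one_mul]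
          rw [this, abs_mul, hσabs, one_mul, abs_le]
          constructor <;> linarith [ht.1, ht.2]
        have h3 := abs_le.1 ht'
        have h4 := mul_le_mul_of_nonneg_left h3.1 hl0.le
        have h5 := mul_le_mul_of_nonneg_left h3.2 hl0.le
        exact hslab e (x i₀) (by linarith) (by linarith)
      · have h1 := abs_le.1 (hx.abs_apply_le i)
        simp only [hi, if_false]
        simp [hi] at h1
        constructor <;> linarith)
    (fun x hx => by
      have hx0 : x i₀ ∈ Set.Icc γ (γ + 80 / 11 * (l * δ)) := by
        have := hx i₀
        simpa using this
      obtain ⟨T, k, hk0, hT, hTk, hT2⟩ := hcover (x i₀) hx0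
      have hsub : {t | t ∈ Set.Icc (t₀ - δ / 2) (t₀ + δ / 2) ∧ ∃ e, InTube
          (EuclideanSpace.single i₀ (y e)) (EuclideanSpace.single i₀ (σ * (l / g e))) x t} ⊆
          ⋃ θ ∈ T, Metric.closedBall (σ * (θ / (2 * l))) ((k + 1) / (2 * l)) := by
        rintro t ⟨-, e, he⟩
        obtain ⟨θ, hθT, hθ⟩ := hT e
        refine Set.mem_iUnion₂.2 ⟨θ, hθT, ?_⟩
        have h2 := hcross e t x he
        rw [Metric.mem_closedBall, Real.dist_eq]
        have h3 : t - σ * (θ / (2 * l)) = σ * ((2 * l * (σ * t) - θ) / (2 * l)) := by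
          have : t = σ * σ * t := by rw [hσσ, one_mul]
          field_simp
          linear_combination 2 * l * this
        rw [h3, abs_mul, hσabs, one_mul, abs_div, abs_of_pos (by positivity : 0 < 2 * l)]
        gcongr
        have := abs_sub_le (2 * l * (σ * t)) (g e * (x i₀ - y e)) θ
        linarith
      refine (measure_mono hsub).trans ((measure_biUnion_finset_le _ _).trans ?_)
      simp only [Real.volume_closedBall, Finset.sum_const, nsmul_eq_mul]
      rw [← ENNReal.ofReal_natCast, ← ENNReal.ofReal_mul (by positivity)]
      refine ENNReal.ofReal_le_ofReal ?_
      have e1 : (T.card : ℝ) * (2 * ((k + 1) / (2 * l))) = (T.card * k + T.card) / l := by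
        field_simp
      rw [e1, div_le_iff₀ hl0]
      -- The unit thickness adds one unit per covering interval, negligible because `2^m · m ≤ l`.
      -- This is why `2m` digits are used with only `m` distinct nodes.
      have h6 : (T.card : ℝ) * m ≤ l := by
        rw [hlm]
        exact mul_le_mul hT2 (natCast_le_two_pow m) hmr.le (by positivity)
      have h7 : (T.card : ℝ) ≤ l / m := by rwa [le_div_iff₀ hmr]
      calc (T.card : ℝ) * k + T.card ≤ 16 / 11 * (l * δ) / m + l / m := add_le_add hTk h7
        _ = (16 / 11 * δ + 1) * (l / m) := by ring
        _ ≤ (8 * δ + 1) * (l / m) := by gcongr; linarith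
        _ = _ := by ring)
  have hcard : (Fintype.card (Fin (2 * m) → Bool) : ℝ) = l := by
    rw [Fintype.card_fun, Fintype.card_bool, Fintype.card_fin, hl]; push_cast; rfl
  rw [hcard, Real.mul_rpow (by positivity) (by positivity), Real.mul_rpow (by positivity) hl0.le]
    at key
  have e2 : (2 : ℝ) ^ (2 * (((2 * m : ℕ) : ℝ) * α)) = l ^ (2 * α) := by
    rw [hl, ← Real.rpow_natCast, ← Real.rpow_mul (by norm_num)]; congr 1; ring
  rw [e2] at key
  have e3 : l = l ^ (2 * q⁻¹.toReal - 2 * p⁻¹.toReal - 2 * α) *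
      (l ^ (1 - 2 * q⁻¹.toReal) * l ^ (2 * α) * l ^ (2 * p⁻¹.toReal)) := by
    rw [← Real.rpow_add hl0, ← Real.rpow_add hl0, ← Real.rpow_add hl0]
    conv_lhs => rw [← Real.rpow_one l]
    congr 1; ring
  have hQ0 : 0 < l ^ (1 - 2 * q⁻¹.toReal) * l ^ (2 * α) * l ^ (2 * p⁻¹.toReal) := by positivity
  rw [div_mul_eq_mul_div, le_div_iff₀ hδ, ← hl]
  refine le_of_mul_le_mul_right ?_ hQ0
  calc _ = (l ^ (2 * q⁻¹.toReal - 2 * p⁻¹.toReal - 2 * α) *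
      (l ^ (1 - 2 * q⁻¹.toReal) * l ^ (2 * α) * l ^ (2 * p⁻¹.toReal))) * δ := by ring
    _ = l * δ := by rw [← e3]
    _ = l * (t₀ + δ / 2 - (t₀ - δ / 2)) := by ring
    _ ≤ _ := key
    _ = _ := by ring

/-- The contribution of a Besicovitch–Keich configuration in space-time. -/
lemma FrequencyEstimate.inv_sub_inv_le' {p q r : ℝ≥0∞} {α a b : ℝ}
    (h : FrequencyEstimate d p q r α a b) (hd : 1 ≤ d) (hab : a < b) (hp : 2 ≤ p) (hq : 2 ≤ q)
    (hr : 2 ≤ r) : q⁻¹.toReal - p⁻¹.toReal ≤ α := by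
  obtain ⟨K, m₀, hK⟩ := h.exists_keich_time_bound hd hab hp hq hr
  have hθ : 0 ≤ 1 - 2 * r⁻¹.toReal := by linarith [inv_toReal_le_half hr]
  -- The frequency scale is `2^(2m)`, so the exponent is doubled to compare powers of `2^m`.
  have := exponent_le_of_forall_dyadic (x := 2 * (2 * q⁻¹.toReal - 2 * p⁻¹.toReal - 2 * α)) (y := 0)
    (K := max K 0) m₀ fun m hm => by
      have h1 := hK m hm
      rw [mul_comm 2 m, pow_mul, ← Real.rpow_natCast ((2 : ℝ) ^ m) 2,
        ← Real.rpow_mul (by positivity)] at h1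
      rw [Real.rpow_zero, mul_one]
      refine h1.trans ?_
      have h2 : (1 / (m : ℝ)) ^ (1 - 2 * r⁻¹.toReal) ≤ 1 := by
        refine Real.rpow_le_one (by positivity) ?_ hθ
        rw [one_div]
        exact Nat.cast_inv_le_one m
      have h3 : 0 ≤ (1 / (m : ℝ)) ^ (1 - 2 * r⁻¹.toReal) := by positivity
      calc K * (1 / (m : ℝ)) ^ (1 - 2 * r⁻¹.toReal)
          ≤ max K 0 * (1 / (m : ℝ)) ^ (1 - 2 * r⁻¹.toReal) := by gcongr; exact le_max_left _ _
        _ ≤ max K 0 * 1 := by gcongr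
        _ = _ := mul_one _
  linarith

lemma not_forall_one_le_mul_rpow {θ : ℝ} (hθ : 0 < θ) (K : ℝ) (m₀ : ℕ) :
    ¬ ∀ m : ℕ, m₀ ≤ m → 1 ≤ K * (1 / (m : ℝ)) ^ θ := by
  intro h
  have h1 : Filter.Tendsto (fun m : ℕ => K * (1 / (m : ℝ)) ^ θ) Filter.atTop (nhds (K * 0)) := by
    refine Filter.Tendsto.const_mul K ?_
    have := (tendsto_rpow_neg_atTop hθ).comp (tendsto_natCast_atTop_atTop (R := ℝ))
    refine this.congr fun m => ?_
    simp only [Function.comp]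
    rw [Real.rpow_neg (by positivity), one_div, Real.inv_rpow (by positivity)]
  have h2 := ge_of_tendsto h1 (Filter.eventually_atTop.2 ⟨m₀, h⟩)
  linarith

/-- The logarithmic gain of a Besicovitch–Keich configuration in space-time. -/
lemma FrequencyEstimate.inv_sub_inv_lt {p q r : ℝ≥0∞} {α a b : ℝ}
    (h : FrequencyEstimate d p q r α a b) (hd : 1 ≤ d) (hab : a < b) (hp : 2 ≤ p) (hq : 2 ≤ q)
    (hr : 2 < r) : q⁻¹.toReal - p⁻¹.toReal < α := by
  -- At equality the power of `l` is `1`, and the remaining factor `m^(-(1-2/r))` tends to `0`.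
  refine lt_of_le_of_ne (h.inv_sub_inv_le' hd hab hp hq hr.le) fun heq => ?_
  obtain ⟨K, m₀, hK⟩ := h.exists_keich_time_bound hd hab hp hq hr.le
  have hθ : 0 < 1 - 2 * r⁻¹.toReal := by
    have : r⁻¹.toReal < (2 : ℝ≥0∞)⁻¹.toReal :=
      ENNReal.toReal_strict_mono (by simp) (ENNReal.inv_lt_inv.2 hr)
    rw [ENNReal.toReal_inv 2, ENNReal.toReal_ofNat] at this
    linarith
  refine not_forall_one_le_mul_rpow hθ K m₀ fun m hm => ?_
  have h1 := hK m hm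
  have h2 : 2 * q⁻¹.toReal - 2 * p⁻¹.toReal - 2 * α = 0 := by linarith
  rwa [h2, Real.rpow_zero] at h1

/-! ### Besicovitch–Keich lines in two space directions. -/

/-- A Besicovitch–Keich configuration of lines `h e + S e * x / 4` in the plane. -/
lemma exists_keich_lines {m : ℕ} (hm : 0 < m) (γ : ℝ) {w : ℝ} (hw : 0 < w) :
    ∃ S h : (Fin (2 * m) → Bool) → ℝ, (∀ e, 0 ≤ S e ∧ S e ≤ 1) ∧
      (∀ e e', e ≠ e' → ∀ k ≤ γ,
        (1 / 2) ^ (2 * m) * (γ - k) ≤ 4 * |(h e + S e * k / 4) - (h e' + S e' * k / 4)|) ∧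
      ∀ x ∈ Set.Icc γ (γ + w), ∃ (T : Finset ℝ) (κ : ℝ), 0 ≤ κ ∧
        (∀ e, ∃ θ ∈ T, θ ≤ h e + S e * x / 4 ∧ h e + S e * x / 4 ≤ θ + κ) ∧
        (T.card : ℝ) * κ ≤ w / m ∧ (T.card : ℝ) ≤ 2 ^ m := by
  classical
  have hzmem : ∀ i, keichNode (γ + w) w m i ∈ Set.Icc γ (γ + w) := fun i => by
    have := keichNode_mem (β := γ + w) hw.le hm i
    rwa [add_sub_cancel_right] at this
  have hzanti := keichNode_antitone (β := γ + w) hw.le m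
  have hcover := fun x (h1 : γ ≤ x) (h2 : x ≤ γ + w) =>
    exists_keich_cover hm (β := γ + w) (w := w) (x := x) hw (by linarith) h2
  generalize keichNode (γ + w) w m = z at hzmem hzanti hcover
  have hP : ∀ (e : Fin (2 * m) → Bool) x, digitSum e (fun i => x - z i) =
      x * digitSum e (fun _ => 1) - digitSum e z := fun e x => by
    rw [digitSum_sub e (fun _ => x) z, digitSum_const]
  refine ⟨fun e => digitSum e fun _ => 1, fun e => -(digitSum e z / 4),
    fun e => digitSum_one_mem_Icc e, fun e e' hne k hk => ?_, fun x hx => ?_⟩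
  · have h1 := le_abs_digitSum_sub hne (c := fun i => z i - k) (fun i j hij => by
        have := hzanti hij
        simp only; linarith) (κ := γ - k) (by linarith) fun i => by linarith [(hzmem i).1]
    have h2 : ∀ e₁ : Fin (2 * m) → Bool, digitSum e₁ (fun i => z i - k) =
        digitSum e₁ z - k * digitSum e₁ (fun _ => 1) := fun e₁ => by
      rw [digitSum_sub e₁ z (fun _ => k), digitSum_const]
    rw [h2, h2] at h1
    refine h1.trans_eq ?_
    rw [← abs_of_pos (by norm_num : (0 : ℝ) < 4), ← abs_mul, ← abs_neg]
    congr 1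
    rw [abs_of_pos (by norm_num : (0 : ℝ) < 4)]
    ring
  · obtain ⟨T, k, hk, hT, hTk, hT2⟩ := hcover x hx.1 hx.2
    have hc : ((T.image fun θ => θ / 4).card : ℝ) ≤ T.card := by
      exact_mod_cast Finset.card_image_le
    refine ⟨T.image fun θ => θ / 4, k / 4, by positivity, fun e => ?_, ?_, hc.trans hT2⟩
    · obtain ⟨θ, hθ, h1, h2⟩ := hT e
      rw [hP] at h1 h2
      refine ⟨_, Finset.mem_image_of_mem _ hθ, ?_⟩
      constructor <;> linarith
    · have h1 : 0 ≤ w / m := by positivity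
      calc _ ≤ (T.card : ℝ) * (k / 4) := by gcongr
        _ = T.card * k / 4 := by ring
        _ ≤ 2 * w / m / 4 := by gcongr
        _ = w / m / 2 := by ring
        _ ≤ _ := by linarith

/-- The union of neighbourhoods of the lines of a Besicovitch–Keich configuration is small. -/
lemma exists_measurableSet_keich_lines {i₀ i₁ : Fin d} (hi : i₀ ≠ i₁) {m : ℕ} {γ w : ℝ}
    (hw : 0 < w) (hm : 0 < m) {ι : Type} {S h : ι → ℝ} (hS : ∀ e, 0 ≤ S e ∧ S e ≤ 1)
    (hcover : ∀ x ∈ Set.Icc γ (γ + w), ∃ (T : Finset ℝ) (κ : ℝ), 0 ≤ κ ∧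
        (∀ e, ∃ θ ∈ T, θ ≤ h e + S e * x / 4 ∧ h e + S e * x / 4 ≤ θ + κ) ∧
        (T.card : ℝ) * κ ≤ w / m ∧ (T.card : ℝ) ≤ 2 ^ m) :
    ∃ X : Set (Space d), MeasurableSet X ∧
      volume X ≤ ENNReal.ofReal ((w + 1) * (2 * w + 3 * 2 ^ (2 * m)) * (1 / m)) ∧
      ∀ e, ∀ u ∈ Set.Icc γ (γ + w), ∀ x : Space d, |x i₀ - u| ≤ 1 / 2 →
        |x i₁ - (h e + S e * u / 4)| ≤ 1 / 2 → (∀ i, i ≠ i₀ → i ≠ i₁ → |x i| ≤ 1 / 2) →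
        x ∈ X := by
  have hmr : (0 : ℝ) < m := by exact_mod_cast hm
  have hmem : ∀ i ∈ Finset.range (⌊w⌋₊ + 1), γ + (i : ℝ) ∈ Set.Icc γ (γ + w) := fun i hi' => by
    have h1 : (i : ℝ) ≤ ⌊w⌋₊ := by exact_mod_cast Nat.lt_succ_iff.1 (Finset.mem_range.1 hi')
    have h2 := Nat.floor_le hw.le
    have h3 : (0 : ℝ) ≤ i := by positivity
    constructor <;> linarith
  have hc : ∀ i : ℕ, ∃ (T : Finset ℝ) (κ : ℝ), i ∈ Finset.range (⌊w⌋₊ + 1) → 0 ≤ κ ∧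
      (∀ e, ∃ θ ∈ T, θ ≤ h e + S e * (γ + i) / 4 ∧ h e + S e * (γ + i) / 4 ≤ θ + κ) ∧
      (T.card : ℝ) * κ ≤ w / m ∧ (T.card : ℝ) ≤ 2 ^ m := fun i => by
    by_cases hi' : i ∈ Finset.range (⌊w⌋₊ + 1)
    · obtain ⟨T, κ, h1⟩ := hcover _ (hmem i hi')
      exact ⟨T, κ, fun _ => h1⟩
    · exact ⟨∅, 0, fun h => absurd h hi'⟩
  choose T κ hTκ using hc
  -- The lines are sampled at unit steps. Slopes are at most `1/4`, so over a step a line rises by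
  -- at most `1/4`; with the half-width `1/2` of the tube this gives the margin `3/4`.
  refine ⟨⋃ i ∈ Finset.range (⌊w⌋₊ + 1), ⋃ θ ∈ T i,
    slab₂ i₀ i₁ (γ + i - 1 / 2) (γ + i + 3 / 2) (θ - 1 / 2) (θ + κ i + 3 / 4), ?_, ?_, ?_⟩
  · exact Finset.measurableSet_biUnion _ fun i _ => Finset.measurableSet_biUnion _ fun θ _ =>
      measurableSet_box _ _
  · have hstep : ∀ i ∈ Finset.range (⌊w⌋₊ + 1), volume (⋃ θ ∈ T i,
        slab₂ i₀ i₁ (γ + i - 1 / 2) (γ + i + 3 / 2) (θ - 1 / 2) (θ + κ i + 3 / 4)) ≤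
        ENNReal.ofReal ((2 * w + 3 * 2 ^ (2 * m)) * (1 / m)) := fun i hi' => by
      obtain ⟨h0, -, h1, h2⟩ := hTκ i hi'
      refine (measure_biUnion_finset_le _ _).trans ?_
      have e1 : ∀ θ : ℝ, volume (slab₂ i₀ i₁ (γ + i - 1 / 2) (γ + i + 3 / 2) (θ - 1 / 2)
          (θ + κ i + 3 / 4)) = ENNReal.ofReal (2 * (κ i + 5 / 4)) := fun θ => by
        rw [volume_slab₂ hi, ← ENNReal.ofReal_mul (by linarith)]
        congr 1; ring
      simp only [e1, Finset.sum_const, nsmul_eq_mul]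
      rw [← ENNReal.ofReal_natCast, ← ENNReal.ofReal_mul (by positivity)]
      refine ENNReal.ofReal_le_ofReal ?_
      have h6 : ((T i).card : ℝ) * m ≤ 2 ^ (2 * m) := by
        rw [two_mul, pow_add]
        exact mul_le_mul h2 (natCast_le_two_pow m) hmr.le (by positivity)
      have h7 : ((T i).card : ℝ) ≤ 2 ^ (2 * m) / m := by rwa [le_div_iff₀ hmr]
      have h8 : (0 : ℝ) ≤ 2 ^ (2 * m) / m := by positivity
      calc ((T i).card : ℝ) * (2 * (κ i + 5 / 4))
          = 2 * ((T i).card * κ i) + 5 / 2 * (T i).card := by ring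
        _ ≤ 2 * (w / m) + 3 * (2 ^ (2 * m) / m) := by linarith
        _ = _ := by ring
    refine (measure_biUnion_finset_le _ _).trans ((Finset.sum_le_sum hstep).trans ?_)
    rw [Finset.sum_const, Finset.card_range, nsmul_eq_mul, ← ENNReal.ofReal_natCast,
      ← ENNReal.ofReal_mul (by positivity)]
    refine ENNReal.ofReal_le_ofReal ?_
    rw [← mul_assoc]
    have : (((⌊w⌋₊ + 1 : ℕ)) : ℝ) ≤ w + 1 := by
      push_cast; linarith [Nat.floor_le hw.le]
    gcongr
  · intro e u hu x h1 h2 h3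
    have hu0 : 0 ≤ u - γ := by linarith [hu.1]
    have hf1 := Nat.floor_le hu0
    have hf2 := Nat.lt_floor_add_one (u - γ)
    have hir : ⌊u - γ⌋₊ ∈ Finset.range (⌊w⌋₊ + 1) := by
      rw [Finset.mem_range, Nat.lt_succ_iff]
      exact Nat.floor_le_floor (by linarith [hu.2])
    obtain ⟨h0, h4, -, -⟩ := hTκ _ hir
    obtain ⟨θ, hθ, h5, h6⟩ := h4 e
    refine Set.mem_iUnion₂.2 ⟨_, hir, Set.mem_iUnion₂.2 ⟨θ, hθ, fun i => ?_⟩⟩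
    have h1 := abs_le.1 h1
    have h2 := abs_le.1 h2
    by_cases hi0 : i = i₀
    · simp only [hi0, if_true]
      constructor <;> linarith
    · by_cases hi1 : i = i₁
      · simp only [hi1, hi.symm, if_true, if_false]
        have h7 : 0 ≤ S e * (u - (γ + ⌊u - γ⌋₊)) := mul_nonneg (hS e).1 (by linarith)
        have h8 : S e * (u - (γ + ⌊u - γ⌋₊)) ≤ 1 * 1 :=
          mul_le_mul (hS e).2 (by linarith) (by linarith) zero_le_one
        rw [mul_sub] at h7 h8
        constructor <;> linarith
      · simp only [hi0, hi1, if_false]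
        exact abs_le.1 (h3 i hi0 hi1)

/-- The contribution of a Besicovitch–Keich configuration in two space directions. -/
lemma FrequencyEstimate.pos_of_two_le {p : ℝ≥0∞} {α a b : ℝ}
    (h : FrequencyEstimate d p p 2 α a b) (hd : 2 ≤ d) (hab : a < b) (hp : 2 < p) : 0 < α := by
  by_contra! hα
  obtain ⟨t₀, σ, τ, δ, hσ, hστ, hτ, hδ, hδ1, hδτ, hδa, hδb⟩ := exists_signed_time_interval hab
  have hσσ : σ * σ = 1 := by rcases hσ with rfl | rfl <;> norm_num
  have hσabs : |σ| = 1 := by rcases hσ with rfl | rfl <;> norm_num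
  obtain ⟨C, hC, h⟩ := h.packet_inequality hp.le hp.le le_rfl t₀ (s := min 1 (τ / 20))
    (lt_min one_pos (by positivity))
  obtain ⟨i₀, i₁, hi⟩ : ∃ i₀ i₁ : Fin d, i₀ ≠ i₁ :=
    ⟨⟨0, by omega⟩, ⟨1, by omega⟩, by simp [Fin.ext_iff]⟩
  have hθ : 0 < 1 - 2 * p⁻¹.toReal := by
    have : p⁻¹.toReal < (2 : ℝ≥0∞)⁻¹.toReal :=
      ENNReal.toReal_strict_mono (by simp) (ENNReal.inv_lt_inv.2 hp)
    rw [ENNReal.toReal_inv 2, ENNReal.toReal_ofNat] at this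
    linarith
  obtain ⟨m₁, hm₁⟩ := exists_nat_gt (1 / δ)
  -- The first coordinate `k + (13/5) l σt` of a packet ranges over a length `(26/5) l δ` from time
  -- and at most `l τ` from the starting index.
  obtain ⟨W, hW⟩ : ∃ W, W = 26 / 5 * δ + τ := ⟨_, rfl⟩
  have hW0 : 0 < W := by rw [hW]; positivity
  obtain ⟨B, hB⟩ : ∃ B, B = (W + 1) * (2 * W + 3) := ⟨_, rfl⟩
  have hB0 : 0 < B := by rw [hB]; positivity
  refine not_forall_one_le_mul_rpow hθ (C * B ^ (1 - 2 * p⁻¹.toReal) /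
    (2 * δ * (τ / 2) ^ (1 - 2 * p⁻¹.toReal))) (max m₁ 2) fun m hm => ?_
  have hm2 : 2 ≤ m := (le_max_right _ _).trans hm
  have hm0 : 0 < m := by omega
  have hmr : (0 : ℝ) < m := by exact_mod_cast hm0
  obtain ⟨l, hl⟩ : ∃ l : ℝ, l = 2 ^ (2 * m) := ⟨_, rfl⟩
  have hl0 : 0 < l := by rw [hl]; positivity
  have hl16 : 16 ≤ l := by
    calc (16 : ℝ) = 2 ^ (2 * 2) := by norm_num
      _ ≤ 2 ^ (2 * m) := pow_le_pow_right₀ (by norm_num) (by omega)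
      _ = l := hl.symm
  have hlδ : 1 < l * δ := by
    have h1 : (m₁ : ℝ) ≤ m := by exact_mod_cast (le_max_left _ _).trans hm
    have h2 := natCast_le_two_pow m
    have h3 : (1 : ℝ) ≤ 2 ^ m := one_le_pow₀ (by norm_num)
    have h4 : 1 / δ < l := by
      rw [hl, two_mul, pow_add]
      calc 1 / δ < 2 ^ m := by linarith
        _ ≤ 2 ^ m * 2 ^ m := le_mul_of_one_le_left (by positivity) h3
    rwa [div_lt_iff₀ hδ] at h4
  have hlτ : 2 * (l * δ) ≤ l * τ := by
    have := mul_le_mul_of_nonneg_left hδτ hl0.le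
    linarith
  obtain ⟨N, hN⟩ : ∃ N : ℕ, N = ⌊l * τ⌋₊ := ⟨_, rfl⟩
  have hN1 : (N : ℝ) ≤ l * τ := hN ▸ Nat.floor_le (by positivity)
  have hN2 : l * τ / 2 ≤ N := by
    have := Nat.lt_floor_add_one (l * τ)
    rw [← hN] at this
    linarith
  obtain ⟨γ, hγ⟩ : ∃ γ, γ = 13 / 5 * l * (τ - δ) := ⟨_, rfl⟩
  obtain ⟨S, g, hS, hsep, hcover⟩ := exists_keich_lines hm0 γ (w := W * l) (by positivity)
  obtain ⟨X, hXm, hXv, hX⟩ :=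
    exists_measurableSet_keich_lines hi (by positivity) hm0 hS hcover
  -- About `lτ` packets start at unit steps along each spatial line and move along that line, so
  -- they all sweep the same thin set. With `r = 2` the time measure carries the exponent `0`.
  have key := h (2 * m) (ι := Fin N × (Fin (2 * m) → Bool))
    (fun k => EuclideanSpace.single i₀ (k.1 : ℝ) +
      EuclideanSpace.single i₁ (g k.2 + S k.2 * k.1 / 4))
    (fun k => EuclideanSpace.single i₀ (σ * (13 / 10 * l)) +
      EuclideanSpace.single i₁ (σ * (13 / 10 * l * S k.2 / 4)))
    (fun k k' hne => by
      by_cases hk : k.1 = k'.1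
      · have he : k.2 ≠ k'.2 := fun he => hne (Prod.ext hk he)
        refine (min_le_right _ _).trans (le_trans ?_ (PiLp.norm_apply_le _ i₁))
        simp only [PiLp.sub_apply, PiLp.add_apply, PiLp.single_apply, hi.symm, if_true, if_false,
          Real.norm_eq_abs, zero_add, hk]
        have h1 : ((k'.1 : ℕ) : ℝ) ≤ l * τ := by
          have : ((k'.1 : ℕ) : ℝ) ≤ N := by exact_mod_cast k'.1.2.le
          linarith
        -- Since `δ ≤ τ/2`, `γ` is at least `(13/10) l τ`, so starting points stay `(3/10) l τ`
        -- before the window where the lines are compressed, and distinct lines are still separated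
        -- there.
        have h3 : 3 / 10 * (l * τ) ≤ γ - (k'.1 : ℕ) := by rw [hγ]; linarith
        have h0 : 0 ≤ l * τ := by positivity
        have h2 := hsep _ _ he (k'.1 : ℕ) (by linarith)
        have h4 : (1 / 2 : ℝ) ^ (2 * m) * (3 / 10 * (l * τ)) ≤
          (1 / 2 : ℝ) ^ (2 * m) * (γ - (k'.1 : ℕ)) := by gcongr
        have h6 : (1 / 2 : ℝ) ^ (2 * m) * l = 1 := by rw [hl, ← mul_pow]; norm_num
        have h7 : (1 / 2 : ℝ) ^ (2 * m) * (3 / 10 * (l * τ)) = 3 / 10 * τ := by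
          linear_combination 3 / 10 * τ * h6
        linarith
      · refine (min_le_left _ _).trans (le_trans ?_ (PiLp.norm_apply_le _ i₀))
        simp only [PiLp.sub_apply, PiLp.add_apply, PiLp.single_apply, hi, if_true, if_false,
          Real.norm_eq_abs, add_zero]
        have h1 : ((k.1 : ℕ) : ℤ) - ((k'.1 : ℕ) : ℤ) ≠ 0 := by
          have := Fin.val_injective.ne hk
          omega
        have := Int.one_le_abs h1
        exact_mod_cast this)
    (fun k => by
      have h0 := hS k.2
      rw [pow_succ, ← hl]
      constructor
      · refine le_trans ?_ (PiLp.norm_apply_le _ i₀)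
        simp only [PiLp.add_apply, PiLp.single_apply, hi, if_true, if_false, add_zero,
          Real.norm_eq_abs]
        rw [abs_mul, hσabs, one_mul, abs_of_pos (by positivity)]
        linarith
      · refine (norm_add_le _ _).trans ?_
        rw [norm_single_real, norm_single_real, abs_mul σ, abs_mul σ, hσabs, one_mul, one_mul,
          abs_of_pos (by positivity), abs_of_nonneg (by have := h0.1; positivity)]
        have := mul_le_mul_of_nonneg_left h0.2 hl0.le
        linarith)
    (t₀ - δ) (t₀ + δ) (by linarith) hδa hδb (by linarith) (by linarith) X (2 * δ)
    (B * (l * l) * (1 / m)) hXm (by positivity) (by positivity) (hXv.trans (by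
      refine ENNReal.ofReal_le_ofReal ?_
      rw [← hl, hB]
      have h1 : W * l + 1 ≤ (W + 1) * l := by linarith
      calc (W * l + 1) * (2 * (W * l) + 3 * l) * (1 / m)
          ≤ ((W + 1) * l) * (2 * (W * l) + 3 * l) * (1 / m) := by gcongr
        _ = _ := by ring))
    (fun k t ht x hx => by
      have ht' : |σ * t - τ| ≤ δ := by
        have : σ * t - τ = σ * (t - t₀) := by rw [hστ, mul_sub, ← mul_assoc, hσσ, one_mul]
        rw [this, abs_mul, hσabs, one_mul, abs_le]
        constructor <;> linarith [ht.1, ht.2]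
      have h3 := abs_le.1 ht'
      have h4 := mul_le_mul_of_nonneg_left h3.1 hl0.le
      have h5 := mul_le_mul_of_nonneg_left h3.2 hl0.le
      have h6 : ((k.1 : ℕ) : ℝ) ≤ l * τ := by
        have : ((k.1 : ℕ) : ℝ) ≤ N := by exact_mod_cast k.1.2.le
        linarith
      have h7 : (0 : ℝ) ≤ (k.1 : ℕ) := by positivity
      have e0 := hx.abs_apply_le i₀
      have e1 := hx.abs_apply_le i₁
      simp only [PiLp.add_apply, PiLp.single_apply, hi, hi.symm, if_true, if_false, add_zero,
        zero_add] at e0 e1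
      refine hX k.2 ((k.1 : ℕ) + 13 / 5 * l * (σ * t)) ⟨?_, ?_⟩ x ?_ ?_ fun i hi0 hi1 => ?_
      · rw [hγ]; linarith
      · rw [hγ, hW]; linarith
      · refine le_trans (le_of_eq ?_) e0
        congr 1; ring
      · refine le_trans (le_of_eq ?_) e1
        congr 1; ring
      · have := hx.abs_apply_le i
        simpa [hi0, hi1] using this)
    (fun y _ => by
      refine (measure_mono (t := Set.Icc (t₀ - δ) (t₀ + δ)) fun t ht => ht.1).trans_eq ?_
      rw [Real.volume_Icc]; congr 1; ring)
  have hcard : (Fintype.card (Fin N × (Fin (2 * m) → Bool)) : ℝ) = N * l := by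
    rw [Fintype.card_prod, Fintype.card_fun, Fintype.card_bool, Fintype.card_fin,
      Fintype.card_fin, hl]; push_cast; rfl
  have hr0 : (1 : ℝ) - 2 * (2 : ℝ≥0∞)⁻¹.toReal = 0 := by
    rw [ENNReal.toReal_inv 2, ENNReal.toReal_ofNat]; norm_num
  have hα1 : (2 : ℝ) ^ (2 * (((2 * m : ℕ) : ℝ) * α)) ≤ 1 := by
    refine Real.rpow_le_one_of_one_le_of_nonpos (by norm_num) ?_
    have : ((2 * m : ℕ) : ℝ) * α ≤ 0 := mul_nonpos_of_nonneg_of_nonpos (by positivity) hα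
    linarith
  have hn0 : 0 < (N : ℝ) * l := by
    have : 0 < l * τ / 2 := by positivity
    have : (0 : ℝ) < N := by linarith
    positivity
  rw [hcard, hr0, Real.rpow_zero, one_mul] at key
  generalize p⁻¹.toReal = p' at *
  have h1 : ((N : ℝ) * l) ^ (1 - 2 * p') * (2 * δ) ≤
      C * (B * (l * l) * (1 / m)) ^ (1 - 2 * p') := by
    refine le_of_mul_le_mul_right ?_ (Real.rpow_pos_of_pos hn0 (2 * p'))
    calc ((N : ℝ) * l) ^ (1 - 2 * p') * (2 * δ) * ((N : ℝ) * l) ^ (2 * p')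
        = ((N : ℝ) * l) ^ (1 - 2 * p') * ((N : ℝ) * l) ^ (2 * p') * (2 * δ) := by ring
      _ = (N : ℝ) * l * (t₀ + δ - (t₀ - δ)) := by
        rw [← Real.rpow_add hn0, sub_add_cancel, Real.rpow_one]; ring
      _ ≤ _ := key
      _ ≤ C * (B * (l * l) * (1 / m)) ^ (1 - 2 * p') * (1 * ((N : ℝ) * l) ^ (2 * p')) := by
        gcongr
      _ = _ := by ring
  have h2 : (τ / 2 * (l * l)) ^ (1 - 2 * p') ≤ ((N : ℝ) * l) ^ (1 - 2 * p') := by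
    refine Real.rpow_le_rpow (by positivity) ?_ hθ.le
    calc τ / 2 * (l * l) = l * τ / 2 * l := by ring
      _ ≤ _ := by gcongr
  have hll : 0 < (l * l) ^ (1 - 2 * p') := by positivity
  rw [Real.mul_rpow (by positivity) (by positivity)] at h2
  rw [Real.mul_rpow (x := B * (l * l)) (by positivity) (by positivity),
    Real.mul_rpow hB0.le (by positivity)] at h1
  rw [div_mul_eq_mul_div, le_div_iff₀ (by positivity), one_mul]
  refine le_of_mul_le_mul_right ?_ hll
  calc 2 * δ * (τ / 2) ^ (1 - 2 * p') * (l * l) ^ (1 - 2 * p')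
      = (τ / 2) ^ (1 - 2 * p') * (l * l) ^ (1 - 2 * p') * (2 * δ) := by ring
    _ ≤ ((N : ℝ) * l) ^ (1 - 2 * p') * (2 * δ) := by gcongr
    _ ≤ _ := h1
    _ = _ := by ring

end SchrodingerSpaceTime

end

/-! ### Deduction of the six conditions. -/

theorem proposition1p3 (d : ℕ) (hd : 1 ≤ d) (a b : ℝ) (hab : a < b)
    (p q r : ℝ≥0∞) (hp : 2 ≤ p) (hq : 2 ≤ q) (hr : 2 ≤ r) (α : ℝ)
    (hU : SchrodingerSpaceTime.SobolevEstimate d p q r α a b ∨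
      ∃ (χ : SchrodingerSpaceTime.Space d → ℝ) (ν : ℝ≥0∞),
        SchrodingerSpaceTime.IsCutoff χ ∧ 0 < ν ∧
        SchrodingerSpaceTime.BesovEstimate d χ p q r α ν a b) :
    p ≤ q ∧
    (d : ℝ) * (1 - p⁻¹.toReal - q⁻¹.toReal) - 2 * r⁻¹.toReal ≤ α ∧
    q⁻¹.toReal - r⁻¹.toReal ≤ α ∧
    q⁻¹.toReal - p⁻¹.toReal ≤ α ∧
    (2 < r → q⁻¹.toReal - p⁻¹.toReal < α) ∧
    (r = 2 → p = q → 2 < q → 2 ≤ d → 0 < α) := by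
  have h : SchrodingerSpaceTime.FrequencyEstimate d p q r α a b := by
    rcases hU with hU | ⟨χ, ν, hχ, hν, hU⟩
    · exact .of_sobolev hU
    · exact .of_besov hχ (one_le_two.trans hp) hν hU
  refine ⟨?_, ?_, h.inv_sub_inv_le hd hab hp hq hr, h.inv_sub_inv_le' hd hab hp hq hr,
    fun hr' => h.inv_sub_inv_lt hd hab hp hq hr', ?_⟩
  · have h1 := h.inv_le_inv hd hab hp hq hr
    have hne : ∀ x : ℝ≥0∞, 2 ≤ x → x⁻¹ ≠ ⊤ := fun x hx =>
      ENNReal.inv_ne_top.2 (two_pos.trans_le hx).ne'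
    exact ENNReal.inv_le_inv.1 ((ENNReal.toReal_le_toReal (hne q hq) (hne p hp)).1 h1)
  · obtain ⟨t₀, ht₀, hne⟩ := SchrodingerSpaceTime.exists_ne_zero_mem_Ioo hab
    exact h.focusing hd hp hq hr hne ht₀.1.le ht₀.2
  · rintro rfl rfl hp' hd'
    exact h.pos_of_two_le hd' hab hp'
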